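/- Let $\nu>0$, $0<T<\infty$ and $\mathbb{R}^3_+=\{x\in\mathbb{R}^3: x_3>0\}$; write $x=(x_h,x_3)$ with $x_h\in\mathbb{R}^2$, and let $\|\cdot\|$ be the norm and $(\cdot,\cdot)$ the scalar product of $L^2(\mathbb{R}^3_+)$. **Function spaces.** Let $\mathcal V$ be the set of smooth divergence-free vector fields with compact support in $\mathbb{R}^3_+$. Let $H$ be the closure of $\mathcal V$ in $L^2(\mathbb{R}^3_+)^3$ and $V$ the closure of $\mathcal V$ in the homogeneous Sobolev space $\dot W^{1,2}_0(\mathbb{R}^3_+)^3$ (with norm $\|\nabla u\|$, realised as a subspace of $L^6$). **Leray–Hopf weak solutions.** Let $v_0\in H$. A measurable $v:(0,T)\times\mathbb{R}^3_+\to\mathbb{R}^3$ is a Leray–Hopf weak solution of the Navier–Stokes equations in $\mathbb{R}^3_+$ with viscosity $\nu$, zero force, homogeneous Dirichlet boundary condition and initial datum $v_0$ if $v\in L^\infty(0,T;H)\cap L^2(0,T;V)$ and 1. for all $\varphi\in C_0^\infty([0,T)\times\mathbb{R}^3_+)^3$ with $\operatorname{div}\varphi=0$, $$\int_0^T\Big[(v,\partial_t\varphi)-\nu(\nabla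 v,\nabla\varphi)-((v\cdot\nabla)v,\varphi)\Big]\,dt=-(v_0,\varphi(0));$$ 2. $\frac12\|v(t)\|^2+\nu\int_0^t\|\nabla v(\tau)\|^2\,d\tau\le\frac12\|v_0\|^2$ for all $t\in[0,T]$; 3. $\lim_{t\to0^+}\|v(t)-v_0\|=0$. Here, as usual, $v(t)\in H$ denotes for every $t\in[0,T]$ the value of the representative of $v$ that is weakly continuous from $[0,T]$ to $L^2(\mathbb{R}^3_+)^3$. **The horizontal class.** Let $\omega$ be a non-negative non-decreasing function on $(0,\infty)$ with $\lim_{s\to0^+}\omega(s)=0$. We say that $v\in L^2(0,T;\dot C_{\omega,hor}(\mathbb{R}^3_+))$ if there is a non-negative $f\in L^2(0,T)$ such that for almost every $t\in(0,T)$ (a representative of) $v(t)$ satisfies, for almost every $z_3>0$, $$|v(t,x_h,z_3)-v(t,y_h,z_3)|\le f(t)\,\omega(|x_h-y_h|)\qquad\text{for all } x_h\ne y_h\in\mathbb{R}^2.$$ **Theorem.** Let $v$ be a Leray–Hopf weak solution of the Navier–Stokes equations in $\mathbb{R}^3_+$ in the above sense. If $v\in L^2(0,T;\dot C_{\omega,hor}(\mathbb{R}^3_+))$,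 then $v$ conserves energy, that is, $$\frac12\|v(t)\|^2+\nu\int_0^t\|\nabla v(\tau)\|^2\,d\tau=\frac12\|v_0\|^2\qquad\text{for all } t\in[0,T].$$ No assumption is made on the pressure or on vertical increments. -/

import Mathlib

open MeasureTheory Set Filter Topology
open scoped ContDiff RealInnerProductSpace ENNReal NNReal

namespace HalfSpaceNS

noncomputable section

/-- Three-dimensional Euclidean space. -/
abbrev E3 : Type := EuclideanSpace ℝ (Fin 3)

/-- The horizontal plane. -/
abbrev E2 : Type := EuclideanSpace ℝ (Fin 2)

/-- The open half-space `x₃ > 0`. -/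
def Omega : Set E3 := {x | 0 < x 2}

/-- Lebesgue measure on the half-space. -/
def muOmega : Measure E3 := volume.restrict Omega

/-- The point `(x_h, z)` with horizontal part `x_h` and height `z`. -/
def point (xh : E2) (z : ℝ) : E3 := !₂[xh 0, xh 1, z]

/-- The classical partial derivative `∂_j φ (x)`. -/
def pd {F : Type*} [NormedAddCommGroup F] [NormedSpace ℝ F] (j : Fin 3) (φ : E3 → F) (x : E3) : F :=
  fderiv ℝ φ x (EuclideanSpace.single j 1)

/-- The classical divergence of a vector field. -/
def divergence (φ : E3 → E3) (x : E3) : ℝ := ∑ j, (pd j φ x) j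

/-- Smooth divergence-free vector fields with compact support in the open half-space. -/
structure IsTestField (φ : E3 → E3) : Prop where
  smooth : ContDiff ℝ ∞ φ
  compactSupport : HasCompactSupport φ
  support_subset : tsupport φ ⊆ Omega
  div_free : ∀ x, divergence φ x = 0

/-- `g` is the weak partial derivative `∂_j u` in the half-space. -/
def HasWeakPartial (j : Fin 3) (u g : E3 → E3) : Prop :=
  LocallyIntegrableOn u Omega volume ∧ LocallyIntegrableOn g Omega volume ∧
  ∀ η : E3 → ℝ, ContDiff ℝ ∞ η → HasCompactSupport η → tsupport η ⊆ Omega →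
    ∫ x, pd j η x • u x ∂muOmega = - ∫ x, η x • g x ∂muOmega

/-- `u ∈ H`: the closure in `L²` of the test fields. -/
def MemH (u : E3 → E3) : Prop :=
  MemLp u 2 muOmega ∧
  ∃ φ : ℕ → E3 → E3, (∀ n, IsTestField (φ n)) ∧
    Tendsto (fun n => eLpNorm (u - φ n) 2 muOmega) atTop (𝓝 0)

/-- `u ∈ V` with weak gradient `(Du j)_j`: the closure of the test fields in the homogeneous
Sobolev space with the norm `‖∇u‖₂`, which is realised as a space of functions in `L⁶`
(by the Sobolev inequality a Cauchy sequence of test fields converges in `L⁶`). -/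
structure MemV (u : E3 → E3) (Du : Fin 3 → E3 → E3) : Prop where
  weak_partial : ∀ j, HasWeakPartial j u (Du j)
  memLp : MemLp u 6 muOmega
  grad_memLp : ∀ j, MemLp (Du j) 2 muOmega
  approx : ∃ φ : ℕ → E3 → E3, (∀ n, IsTestField (φ n)) ∧
    Tendsto (fun n => eLpNorm (u - φ n) 6 muOmega) atTop (𝓝 0) ∧
    ∀ j, Tendsto (fun n => eLpNorm (Du j - pd j (φ n)) 2 muOmega) atTop (𝓝 0)

/-- Space-time test functions: restrictions to `t ≥ 0` of smooth functions with compact support in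
`(-∞, T) × Ω`, divergence-free in `x` for every `t ≥ 0`. -/
structure IsSpaceTimeTest (T : ℝ) (φ : ℝ → E3 → E3) : Prop where
  smooth : ContDiff ℝ ∞ (fun p : ℝ × E3 => φ p.1 p.2)
  compactSupport : HasCompactSupport (fun p : ℝ × E3 => φ p.1 p.2)
  support_subset : tsupport (fun p : ℝ × E3 => φ p.1 p.2) ⊆ Iio T ×ˢ Omega
  div_free : ∀ t, 0 ≤ t → ∀ x, divergence (φ t) x = 0

/-- The squared norm `‖u‖²` in `L²` of the half-space. -/
def normSq (u : E3 → E3) : ℝ := ∫ x, ‖u x‖ ^ 2 ∂muOmega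

/-- The dissipated energy `∫₀ᵗ ‖∇v(τ)‖² dτ`; `Dv j` is `∂_j v`. -/
def dissipation (Dv : Fin 3 → ℝ → E3 → E3) (t : ℝ) : ℝ :=
  ∫ τ in (0 : ℝ)..t, ∑ j, normSq (Dv j τ)

/-- Lebesgue measure on `(0, T) × Ω`. -/
def spaceTime (T : ℝ) : Measure (ℝ × E3) := (volume.restrict (Ioo 0 T)).prod muOmega

/-- `v` is a Leray-Hopf weak solution in the half-space, with viscosity `ν`, homogeneous Dirichlet
condition and initial datum `v₀`, and `Dv j` is its weak spatial derivative `∂_j v`. As usual `v(t)`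
denotes, for every `t ∈ [0, T]`, the weakly `L²`-continuous representative in time. -/
structure IsLerayHopf (ν T : ℝ) (v₀ : E3 → E3) (v : ℝ → E3 → E3) (Dv : Fin 3 → ℝ → E3 → E3) :
    Prop where
  initial_memH : MemH v₀
  -- v ∈ L^∞(0,T;H)
  measurable : AEStronglyMeasurable (fun p : ℝ × E3 => v p.1 p.2) (spaceTime T)
  memH : ∀ t ∈ Icc 0 T, MemH (v t)
  bounded : ∃ C : ℝ≥0, ∀ᵐ t ∂(volume.restrict (Ioo 0 T)), eLpNorm (v t) 2 muOmega ≤ C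
  weakly_continuous : ∀ ψ : E3 → E3, MemLp ψ 2 muOmega →
    ContinuousOn (fun t => ∫ x, ⟪v t x, ψ x⟫ ∂muOmega) (Icc 0 T)
  -- v ∈ L²(0,T;V)
  memV : ∀ᵐ t ∂(volume.restrict (Ioo 0 T)), MemV (v t) (fun j => Dv j t)
  grad_memLp : ∀ j, MemLp (fun p : ℝ × E3 => Dv j p.1 p.2) 2 (spaceTime T)
  -- the equations in the weak sense
  weak_form : ∀ φ : ℝ → E3 → E3, IsSpaceTimeTest T φ →
    ∫ t in (0 : ℝ)..T,
      ((∫ x, ⟪v t x, deriv (fun s => φ s x) t⟫ ∂muOmega)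
        - ν * (∫ x, ∑ j, ⟪Dv j t x, pd j (φ t) x⟫ ∂muOmega)
        - ∫ x, ⟪∑ j, v t x j • Dv j t x, φ t x⟫ ∂muOmega)
      = - ∫ x, ⟪v₀ x, φ 0 x⟫ ∂muOmega
  energy_inequality : ∀ t ∈ Icc 0 T,
    1 / 2 * normSq (v t) + ν * dissipation Dv t ≤ 1 / 2 * normSq v₀
  initial_attained : Tendsto (fun t => eLpNorm (v t - v₀) 2 muOmega) (𝓝[>] 0) (𝓝 0)

/-- A modulus of continuity: a non-negative non-decreasing function on `(0, ∞)` with limit `0` at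
`0⁺`. -/
structure IsModulus (om : ℝ → ℝ) : Prop where
  nonneg : ∀ s, 0 < s → 0 ≤ om s
  mono : MonotoneOn om (Ioi 0)
  tendsto_zero : Tendsto om (𝓝[>] 0) (𝓝 0)

/-- For almost every height, `u` has modulus of continuity `om` in the horizontal variables. -/
def HorModulus (om : ℝ → ℝ) (u : E3 → E3) : Prop :=
  ∀ᵐ z ∂(volume.restrict (Ioi (0 : ℝ))), ∀ xh yh : E2, xh ≠ yh →
    ‖u (point xh z) - u (point yh z)‖ ≤ om ‖xh - yh‖

/-- `v ∈ L²(0, T; Ċ_{om,hor})`: for some `f ∈ L²(0, T)` and almost every `t`, the field `v(t)` (that is,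
a representative of its class) has horizontal modulus of continuity `f(t) om`. -/
def MemL2HorModulus (T : ℝ) (om : ℝ → ℝ) (v : ℝ → E3 → E3) : Prop :=
  ∃ f : ℝ → ℝ, (∀ t, 0 ≤ f t) ∧ MemLp f 2 (volume.restrict (Ioo 0 T)) ∧
    ∀ᵐ t ∂(volume.restrict (Ioo 0 T)), ∃ w : E3 → E3,
      w =ᵐ[muOmega] v t ∧ HorModulus (fun s => f t * om s) w

/-- The energy equality on all of `[0, T]`. -/
def ConservesEnergy (ν T : ℝ) (v₀ : E3 → E3) (v : ℝ → E3 → E3) (Dv : Fin 3 → ℝ → E3 → E3) : Prop :=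
  ∀ t ∈ Icc 0 T, 1 / 2 * normSq (v t) + ν * dissipation Dv t = 1 / 2 * normSq v₀

end

end HalfSpaceNS

/-!
Horizontal translations preserve the half-space, its boundary condition, the divergence constraint
and every norm that occurs. Hence the equation may be regularised by averaging in the horizontal
variables only: let `P` be convolution with the uniform distribution on a small horizontal disk of
radius `ε`. The operator `P` is symmetric on `L²`, and the energy balance for the quadratic form
`(v, P v)` is obtained by using `P v` as a test function. No pressure appears, as `P v` is
divergence-free and vanishes on the boundary.

Three points have to be justified.

* *Integrability of the convective term.* In three dimensions `(v · ∇) v` is not in `L²` in space,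
  so it cannot be paired with a general element of `L² ∩ V`, but its horizontal average is in `L²`.
  In the vertical direction `v ∈ L² ∩ V` obeys the one-dimensional trace bound
  `sup_z ∫ |v(x_h, z)|² dx_h ≤ 2 ‖v‖ ‖∂₃ v‖` (`MemV.lintegral_plane_le`), and Cauchy–Schwarz on the
  disk gives `‖P ((v · ∇) v)‖² ≤ C ‖v‖ ‖∇v‖³` (`eLpNorm_havg_sq_le`). This norm is at most
  `B (1 + ‖∇v‖²)`, which is integrable in time.
* *Density.* Test fields approximate an element `u` of `L² ∩ V` in `L²` and in `V` at the same time
  (`MemV.exists_seq_testField`): horizontal increments of `u` over a fixed distance `R` can be so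
  approximated, because they are controlled in `L²` by `R ‖∂₁ u‖`, and they converge weakly to `u`
  as `R → ∞`. Hence the averaged equation, integrated up to any time `t`, holds for every element of
  `L² ∩ V` as a test field (`IsLerayHopf.averaged_identity`).
* *Time regularity.* `P v` has no time derivative to speak of. The equation at time `t` is therefore
  tested with `P v(s)`, which gives `∂ₜ a(t, s) = -G(t, s)` for the symmetric kernel
  `a(t, s) = (v(t), P v(s))`. Integrating over the strip `|t - s| < h`, where the contributions of
  the two sides `t = s ± h` cancel by symmetry, and letting `h → 0` yields
  `a(0, 0) - a(t, t) = 2 ∫ G(τ, τ) dτ` (`diagonal_identity`, `IsLerayHopf.averaged_energy_balance`).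

It remains to let `ε → 0`. The terms with `(v, P v)` and `(P ∇v, ∇v)` converge to the terms of the
energy equality. In the transport term, `((v · ∇) v, v) = 0` (`MemV.integral_inner_convect_self`),
so that `((v · ∇) v, P v) = ((v · ∇) v, P v - v)`; since `P` only compares values at the same
height, `|P v - v| ≤ f(t) om(ε)` pointwise, and the term is at most `om(ε) f(t) ‖v‖ ∑ⱼ ‖∂ⱼ v‖`
(`MemV.abs_integral_inner_havg_convect_le`), which tends to zero in `L¹` in time.
-/

namespace HalfSpaceNS

noncomputable section

/-! ### Pairings in `L²` -/

section Pairing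

variable {α F : Type*} [MeasurableSpace α] {μ : Measure α} [NormedAddCommGroup F]
  [InnerProductSpace ℝ F]

lemma integral_inner_eq_inner_toLp {u w : α → F} (hu : MemLp u 2 μ) (hw : MemLp w 2 μ) :
    ∫ x, ⟪u x, w x⟫ ∂μ = ⟪hu.toLp u, hw.toLp w⟫ := by
  rw [L2.inner_def]
  refine integral_congr_ae ?_
  filter_upwards [hu.coeFn_toLp, hw.coeFn_toLp] with x h1 h2
  rw [h1, h2]

lemma integrable_inner_of_memLp {u w : α → F} (hu : MemLp u 2 μ) (hw : MemLp w 2 μ) :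
    Integrable (fun x => ⟪u x, w x⟫) μ := by
  refine (L2.integrable_inner (𝕜 := ℝ) (hu.toLp u) (hw.toLp w)).congr ?_
  filter_upwards [hu.coeFn_toLp, hw.coeFn_toLp] with x h1 h2
  rw [h1, h2]

lemma abs_integral_inner_le {u w : α → F} (hu : MemLp u 2 μ) (hw : MemLp w 2 μ) :
    |∫ x, ⟪u x, w x⟫ ∂μ| ≤ lpNorm u 2 μ * lpNorm w 2 μ := by
  rw [integral_inner_eq_inner_toLp hu hw, ← toReal_eLpNorm hu.1, ← toReal_eLpNorm hw.1,
    ← Lp.norm_toLp u hu, ← Lp.norm_toLp w hw]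
  exact abs_real_inner_le_norm _ _

lemma integral_norm_mul_norm_le {G H : Type*} [NormedAddCommGroup G] [NormedAddCommGroup H]
    {u : α → G} {w : α → H}
    (hu : MemLp u 2 μ) (hw : MemLp w 2 μ) :
    ∫ x, ‖u x‖ * ‖w x‖ ∂μ ≤ lpNorm u 2 μ * lpNorm w 2 μ := by
  have h := abs_integral_inner_le hu.norm hw.norm
  rw [lpNorm_norm hu.1, lpNorm_norm hw.1] at h
  refine le_trans (le_of_eq ?_) ((le_abs_self _).trans h)
  refine integral_congr_ae (Eventually.of_forall fun x => ?_)
  simp [mul_comm]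

lemma integral_norm_sq_eq_lpNorm_sq {G : Type*} [NormedAddCommGroup G] {u : α → G}
    (hu : AEStronglyMeasurable u μ) : ∫ x, ‖u x‖ ^ 2 ∂μ = lpNorm u 2 μ ^ 2 := by
  rw [lpNorm_eq_integral_norm_rpow_toReal (by norm_num) (by norm_num) hu]
  have h : 0 ≤ ∫ x, ‖u x‖ ^ 2 ∂μ := integral_nonneg fun x => by positivity
  simp only [ENNReal.toReal_ofNat, Real.rpow_ofNat]
  rw [← Real.rpow_natCast, ← Real.rpow_mul h]
  norm_num

lemma lpNorm_eq_toReal {G : Type*} [NormedAddCommGroup G] {p : ℝ≥0∞} {u : α → G}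
    (hu : AEStronglyMeasurable u μ) : lpNorm u p μ = (eLpNorm u p μ).toReal :=
  (toReal_eLpNorm hu).symm

lemma tendsto_integral_inner {u : α → F} {φ : ℕ → α → F} {w : α → F}
    (hw : MemLp w 2 μ) (hu : MemLp u 2 μ) (hφ : ∀ n, MemLp (φ n) 2 μ)
    (h : Tendsto (fun n => eLpNorm (u - φ n) 2 μ) atTop (𝓝 0)) :
    Tendsto (fun n => ∫ x, ⟪w x, φ n x⟫ ∂μ) atTop (𝓝 (∫ x, ⟪w x, u x⟫ ∂μ)) := by
  simp_rw [fun n => integral_inner_eq_inner_toLp hw (hφ n), integral_inner_eq_inner_toLp hw hu]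
  have : Tendsto (fun n => (hφ n).toLp (φ n)) atTop (𝓝 (hu.toLp u)) := by
    rw [Lp.tendsto_Lp_iff_tendsto_eLpNorm'' _ hφ _ hu]
    refine h.congr fun n => ?_
    rw [← eLpNorm_neg, neg_sub]
  exact tendsto_const_nhds.inner this

/-- Translation is continuous in `L²`; more generally, a pairing is continuous in the parameter of a
continuous family of measure-preserving changes of variables. -/
lemma continuous_integral_inner_comp {X Z : Type*} [TopologicalSpace X] [MeasurableSpace X]
    [BorelSpace X] [R1Space X] {μ : Measure X} [μ.InnerRegularCompactLTTop]
    [IsLocallyFiniteMeasure μ] [TopologicalSpace Z] {g : Z → C(X, X)} (hg : Continuous g)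
    (hgm : ∀ z, MeasurePreserving (g z) μ μ) {u w : X → F} (hu : MemLp u 2 μ) (hw : MemLp w 2 μ) :
    Continuous fun z => ∫ x, ⟪u x, w (g z x)⟫ ∂μ := by
  have h : Continuous fun z => Lp.compMeasurePreserving (g z) (hgm z) (hw.toLp w) :=
    continuous_const.compMeasurePreservingLp hg hgm (by norm_num)
  refine (continuous_const.inner h (f := fun _ : Z => hu.toLp u)).congr fun z => ?_
  rw [Lp.toLp_compMeasurePreserving hw (hgm z),
    ← integral_inner_eq_inner_toLp hu (hw.comp_measurePreserving (hgm z))]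
  rfl

end Pairing

/-! ### Horizontal translations of the half-space -/

/-- The embedding of the horizontal plane into space as `x₃ = 0`. -/
def hz : E2 →L[ℝ] E3 :=
  LinearMap.toContinuousLinearMap
    { toFun := fun y => point y 0
      map_add' := fun y z => by ext i; fin_cases i <;> simp [point]
      map_smul' := fun c y => by ext i; fin_cases i <;> simp [point] }

lemma hz_apply (y : E2) : hz y = point y 0 := rfl

@[simp] lemma hz_apply_two (y : E2) : hz y 2 = 0 := by simp [hz_apply, point]

lemma point_add_hz (a y : E2) (z : ℝ) : point a z + hz y = point (a + y) z := by
  ext i; fin_cases i <;> simp [point, hz_apply]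

lemma measurableSet_Omega : MeasurableSet Omega :=
  (isOpen_lt continuous_const (by fun_prop : Continuous fun x : E3 => x 2)).measurableSet

instance : IsLocallyFiniteMeasure muOmega := by unfold muOmega; infer_instance

instance : SFinite muOmega := by unfold muOmega; infer_instance

instance : SigmaFinite muOmega := by unfold muOmega; infer_instance

instance : Measure.InnerRegularCompactLTTop muOmega := by unfold muOmega; infer_instance

lemma measurePreserving_add_hz (y : E2) :
    MeasurePreserving (fun x : E3 => x + hz y) muOmega muOmega := by
  have h := (measurePreserving_add_right (volume : Measure E3) (hz y)).restrict_preimage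
    measurableSet_Omega
  have h2 : (fun x : E3 => x + hz y) ⁻¹' Omega = Omega := by
    ext x; simp [Omega]
  rwa [h2] at h

lemma measurePreserving_skew (κ : Measure E2) [SFinite κ] :
    MeasurePreserving (fun p : E3 × E2 => (p.1 + hz p.2, p.2)) (muOmega.prod κ)
      (muOmega.prod κ) := by
  have h : MeasurePreserving (fun p : E2 × E3 => (p.1, p.2 + hz p.1)) (κ.prod muOmega)
      (κ.prod muOmega) :=
    (MeasurePreserving.id κ).skew_product (g := fun y x => x + hz y) (by fun_prop)
      (Eventually.of_forall fun y => (measurePreserving_add_hz y).map_eq)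
  exact (Measure.measurePreserving_swap.comp h).comp Measure.measurePreserving_swap

lemma measurable_point : Measurable fun p : E2 × ℝ => point p.1 p.2 := by
  unfold point; fun_prop

lemma continuous_point : Continuous fun p : E2 × ℝ => point p.1 p.2 := by
  unfold point; fun_prop

lemma measurePreserving_point :
    MeasurePreserving (fun p : E2 × ℝ => point p.1 p.2) (volume.prod volume) volume := by
  have h1 := (volume_preserving_piFinSuccAbove (fun _ : Fin 3 => ℝ) (Fin.last 2)).symm
  have h2 : MeasurePreserving (fun p : E2 × ℝ => (p.2, WithLp.ofLp p.1))
      ((volume : Measure E2).prod (volume : Measure ℝ)) (volume.prod volume) :=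
    ((MeasurePreserving.id volume).prod (PiLp.volume_preserving_ofLp (Fin 2))).comp
      Measure.measurePreserving_swap
  have h3 := (PiLp.volume_preserving_toLp (Fin 3)).comp (h1.comp h2)
  refine (congrArg (fun f => MeasurePreserving f (volume.prod volume) volume) ?_).mp h3
  funext p
  ext i
  fin_cases i <;> simp [point, MeasurableEquiv.piFinSuccAbove, Fin.insertNthEquiv] <;> rfl

lemma lintegral_muOmega_eq {F : E3 → ℝ≥0∞} (hF : Measurable F) :
    ∫⁻ x, F x ∂muOmega = ∫⁻ z in Ioi (0 : ℝ), ∫⁻ y : E2, F (point y z) := by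
  rw [muOmega, ← lintegral_indicator measurableSet_Omega,
    ← measurePreserving_point.lintegral_comp (hF.indicator measurableSet_Omega),
    lintegral_prod_symm (fun p : E2 × ℝ => Omega.indicator F (point p.1 p.2))
      ((hF.indicator measurableSet_Omega).comp measurable_point).aemeasurable,
    ← lintegral_indicator measurableSet_Ioi]
  refine lintegral_congr fun z => ?_
  by_cases h0 : 0 < z
  · simp [Set.indicator, Omega, point, h0]
  · simp [Set.indicator, Omega, point, h0]

/-! ### Squares of `L²` norms as lower integrals -/

lemma eLpNorm_two_sq {α F : Type*} [MeasurableSpace α] [NormedAddCommGroup F] (μ : Measure α)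
    (u : α → F) : eLpNorm u 2 μ ^ 2 = ∫⁻ x, ‖u x‖ₑ ^ 2 ∂μ := by
  have h := eLpNorm_nnreal_pow_eq_lintegral (f := u) (μ := μ) (p := 2) (by norm_num)
  simpa using h

/-- The Cauchy–Schwarz inequality for lower integrals. -/
lemma sq_lintegral_mul_le {α : Type*} [MeasurableSpace α] {μ : Measure α} {f g : α → ℝ≥0∞}
    (hf : AEMeasurable f μ) (hg : AEMeasurable g μ) :
    (∫⁻ x, f x * g x ∂μ) ^ 2 ≤ (∫⁻ x, f x ^ 2 ∂μ) * ∫⁻ x, g x ^ 2 ∂μ := by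
  have h := ENNReal.lintegral_mul_le_Lp_mul_Lq μ Real.HolderConjugate.two_two hf hg
  simp only [Pi.mul_apply, ENNReal.rpow_ofNat] at h
  calc (∫⁻ x, f x * g x ∂μ) ^ 2
      ≤ ((∫⁻ x, f x ^ 2 ∂μ) ^ (1 / 2 : ℝ) * (∫⁻ x, g x ^ 2 ∂μ) ^ (1 / 2 : ℝ)) ^ 2 := by gcongr
    _ = _ := by
      rw [mul_pow, ← ENNReal.rpow_natCast, ← ENNReal.rpow_natCast, ← ENNReal.rpow_mul,
        ← ENNReal.rpow_mul]
      norm_num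

lemma sq_lintegral_le {α : Type*} [MeasurableSpace α] {μ : Measure α} {f : α → ℝ≥0∞}
    (hf : AEMeasurable f μ) : (∫⁻ x, f x ∂μ) ^ 2 ≤ μ univ * ∫⁻ x, f x ^ 2 ∂μ := by
  have h := sq_lintegral_mul_le (f := fun _ => 1) aemeasurable_const hf
  simpa using h

/-! ### Test fields -/

lemma pd_add_hz {F : Type*} [NormedAddCommGroup F] [NormedSpace ℝ F] (j : Fin 3) (φ : E3 → F)
    (y : E2) (x : E3) : pd j (fun x => φ (x + hz y)) x = pd j φ (x + hz y) := by
  simp [pd, fderiv_comp_add_right]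

lemma contDiff_pd {F : Type*} [NormedAddCommGroup F] [NormedSpace ℝ F] (j : Fin 3) {φ : E3 → F}
    (h : ContDiff ℝ ∞ φ) : ContDiff ℝ ∞ (pd j φ) :=
  (h.fderiv_right (m := ∞) (by simp)).clm_apply contDiff_const

lemma hasCompactSupport_pd {F : Type*} [NormedAddCommGroup F] [NormedSpace ℝ F] (j : Fin 3)
    {φ : E3 → F} (h : HasCompactSupport φ) : HasCompactSupport (pd j φ) :=
  (h.fderiv ℝ).comp_left (g := fun L : E3 →L[ℝ] F => L (EuclideanSpace.single j 1)) (by simp)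

namespace IsTestField

variable {φ ψ : E3 → E3}

lemma differentiable (h : IsTestField φ) : Differentiable ℝ φ := h.smooth.differentiable (by simp)

lemma memLp (h : IsTestField φ) (p : ℝ≥0∞) : MemLp φ p muOmega :=
  h.smooth.continuous.memLp_of_hasCompactSupport h.compactSupport

lemma memLp_pd (h : IsTestField φ) (j : Fin 3) (p : ℝ≥0∞) : MemLp (pd j φ) p muOmega :=
  (contDiff_pd j h.smooth).continuous.memLp_of_hasCompactSupport
    (hasCompactSupport_pd j h.compactSupport)

lemma pd_add (h : IsTestField φ) (h' : IsTestField ψ) (j : Fin 3) :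
    pd j (φ + ψ) = pd j φ + pd j ψ := by
  funext x; simp [pd, fderiv_add (h.differentiable x) (h'.differentiable x)]

lemma pd_sub (h : IsTestField φ) (h' : IsTestField ψ) (j : Fin 3) :
    pd j (φ - ψ) = pd j φ - pd j ψ := by
  funext x; simp [pd, fderiv_sub (h.differentiable x) (h'.differentiable x)]

lemma pd_smul (h : IsTestField φ) (c : ℝ) (j : Fin 3) : pd j (c • φ) = c • pd j φ := by
  funext x; simp [pd, fderiv_const_smul (h.differentiable x)]

lemma zero : IsTestField 0 where
  smooth := contDiff_const
  compactSupport := HasCompactSupport.zero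
  support_subset := by simp [tsupport]
  div_free x := by simp [divergence, pd]

lemma add (h : IsTestField φ) (h' : IsTestField ψ) : IsTestField (φ + ψ) where
  smooth := h.smooth.add h'.smooth
  compactSupport := h.compactSupport.add h'.compactSupport
  support_subset := (tsupport_add φ ψ).trans (union_subset h.support_subset h'.support_subset)
  div_free x := by
    have := h.div_free x
    have := h'.div_free x
    simp_all [divergence, h.pd_add h', Finset.sum_add_distrib]

lemma smul (h : IsTestField φ) (c : ℝ) : IsTestField (c • φ) where
  smooth := h.smooth.const_smul c
  compactSupport := h.compactSupport.smul_left (f := fun _ => c)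
  support_subset := (tsupport_smul_subset_right (fun _ => c) φ).trans h.support_subset
  div_free x := by
    have := h.div_free x
    simp_all [divergence, h.pd_smul, ← Finset.mul_sum]

lemma sub (h : IsTestField φ) (h' : IsTestField ψ) : IsTestField (φ - ψ) := by
  have := h.add (h'.smul (-1))
  simpa [sub_eq_add_neg] using this

lemma translate (h : IsTestField φ) (y : E2) : IsTestField (fun x => φ (x + hz y)) where
  smooth := h.smooth.comp (contDiff_id.add contDiff_const)
  compactSupport := h.compactSupport.comp_homeomorph (Homeomorph.addRight (hz y))
  support_subset := by
    intro x hx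
    have h1 : x + hz y ∈ tsupport φ := by
      have := tsupport_comp_subset_preimage φ (f := fun x => x + hz y) (by fun_prop)
      exact this hx
    have := h.support_subset h1
    simpa [Omega] using this
  div_free x := by simpa [divergence, pd_add_hz] using h.div_free (x + hz y)

end IsTestField

/-- Horizontal increments over a distance `R` are bounded in `L²` by `R` times the gradient. -/
lemma IsTestField.eLpNorm_sub_translate_le {φ : E3 → E3} (h : IsTestField φ) {R : ℝ} (hR : 0 ≤ R) :
    eLpNorm (fun x => φ x - φ (x + hz (EuclideanSpace.single 0 R))) 2 muOmega
      ≤ ENNReal.ofReal R * eLpNorm (pd 0 φ) 2 muOmega := by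
  have hc : Continuous (pd 0 φ) := (contDiff_pd 0 h.smooth).continuous
  have hhz : ∀ s : ℝ, hz (EuclideanSpace.single 0 s) = s • EuclideanSpace.single (0 : Fin 3) 1 := by
    intro s; ext i; fin_cases i <;> simp [hz_apply, point]
  have h1 : ∀ x, ‖φ x - φ (x + hz (EuclideanSpace.single 0 R))‖ₑ ≤
      ∫⁻ s in Ioc 0 R, ‖pd 0 φ (x + hz (EuclideanSpace.single 0 s))‖ₑ := by
    intro x
    have hd : ∀ s : ℝ, HasDerivAt (fun s => φ (x + hz (EuclideanSpace.single 0 s)))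
        (pd 0 φ (x + hz (EuclideanSpace.single 0 s))) s := by
      intro s
      simp_rw [hhz]
      have e1 : HasDerivAt (fun s : ℝ => x + s • EuclideanSpace.single (0 : Fin 3) (1 : ℝ))
          (EuclideanSpace.single (0 : Fin 3) (1 : ℝ)) s := by
        simpa using ((hasDerivAt_id s).smul_const
          (EuclideanSpace.single (0 : Fin 3) (1 : ℝ))).const_add x
      exact ((h.differentiable _).hasFDerivAt.comp_hasDerivAt s e1)
    have hcont : Continuous fun s : ℝ => pd 0 φ (x + hz (EuclideanSpace.single 0 s)) :=
      hc.comp (by simp_rw [hhz]; fun_prop)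
    have e2 := intervalIntegral.integral_eq_sub_of_hasDerivAt (a := 0) (b := R)
      (fun s _ => hd s) (hcont.intervalIntegrable _ _)
    have e3 : φ x - φ (x + hz (EuclideanSpace.single 0 R)) =
        - ∫ s in (0 : ℝ)..R, pd 0 φ (x + hz (EuclideanSpace.single 0 s)) := by
      rw [e2]; simp [hhz]
    rw [e3, enorm_neg, intervalIntegral.integral_of_le hR]
    exact enorm_integral_le_lintegral_enorm _
  have hm : Measurable fun p : E3 × ℝ =>
      ‖pd 0 φ (p.1 + hz (EuclideanSpace.single 0 p.2))‖ₑ ^ 2 := by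
    have : Continuous fun p : E3 × ℝ => pd 0 φ (p.1 + hz (EuclideanSpace.single 0 p.2)) :=
      hc.comp (by simp_rw [hhz]; fun_prop)
    exact this.measurable.enorm.pow_const 2
  refine (ENNReal.pow_le_pow_left_iff (n := 2) (by norm_num)).mp ?_
  rw [mul_pow, eLpNorm_two_sq, eLpNorm_two_sq]
  calc ∫⁻ x, ‖φ x - φ (x + hz (EuclideanSpace.single 0 R))‖ₑ ^ 2 ∂muOmega
      ≤ ∫⁻ x, (∫⁻ s in Ioc 0 R, ‖pd 0 φ (x + hz (EuclideanSpace.single 0 s))‖ₑ) ^ 2 ∂muOmega := by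
        gcongr with x; exact h1 x
    _ ≤ ∫⁻ x, ENNReal.ofReal R *
          (∫⁻ s in Ioc 0 R, ‖pd 0 φ (x + hz (EuclideanSpace.single 0 s))‖ₑ ^ 2) ∂muOmega := by
        gcongr with x
        refine (sq_lintegral_le
          ((hc.comp (by simp_rw [hhz]; fun_prop)).enorm.measurable.aemeasurable)).trans_eq ?_
        simp
    _ = ENNReal.ofReal R * ∫⁻ s in Ioc 0 R,
          ∫⁻ x, ‖pd 0 φ (x + hz (EuclideanSpace.single 0 s))‖ₑ ^ 2 ∂muOmega := by
        rw [lintegral_const_mul _ hm.lintegral_prod_right',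
          lintegral_lintegral_swap hm.aemeasurable]
    _ = ENNReal.ofReal R ^ 2 * ∫⁻ x, ‖pd 0 φ x‖ₑ ^ 2 ∂muOmega := by
        have : ∀ s : ℝ, ∫⁻ x, ‖pd 0 φ (x + hz (EuclideanSpace.single 0 s))‖ₑ ^ 2 ∂muOmega =
            ∫⁻ x, ‖pd 0 φ x‖ₑ ^ 2 ∂muOmega := fun s =>
          (measurePreserving_add_hz (EuclideanSpace.single 0 s)).lintegral_comp
            (f := fun x => ‖pd 0 φ x‖ₑ ^ 2) (hc.measurable.enorm.pow_const 2)
        simp_rw [this]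
        rw [lintegral_const]
        simp only [Measure.restrict_apply_univ, Real.volume_Ioc, sub_zero]
        ring

/-! ### Density of test fields in `L² ∩ V` -/

lemma tendsto_eLpNorm_indicator_far {u : E3 → E3} (hu : MemLp u 2 muOmega) :
    Tendsto (fun n : ℕ => eLpNorm ({x : E3 | (n : ℝ) / 2 ≤ |x 0|}.indicator u) 2 muOmega) atTop
      (𝓝 0) := by
  have hmeas : ∀ n : ℕ, MeasurableSet {x : E3 | (n : ℝ) / 2 ≤ |x 0|} := fun n =>
    measurableSet_le measurable_const (by fun_prop)
  have h : Tendsto (fun n : ℕ =>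
      ∫⁻ x, ‖({x : E3 | (n : ℝ) / 2 ≤ |x 0|}.indicator u) x‖ₑ ^ 2 ∂muOmega) atTop (𝓝 0) := by
    have := tendsto_lintegral_of_dominated_convergence' (μ := muOmega)
      (F := fun n : ℕ => fun x => ‖({x : E3 | (n : ℝ) / 2 ≤ |x 0|}.indicator u) x‖ₑ ^ 2)
      (f := fun _ => 0) (fun x => ‖u x‖ₑ ^ 2)
      (fun n => (hu.1.indicator (hmeas n)).enorm.pow_const 2)
      (fun n => Eventually.of_forall fun x => by
        exact pow_le_pow_left' (enorm_indicator_le_enorm_self u x) 2)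
      (by
        rw [← eLpNorm_two_sq]
        exact ENNReal.pow_ne_top hu.2.ne)
      (Eventually.of_forall fun x => by
        refine tendsto_const_nhds.congr' ?_
        obtain ⟨N, hN⟩ := exists_nat_gt (2 * |x 0|)
        filter_upwards [eventually_ge_atTop N] with n hn
        have : (N : ℝ) ≤ n := by exact_mod_cast hn
        have h2 : ¬ ((n : ℝ) / 2 ≤ |x 0|) := by linarith
        simp [Set.indicator, h2])
    simpa using this
  have h2 : Tendsto (fun n : ℕ =>
      (∫⁻ x, ‖({x : E3 | (n : ℝ) / 2 ≤ |x 0|}.indicator u) x‖ₑ ^ 2 ∂muOmega) ^ (1 / 2 : ℝ)) atTop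
      (𝓝 0) := by
    have := h.ennrpow_const (1 / 2 : ℝ)
    simpa using this
  refine h2.congr fun n => ?_
  rw [← eLpNorm_two_sq, ← ENNReal.rpow_natCast, ← ENNReal.rpow_mul]
  norm_num

/-- Horizontal translations tend weakly to zero in `L²` as the translation goes to infinity. -/
lemma tendsto_integral_inner_translate {u w : E3 → E3} (hu : MemLp u 2 muOmega)
    (hw : MemLp w 2 muOmega) :
    Tendsto (fun n : ℕ => ∫ x, ⟪w x, u (x + hz (EuclideanSpace.single 0 (n : ℝ)))⟫ ∂muOmega) atTop
      (𝓝 0) := by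
  set A : ℕ → Set E3 := fun n => {x : E3 | (n : ℝ) / 2 ≤ |x 0|} with hA
  have hmeas : ∀ n : ℕ, MeasurableSet (A n) := fun n =>
    measurableSet_le measurable_const (by fun_prop)
  have htr : ∀ {f : E3 → E3} (n : ℕ), MemLp f 2 muOmega →
      MemLp (fun x => f (x + hz (EuclideanSpace.single 0 (n : ℝ)))) 2 muOmega :=
    fun n hf => hf.comp_measurePreserving (measurePreserving_add_hz _)
  have hnorm : ∀ {f : E3 → E3} (n : ℕ), MemLp f 2 muOmega →
      lpNorm (fun x => f (x + hz (EuclideanSpace.single 0 (n : ℝ)))) 2 muOmega =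
        lpNorm f 2 muOmega := by
    intro f n hf
    rw [lpNorm_eq_toReal (htr n hf).1, lpNorm_eq_toReal hf.1]
    congr 1
    exact eLpNorm_comp_measurePreserving hf.1 (measurePreserving_add_hz _)
  have hlim : ∀ {f : E3 → E3}, MemLp f 2 muOmega →
      Tendsto (fun n => lpNorm ((A n).indicator f) 2 muOmega) atTop (𝓝 0) := by
    intro f hf
    have := (ENNReal.tendsto_toReal ENNReal.zero_ne_top).comp (tendsto_eLpNorm_indicator_far hf)
    refine this.congr fun n => ?_
    rw [lpNorm_eq_toReal (hf.1.indicator (hmeas n))]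
    rfl
  have hbound : ∀ n : ℕ, |∫ x, ⟪w x, u (x + hz (EuclideanSpace.single 0 (n : ℝ)))⟫ ∂muOmega| ≤
      lpNorm ((A n).indicator w) 2 muOmega * lpNorm u 2 muOmega
      + lpNorm w 2 muOmega * lpNorm ((A n).indicator u) 2 muOmega
      + lpNorm ((A n).indicator w) 2 muOmega * lpNorm ((A n).indicator u) 2 muOmega := by
    intro n
    have hwi := hw.indicator (hmeas n)
    have hui := hu.indicator (hmeas n)
    have e : ∀ x, ⟪w x, u (x + hz (EuclideanSpace.single 0 (n : ℝ)))⟫ =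
        ⟪(A n).indicator w x, u (x + hz (EuclideanSpace.single 0 (n : ℝ)))⟫
        + ⟪w x, (A n).indicator u (x + hz (EuclideanSpace.single 0 (n : ℝ)))⟫
        - ⟪(A n).indicator w x,
            (A n).indicator u (x + hz (EuclideanSpace.single 0 (n : ℝ)))⟫ := by
      intro x
      by_cases hx : x ∈ A n
      · simp [hx]
      · have hx2 : x + hz (EuclideanSpace.single 0 (n : ℝ)) ∈ A n := by
          simp only [hA, mem_ofPred_eq, not_le] at hx ⊢
          have h3 := abs_lt.mp hx
          have : (x + hz (EuclideanSpace.single 0 (n : ℝ))) 0 = x 0 + n := by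
            simp [hz_apply, point]
          rw [this]
          refine le_trans ?_ (le_abs_self _)
          linarith [h3.1]
        simp [hx, hx2]
    have i1 := integrable_inner_of_memLp hwi (htr n hu)
    have i2 := integrable_inner_of_memLp hw (htr n hui)
    have i3 := integrable_inner_of_memLp hwi (htr n hui)
    simp_rw [e]
    have i12 : Integrable (fun x =>
        ⟪(A n).indicator w x, u (x + hz (EuclideanSpace.single 0 (n : ℝ)))⟫
        + ⟪w x, (A n).indicator u (x + hz (EuclideanSpace.single 0 (n : ℝ)))⟫) muOmega := i1.add i2
    rw [integral_sub i12 i3, integral_add i1 i2]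
    have b1 := abs_integral_inner_le hwi (htr n hu)
    have b2 := abs_integral_inner_le hw (htr n hui)
    have b3 := abs_integral_inner_le hwi (htr n hui)
    rw [hnorm n hu] at b1
    rw [hnorm n hui] at b2 b3
    refine (abs_sub _ _).trans (add_le_add ((abs_add_le _ _).trans (add_le_add b1 b2)) b3)
  have hz0 := (((hlim hw).mul_const (lpNorm u 2 muOmega)).add
    ((hlim hu).const_mul (lpNorm w 2 muOmega))).add ((hlim hw).mul (hlim hu))
  simp only [zero_mul, mul_zero, add_zero] at hz0
  exact squeeze_zero_norm hbound hz0

/-- The Hilbert space of `L²` functions together with candidates for their three derivatives. -/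
abbrev JetSpace : Type := PiLp 2 fun _ : Option (Fin 3) => Lp E3 2 muOmega

/-- The element `(u, Du)` of `JetSpace`. -/
def jet {u : E3 → E3} {Du : Fin 3 → E3 → E3} (hu : MemLp u 2 muOmega)
    (hDu : ∀ j, MemLp (Du j) 2 muOmega) : JetSpace :=
  WithLp.toLp 2 fun o => match o with
    | none => hu.toLp u
    | some j => (hDu j).toLp (Du j)

/-- The jets of test fields. -/
def testJets : Submodule ℝ JetSpace where
  carrier := {X | ∃ φ, ∃ h : IsTestField φ, X = jet (h.memLp 2) fun j => h.memLp_pd j 2}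
  add_mem' := by
    rintro _ _ ⟨φ, h, rfl⟩ ⟨ψ, h', rfl⟩
    refine ⟨φ + ψ, h.add h', ?_⟩
    ext1 o
    cases o with
    | none => exact (MemLp.toLp_add (h.memLp 2) (h'.memLp 2)).symm
    | some j =>
      simp only [jet, PiLp.add_apply]
      rw [← MemLp.toLp_add]
      simp_rw [h.pd_add h']
  zero_mem' := by
    refine ⟨0, IsTestField.zero, ?_⟩
    ext1 o
    cases o with
    | none => exact (MemLp.toLp_zero (IsTestField.zero.memLp 2)).symm
    | some j =>
      have : pd j (0 : E3 → E3) = 0 := by funext x; simp [pd]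
      symm
      change MemLp.toLp (pd j (0 : E3 → E3)) (IsTestField.zero.memLp_pd j 2) =
        (0 : Lp E3 2 muOmega)
      rw [Lp.eq_zero_iff_ae_eq_zero]
      filter_upwards [(IsTestField.zero.memLp_pd j 2).coeFn_toLp] with x hx
      rw [hx, this]
  smul_mem' := by
    rintro c _ ⟨φ, h, rfl⟩
    refine ⟨c • φ, h.smul c, ?_⟩
    ext1 o
    cases o with
    | none => exact (MemLp.toLp_const_smul c (h.memLp 2)).symm
    | some j =>
      simp only [jet, PiLp.smul_apply]
      rw [← MemLp.toLp_const_smul]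
      simp_rw [h.pd_smul]

lemma mem_testJets {X : JetSpace} : X ∈ testJets ↔
    ∃ φ, ∃ h : IsTestField φ, X = jet (h.memLp 2) fun j => h.memLp_pd j 2 := Iff.rfl

lemma tendsto_jet {u : E3 → E3} {Du : Fin 3 → E3 → E3} (hu : MemLp u 2 muOmega)
    (hDu : ∀ j, MemLp (Du j) 2 muOmega) {φ : ℕ → E3 → E3} {Dφ : ℕ → Fin 3 → E3 → E3}
    (hφ : ∀ n, MemLp (φ n) 2 muOmega) (hDφ : ∀ n j, MemLp (Dφ n j) 2 muOmega) :
    Tendsto (fun n => jet (hφ n) (hDφ n)) atTop (𝓝 (jet hu hDu)) ↔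
      Tendsto (fun n => eLpNorm (u - φ n) 2 muOmega) atTop (𝓝 0) ∧
      ∀ j, Tendsto (fun n => eLpNorm (Du j - Dφ n j) 2 muOmega) atTop (𝓝 0) := by
  have e : Tendsto (fun n => jet (hφ n) (hDφ n)) atTop (𝓝 (jet hu hDu)) ↔
      ∀ o, Tendsto (fun n => jet (hφ n) (hDφ n) o) atTop (𝓝 (jet hu hDu o)) := by
    rw [← tendsto_pi_nhds]
    constructor
    · intro h
      exact ((PiLp.continuous_ofLp 2 _).tendsto _).comp h
    · intro h
      exact ((PiLp.continuous_toLp 2 _).tendsto _).comp h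
  rw [e, Option.forall]
  refine and_congr ?_ (forall_congr' fun j => ?_)
  · simp only [jet]
    rw [Lp.tendsto_Lp_iff_tendsto_eLpNorm'' _ hφ _ hu]
    refine tendsto_congr fun n => ?_
    rw [← eLpNorm_neg, neg_sub]
  · simp only [jet]
    rw [Lp.tendsto_Lp_iff_tendsto_eLpNorm'' _ (fun n => hDφ n j) _ (hDu j)]
    refine tendsto_congr fun n => ?_
    rw [← eLpNorm_neg, neg_sub]

lemma inner_jet {u : E3 → E3} {Du : Fin 3 → E3 → E3} (hu : MemLp u 2 muOmega)
    (hDu : ∀ j, MemLp (Du j) 2 muOmega) (X : JetSpace) :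
    ⟪X, jet hu hDu⟫ = ∫ x, ⟪X none x, u x⟫ ∂muOmega
      + ∑ j, ∫ x, ⟪X (some j) x, Du j x⟫ ∂muOmega := by
  rw [PiLp.inner_apply, Fintype.sum_option]
  congr 1
  · rw [integral_inner_eq_inner_toLp (Lp.memLp _) hu, Lp.toLp_coeFn]
    rfl
  · refine Finset.sum_congr rfl fun j _ => ?_
    rw [integral_inner_eq_inner_toLp (Lp.memLp _) (hDu j), Lp.toLp_coeFn]
    rfl

/-- The bound for horizontal increments, for differences between an element of `V` and a test
field. -/
lemma MemV.eLpNorm_increment_le {u : E3 → E3} {Du : Fin 3 → E3 → E3} {ψ : ℕ → E3 → E3}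
    (hu : AEStronglyMeasurable u muOmega) (hDu : ∀ j, MemLp (Du j) 2 muOmega)
    (hψ : ∀ n, IsTestField (ψ n))
    (h6 : Tendsto (fun n => eLpNorm (u - ψ n) 6 muOmega) atTop (𝓝 0))
    (h2 : Tendsto (fun n => eLpNorm (Du 0 - pd 0 (ψ n)) 2 muOmega) atTop (𝓝 0))
    {R : ℝ} (hR : 0 ≤ R) (m : ℕ) :
    eLpNorm ((fun x => u x - u (x + hz (EuclideanSpace.single 0 R))) -
        fun x => ψ m x - ψ m (x + hz (EuclideanSpace.single 0 R))) 2 muOmega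
      ≤ ENNReal.ofReal R * eLpNorm (Du 0 - pd 0 (ψ m)) 2 muOmega := by
  have hm : TendstoInMeasure muOmega ψ atTop u :=
    tendstoInMeasure_of_tendsto_eLpNorm (p := 6) (by norm_num)
      (fun n => ((hψ n).memLp 6).1) hu (h6.congr fun n => by rw [← eLpNorm_neg, neg_sub])
  obtain ⟨ns, hns, hae⟩ := hm.exists_seq_tendsto_ae
  set y : E2 := EuclideanSpace.single 0 R
  have hae2 := (measurePreserving_add_hz y).quasiMeasurePreserving.ae hae
  have hlim : ∀ᵐ x ∂muOmega, Tendsto (fun k => (ψ (ns k) x - ψ (ns k) (x + hz y))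
      - (ψ m x - ψ m (x + hz y))) atTop (𝓝 ((u x - u (x + hz y)) - (ψ m x - ψ m (x + hz y)))) := by
    filter_upwards [hae, hae2] with x h1 h3
    exact (h1.sub h3).sub_const _
  have hk : ∀ k, eLpNorm (fun x => (ψ (ns k) x - ψ (ns k) (x + hz y))
      - (ψ m x - ψ m (x + hz y))) 2 muOmega ≤ ENNReal.ofReal R *
        (eLpNorm (Du 0 - pd 0 (ψ (ns k))) 2 muOmega + eLpNorm (Du 0 - pd 0 (ψ m)) 2 muOmega) := by
    intro k
    have ht := ((hψ (ns k)).sub (hψ m)).eLpNorm_sub_translate_le hR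
    have e : (fun x => (ψ (ns k) x - ψ (ns k) (x + hz y)) - (ψ m x - ψ m (x + hz y))) =
        fun x => (ψ (ns k) - ψ m) x - (ψ (ns k) - ψ m) (x + hz y) := by
      funext x; simp only [Pi.sub_apply]; abel
    rw [e]
    refine ht.trans ?_
    gcongr
    rw [(hψ (ns k)).pd_sub (hψ m)]
    have e2 : pd 0 (ψ (ns k)) - pd 0 (ψ m) =
        (Du 0 - pd 0 (ψ m)) - (Du 0 - pd 0 (ψ (ns k))) := by abel
    rw [e2, add_comm]
    exact eLpNorm_sub_le ((hDu 0).sub ((hψ m).memLp_pd 0 2)).1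
      ((hDu 0).sub ((hψ _).memLp_pd 0 2)).1 (by norm_num)
  have hmeas : ∀ k, AEStronglyMeasurable (fun x => (ψ (ns k) x - ψ (ns k) (x + hz y))
      - (ψ m x - ψ m (x + hz y))) muOmega := fun k =>
    (((((hψ (ns k)).memLp 2).sub (((hψ (ns k)).translate y).memLp 2)).sub
      (((hψ m).memLp 2).sub (((hψ m).translate y).memLp 2))).1)
  refine (Lp.eLpNorm_lim_le_liminf_eLpNorm hmeas _ hlim).trans ?_
  have hl : Tendsto (fun k => ENNReal.ofReal R *
      (eLpNorm (Du 0 - pd 0 (ψ (ns k))) 2 muOmega + eLpNorm (Du 0 - pd 0 (ψ m)) 2 muOmega)) atTop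
      (𝓝 (ENNReal.ofReal R * (0 + eLpNorm (Du 0 - pd 0 (ψ m)) 2 muOmega))) :=
    ENNReal.Tendsto.const_mul ((h2.comp hns.tendsto_atTop).add tendsto_const_nhds)
      (Or.inr ENNReal.ofReal_ne_top)
  rw [zero_add] at hl
  rw [← hl.liminf_eq]
  exact liminf_le_liminf (Eventually.of_forall hk)

/-- Joint density: a field in `L² ∩ V` is approximated by test fields in `L²` and in the gradient
norm at the same time. The increments `u - u(· + n e₁)` are limits in both norms because the
horizontal increment turns the gradient bound into an `L²` bound, and they tend weakly to `u`. -/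
theorem MemV.exists_seq_testField {u : E3 → E3} {Du : Fin 3 → E3 → E3} (hu : MemLp u 2 muOmega)
    (hV : MemV u Du) : ∃ φ : ℕ → E3 → E3, (∀ n, IsTestField (φ n)) ∧
      Tendsto (fun n => eLpNorm (u - φ n) 2 muOmega) atTop (𝓝 0) ∧
      ∀ j, Tendsto (fun n => eLpNorm (Du j - pd j (φ n)) 2 muOmega) atTop (𝓝 0) := by
  have hDu := hV.grad_memLp
  obtain ⟨ψ, hψ, h6, h2⟩ := hV.approx
  have htr : ∀ {f : E3 → E3} (y : E2), MemLp f 2 muOmega →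
      MemLp (fun x => f (x + hz y)) 2 muOmega :=
    fun y hf => hf.comp_measurePreserving (measurePreserving_add_hz _)
  set y : ℕ → E2 := fun n => EuclideanSpace.single 0 (n : ℝ) with hy
  have hmem : ∀ n : ℕ, jet (hu.sub (htr (y n) hu)) (fun j => (hDu j).sub (htr (y n) (hDu j))) ∈
      testJets.topologicalClosure := by
    intro n
    have htest : ∀ m, IsTestField (ψ m - fun x => ψ m (x + hz (y n))) := fun m =>
      (hψ m).sub ((hψ m).translate (y n))
    refine mem_closure_of_tendsto (f := fun m => jet ((htest m).memLp 2)
      fun j => (htest m).memLp_pd j 2) (b := atTop) ?_ (Eventually.of_forall fun m => ?_)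
    · rw [tendsto_jet]
      constructor
      · have := ENNReal.Tendsto.const_mul (a := ENNReal.ofReal n) (h2 0)
          (Or.inr ENNReal.ofReal_ne_top)
        rw [mul_zero] at this
        refine tendsto_of_tendsto_of_tendsto_of_le_of_le tendsto_const_nhds this
          (fun _ => zero_le) fun m => ?_
        exact MemV.eLpNorm_increment_le hu.1 hDu hψ h6 (h2 0) (Nat.cast_nonneg n) m
      · intro j
        have := (h2 j).add (h2 j)
        rw [add_zero] at this
        refine tendsto_of_tendsto_of_tendsto_of_le_of_le tendsto_const_nhds this
          (fun _ => zero_le) fun m => ?_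
        have hd := (hDu j).sub ((hψ m).memLp_pd j 2)
        have e : (Du j - fun x => Du j (x + hz (y n))) - pd j (ψ m - fun x => ψ m (x + hz (y n))) =
            (Du j - pd j (ψ m)) - fun x => (Du j - pd j (ψ m)) (x + hz (y n)) := by
          rw [(hψ m).pd_sub ((hψ m).translate _)]
          funext x
          simp only [Pi.sub_apply, pd_add_hz]
          abel
        have e2 : eLpNorm (fun x => (Du j - pd j (ψ m)) (x + hz (y n))) 2 muOmega =
            eLpNorm (Du j - pd j (ψ m)) 2 muOmega :=
          eLpNorm_comp_measurePreserving hd.1 (measurePreserving_add_hz _)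
        dsimp only
        rw [e]
        refine (eLpNorm_sub_le hd.1 (htr _ hd).1 (by norm_num)).trans ?_
        rw [e2]
    · exact mem_testJets.mpr ⟨_, htest m, rfl⟩
  -- a closed subspace contains the weak limits of its elements
  have hjet : jet hu hDu ∈ testJets.topologicalClosure := by
    rw [← Submodule.orthogonal_orthogonal_eq_closure, Submodule.mem_orthogonal]
    intro X hX
    have h0 : ∀ n, ⟪X, jet (hu.sub (htr (y n) hu))
        (fun j => (hDu j).sub (htr (y n) (hDu j)))⟫ = 0 := by
      intro n
      have := hmem n
      rw [← Submodule.orthogonal_orthogonal_eq_closure, Submodule.mem_orthogonal] at this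
      exact this X hX
    have h1 : ∀ n, ⟪X, jet hu hDu⟫ = ∫ x, ⟪X none x, u (x + hz (y n))⟫ ∂muOmega
        + ∑ j, ∫ x, ⟪X (some j) x, Du j (x + hz (y n))⟫ ∂muOmega := by
      intro n
      have h3 := h0 n
      have hs : ∀ (f : E3 → E3) (Y : Lp E3 2 muOmega), MemLp f 2 muOmega →
          ∫ x, ⟪Y x, (f - fun x => f (x + hz (y n))) x⟫ ∂muOmega =
            ∫ x, ⟪Y x, f x⟫ ∂muOmega - ∫ x, ⟪Y x, f (x + hz (y n))⟫ ∂muOmega := by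
        intro f Y hf
        rw [← integral_sub (integrable_inner_of_memLp (Lp.memLp Y) hf)
          (integrable_inner_of_memLp (Lp.memLp Y) (htr _ hf))]
        simp_rw [Pi.sub_apply, inner_sub_right]
      rw [inner_jet, hs u _ hu] at h3
      simp_rw [fun j => hs (Du j) (X (some j)) (hDu j)] at h3
      rw [Finset.sum_sub_distrib] at h3
      rw [inner_jet]
      linarith
    have h2 : Tendsto (fun n => ∫ x, ⟪X none x, u (x + hz (y n))⟫ ∂muOmega
        + ∑ j, ∫ x, ⟪X (some j) x, Du j (x + hz (y n))⟫ ∂muOmega) atTop (𝓝 (0 + ∑ j : Fin 3, 0)) :=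
      (tendsto_integral_inner_translate hu (Lp.memLp _)).add
        (tendsto_finsetSum _ fun j _ => tendsto_integral_inner_translate (hDu j) (Lp.memLp _))
    simp only [Finset.sum_const_zero, add_zero] at h2
    exact tendsto_nhds_unique (tendsto_const_nhds.congr h1) h2
  obtain ⟨X, hX, hlim⟩ := mem_closure_iff_seq_limit.mp hjet
  choose φ hφ hXφ using fun n => mem_testJets.mp (hX n)
  refine ⟨φ, hφ, ?_⟩
  rw [← tendsto_jet hu hDu (fun n => (hφ n).memLp 2) fun n j => (hφ n).memLp_pd j 2]
  exact hlim.congr hXφ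

/-! ### The vertical trace bound -/

lemma ae_ae_add_hz (κ : Measure E2) [SFinite κ] {p : E3 → Prop} (h : ∀ᵐ x ∂muOmega, p x) :
    ∀ᵐ x ∂muOmega, ∀ᵐ y ∂κ, p (x + hz y) := by
  have h1 : ∀ᵐ q ∂(muOmega.prod κ), p q.1 := Measure.quasiMeasurePreserving_fst.ae h
  exact Measure.ae_ae_of_ae_prod ((measurePreserving_skew κ).quasiMeasurePreserving.ae h1)

lemma eq_point (x : E3) : x = point !₂[x 0, x 1] (x 2) := by
  ext i; fin_cases i <;> simp [point]

lemma IsTestField.sq_enorm_point_le {φ : E3 → E3} (h : IsTestField φ) (a : E2) (z : ℝ) :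
    ‖φ (point a z)‖ₑ ^ 2 ≤
      2 * ∫⁻ s in Ioi (0 : ℝ), ‖φ (point a s)‖ₑ * ‖pd 2 φ (point a s)‖ₑ := by
  have hzero : ∀ s : ℝ, s ≤ 0 → φ (point a s) = 0 := by
    intro s hs
    by_contra hne
    have := h.support_subset (subset_tsupport φ hne)
    simp only [Omega, mem_ofPred_eq, point] at this
    simp at this
    linarith
  rcases le_or_gt z 0 with hz0 | hz0
  · simp [hzero z hz0]
  have hlin : ∀ s : ℝ, HasDerivAt (fun s => point a s) (EuclideanSpace.single (2 : Fin 3) 1) s := by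
    intro s
    have e : (fun s => point a s) =
        fun s : ℝ => point a 0 + s • EuclideanSpace.single (2 : Fin 3) (1 : ℝ) := by
      funext s; ext i; fin_cases i <;> simp [point]
    rw [e]
    simpa using ((hasDerivAt_id s).smul_const (EuclideanSpace.single (2 : Fin 3) (1 : ℝ))).const_add
      (point a 0)
  have hcp : Continuous fun s : ℝ => point a s :=
    continuous_point.comp (continuous_const.prodMk continuous_id)
  have hc1 : Continuous fun s : ℝ => φ (point a s) := h.smooth.continuous.comp hcp
  have hc2 : Continuous fun s : ℝ => pd 2 φ (point a s) :=
    (contDiff_pd 2 h.smooth).continuous.comp hcp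
  have hd : ∀ s : ℝ, HasDerivAt (fun s => ‖φ (point a s)‖ ^ 2)
      (2 * ⟪φ (point a s), pd 2 φ (point a s)⟫) s := fun s =>
    ((h.differentiable _).hasFDerivAt.comp_hasDerivAt s (hlin s)).norm_sq
  have e2 := intervalIntegral.integral_eq_sub_of_hasDerivAt (a := 0) (b := z)
    (fun s _ => hd s) ((continuous_const.mul (hc1.inner hc2)).intervalIntegrable _ _)
  simp only [hzero 0 le_rfl, norm_zero] at e2
  have e3 : ‖φ (point a z)‖ₑ ^ 2 =
      ‖∫ s in (0 : ℝ)..z, 2 * ⟪φ (point a s), pd 2 φ (point a s)⟫‖ₑ := by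
    rw [e2]; simp [enorm_pow]
  rw [e3, intervalIntegral.integral_of_le hz0.le]
  refine (enorm_integral_le_lintegral_enorm _).trans ?_
  have hprod : Measurable fun s => ‖φ (point a s)‖ₑ * ‖pd 2 φ (point a s)‖ₑ :=
    hc1.enorm.measurable.mul hc2.enorm.measurable
  rw [← lintegral_const_mul _ hprod]
  refine (lintegral_mono fun s => ?_).trans
    (lintegral_mono_set (Ioc_subset_Ioi_self : Ioc 0 z ⊆ Ioi 0))
  rw [enorm_mul]
  gcongr
  · simp [enorm_eq_nnnorm]
  · rw [← enorm_norm (φ (point a s)), ← enorm_norm (pd 2 φ (point a s)), ← enorm_mul]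
    exact enorm_le_iff_norm_le.mpr (by
      rw [Real.norm_eq_abs, Real.norm_eq_abs, abs_mul, abs_norm, abs_norm]
      exact abs_real_inner_le_norm _ _)

lemma IsTestField.lintegral_plane_le {φ : E3 → E3} (h : IsTestField φ) (x : E3) :
    ∫⁻ y : E2, ‖φ (x + hz y)‖ₑ ^ 2 ≤ 2 * (eLpNorm φ 2 muOmega * eLpNorm (pd 2 φ) 2 muOmega) := by
  have hc1 : Continuous φ := h.smooth.continuous
  have hc2 : Continuous (pd 2 φ) := (contDiff_pd 2 h.smooth).continuous
  have hm : Measurable fun x => ‖φ x‖ₑ * ‖pd 2 φ x‖ₑ :=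
    hc1.enorm.measurable.mul hc2.enorm.measurable
  calc ∫⁻ y : E2, ‖φ (x + hz y)‖ₑ ^ 2
      = ∫⁻ y : E2, ‖φ (point (!₂[x 0, x 1] + y) (x 2))‖ₑ ^ 2 := by
        congr with y
        rw [← point_add_hz, ← eq_point]
    _ = ∫⁻ y : E2, ‖φ (point y (x 2))‖ₑ ^ 2 :=
        lintegral_add_left_eq_self (fun y : E2 => ‖φ (point y (x 2))‖ₑ ^ 2) _
    _ ≤ ∫⁻ y : E2, 2 * ∫⁻ s in Ioi (0 : ℝ), ‖φ (point y s)‖ₑ * ‖pd 2 φ (point y s)‖ₑ := by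
        gcongr with y
        exact h.sq_enorm_point_le y (x 2)
    _ = 2 * ∫⁻ x, ‖φ x‖ₑ * ‖pd 2 φ x‖ₑ ∂muOmega := by
        have hm2 : Measurable fun p : E2 × ℝ =>
          ‖φ (point p.1 p.2)‖ₑ * ‖pd 2 φ (point p.1 p.2)‖ₑ := hm.comp measurable_point
        rw [lintegral_muOmega_eq hm, lintegral_const_mul _ hm2.lintegral_prod_right',
          lintegral_lintegral_swap hm2.aemeasurable]
    _ ≤ _ := by
        gcongr
        refine (ENNReal.pow_le_pow_left_iff (n := 2) (by norm_num)).mp ?_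
        rw [mul_pow, eLpNorm_two_sq, eLpNorm_two_sq]
        exact sq_lintegral_mul_le hc1.enorm.measurable.aemeasurable
          hc2.enorm.measurable.aemeasurable

/-- A field in `L² ∩ V` is square-integrable over almost every horizontal plane, with a bound that
does not depend on the plane. -/
lemma MemV.lintegral_plane_le {u : E3 → E3} {Du : Fin 3 → E3 → E3} (hu : MemLp u 2 muOmega)
    (hV : MemV u Du) : ∀ᵐ x ∂muOmega, ∫⁻ y : E2, ‖u (x + hz y)‖ₑ ^ 2 ≤
      2 * (eLpNorm u 2 muOmega * eLpNorm (Du 2) 2 muOmega) := by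
  obtain ⟨φ, hφ, h0, h1⟩ := hV.exists_seq_testField hu
  have hm : TendstoInMeasure muOmega φ atTop u :=
    tendstoInMeasure_of_tendsto_eLpNorm (p := 2) (by norm_num)
      (fun n => ((hφ n).memLp 2).1) hu.1 (h0.congr fun n => by rw [← eLpNorm_neg, neg_sub])
  obtain ⟨ns, hns, hae⟩ := hm.exists_seq_tendsto_ae
  filter_upwards [ae_ae_add_hz volume hae] with x hx
  have hlim : ∀ᵐ y : E2, ‖u (x + hz y)‖ₑ ^ 2 =
      liminf (fun k => ‖φ (ns k) (x + hz y)‖ₑ ^ 2) atTop := by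
    filter_upwards [hx] with y hy
    exact ((ENNReal.continuous_pow 2).tendsto _ |>.comp hy.enorm).liminf_eq.symm
  rw [lintegral_congr_ae hlim]
  refine (lintegral_liminf_le fun k => ?_).trans ?_
  · exact ((((hφ _).smooth.continuous).comp (by fun_prop :
      Continuous fun y => x + hz y)).enorm.measurable.pow_const 2)
  have hbound : ∀ k, ∫⁻ y : E2, ‖φ (ns k) (x + hz y)‖ₑ ^ 2 ≤
      2 * ((eLpNorm u 2 muOmega + eLpNorm (u - φ (ns k)) 2 muOmega) *
        (eLpNorm (Du 2) 2 muOmega + eLpNorm (Du 2 - pd 2 (φ (ns k))) 2 muOmega)) := by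
    intro k
    refine ((hφ (ns k)).lintegral_plane_le x).trans ?_
    gcongr
    · have := eLpNorm_sub_le hu.1 (hu.sub ((hφ (ns k)).memLp 2)).1 (p := 2) (by norm_num)
      rwa [sub_sub_cancel] at this
    · have := eLpNorm_sub_le (hV.grad_memLp 2).1
        ((hV.grad_memLp 2).sub ((hφ (ns k)).memLp_pd 2 2)).1 (p := 2) (by norm_num)
      rwa [sub_sub_cancel] at this
  have hl : Tendsto (fun k => 2 * ((eLpNorm u 2 muOmega + eLpNorm (u - φ (ns k)) 2 muOmega) *
        (eLpNorm (Du 2) 2 muOmega + eLpNorm (Du 2 - pd 2 (φ (ns k))) 2 muOmega))) atTop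
      (𝓝 (2 * ((eLpNorm u 2 muOmega + 0) * (eLpNorm (Du 2) 2 muOmega + 0)))) := by
    refine ENNReal.Tendsto.const_mul (ENNReal.Tendsto.mul
      (tendsto_const_nhds.add (h0.comp hns.tendsto_atTop)) (Or.inr ?_)
      (tendsto_const_nhds.add ((h1 2).comp hns.tendsto_atTop)) (Or.inr ?_)) (Or.inr ?_)
    · simpa using (hV.grad_memLp 2).2.ne
    · simpa using hu.2.ne
    · norm_num
  simp only [add_zero] at hl
  rw [← hl.liminf_eq]
  exact liminf_le_liminf (Eventually.of_forall hbound)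

/-! ### Horizontal averages -/

/-- The horizontal average of `u` with weight `κ`. -/
def havg {F : Type*} [NormedAddCommGroup F] [NormedSpace ℝ F] (κ : Measure E2) (u : E3 → F)
    (x : E3) : F := ∫ y, u (x + hz y) ∂κ

section Average

variable {κ : Measure E2} [IsProbabilityMeasure κ] {F : Type*} [NormedAddCommGroup F]

lemma lintegral_lintegral_add_hz (κ : Measure E2) [IsProbabilityMeasure κ] {f : E3 → ℝ≥0∞}
    (hf : AEMeasurable f muOmega) :
    ∫⁻ x, ∫⁻ y, f (x + hz y) ∂κ ∂muOmega = ∫⁻ x, f x ∂muOmega := by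
  have hf1 : AEMeasurable (fun p : E3 × E2 => f p.1) (muOmega.prod κ) := hf.comp_fst
  have hf2 : AEMeasurable (fun p : E3 × E2 => f (p.1 + hz p.2)) (muOmega.prod κ) :=
    hf1.comp_quasiMeasurePreserving (measurePreserving_skew κ).quasiMeasurePreserving
  rw [← lintegral_prod (fun p : E3 × E2 => f (p.1 + hz p.2)) hf2]
  have h := lintegral_map' (μ := muOmega.prod κ) (f := fun p : E3 × E2 => f p.1)
    (g := fun p : E3 × E2 => (p.1 + hz p.2, p.2))
    (by rw [(measurePreserving_skew κ).map_eq]; exact hf1)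
    (measurePreserving_skew κ).measurable.aemeasurable
  rw [(measurePreserving_skew κ).map_eq] at h
  rw [← h, lintegral_prod _ hf1]
  simp

lemma aestronglyMeasurable_add_hz {u : E3 → F} (hu : AEStronglyMeasurable u muOmega) :
    AEStronglyMeasurable (fun p : E3 × E2 => u (p.1 + hz p.2)) (muOmega.prod κ) :=
  (hu.comp_fst (ν := κ)).comp_quasiMeasurePreserving
    (measurePreserving_skew κ).quasiMeasurePreserving

lemma ae_memLp_two_add_hz {u : E3 → F} (hu : MemLp u 2 muOmega) :
    ∀ᵐ x ∂muOmega, MemLp (fun y => u (x + hz y)) 2 κ := by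
  have h1 := (aestronglyMeasurable_add_hz (κ := κ) hu.1).prodMk_left
  have h2 : ∫⁻ x, ∫⁻ y, ‖u (x + hz y)‖ₑ ^ 2 ∂κ ∂muOmega ≠ ⊤ := by
    rw [lintegral_lintegral_add_hz κ (hu.1.enorm.pow_const 2), ← eLpNorm_two_sq]
    exact ENNReal.pow_ne_top hu.2.ne
  have h3 := ae_lt_top' ((aestronglyMeasurable_add_hz (κ := κ)
    hu.1).enorm.pow_const 2).lintegral_prod_right' h2
  filter_upwards [h1, h3] with x hx1 hx2
  refine ⟨hx1, ?_⟩
  rw [← eLpNorm_two_sq] at hx2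
  contrapose! hx2
  rw [top_le_iff.mp hx2]
  simp

lemma ae_integrable_add_hz_of_memLp_two {u : E3 → F} (hu : MemLp u 2 muOmega) :
    ∀ᵐ x ∂muOmega, Integrable (fun y => u (x + hz y)) κ := by
  filter_upwards [ae_memLp_two_add_hz (κ := κ) hu] with x hx
  exact hx.integrable (by norm_num)

lemma ae_integrable_add_hz_of_integrable {u : E3 → F} (hu : Integrable u muOmega) :
    ∀ᵐ x ∂muOmega, Integrable (fun y => u (x + hz y)) κ := by
  have h1 := (aestronglyMeasurable_add_hz (κ := κ) hu.1).prodMk_left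
  have h2 : ∫⁻ x, ∫⁻ y, ‖u (x + hz y)‖ₑ ∂κ ∂muOmega ≠ ⊤ := by
    rw [lintegral_lintegral_add_hz κ hu.1.enorm]
    exact hu.2.ne
  have h3 := ae_lt_top' (aestronglyMeasurable_add_hz (κ := κ)
    hu.1).enorm.lintegral_prod_right' h2
  filter_upwards [h1, h3] with x hx1 hx2
  exact ⟨hx1, hx2⟩

variable [NormedSpace ℝ F]

lemma aestronglyMeasurable_havg {u : E3 → F} (hu : AEStronglyMeasurable u muOmega) :
    AEStronglyMeasurable (havg κ u) muOmega :=
  (aestronglyMeasurable_add_hz (κ := κ) hu).integral_prod_right'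

lemma eLpNorm_havg_le {u : E3 → F} (hu : AEStronglyMeasurable u muOmega) :
    eLpNorm (havg κ u) 2 muOmega ≤ eLpNorm u 2 muOmega := by
  refine (ENNReal.pow_le_pow_left_iff (n := 2) (by norm_num)).mp ?_
  rw [eLpNorm_two_sq, eLpNorm_two_sq, ← lintegral_lintegral_add_hz κ (hu.enorm.pow_const 2)]
  refine lintegral_mono_ae ?_
  filter_upwards [(aestronglyMeasurable_add_hz (κ := κ) hu).prodMk_left] with x hx
  calc ‖havg κ u x‖ₑ ^ 2 ≤ (∫⁻ y, ‖u (x + hz y)‖ₑ ∂κ) ^ 2 := by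
        gcongr; exact enorm_integral_le_lintegral_enorm _
    _ ≤ _ := by simpa using sq_lintegral_le hx.enorm

lemma memLp_havg {u : E3 → F} (hu : MemLp u 2 muOmega) : MemLp (havg κ u) 2 muOmega :=
  ⟨aestronglyMeasurable_havg hu.1, (eLpNorm_havg_le hu.1).trans_lt hu.2⟩

/-- For `‖g‖ ≤ ‖u‖ W` with `W ∈ L²` and `u` square-integrable uniformly on horizontal planes, the
horizontal average of `g` belongs to `L²`. -/
lemma eLpNorm_havg_sq_le {G : Type*} [NormedAddCommGroup G] {C : ℝ≥0∞} (hκ : κ ≤ C • volume)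
    {g : E3 → F} {u : E3 → G} {W : E3 → ℝ≥0∞} {K : ℝ≥0∞} (hu : AEStronglyMeasurable u muOmega)
    (hW : AEMeasurable W muOmega) (hg : ∀ᵐ x ∂muOmega, ‖g x‖ₑ ≤ ‖u x‖ₑ * W x)
    (hK : ∀ᵐ x ∂muOmega, ∫⁻ y : E2, ‖u (x + hz y)‖ₑ ^ 2 ≤ K) :
    eLpNorm (havg κ g) 2 muOmega ^ 2 ≤ C * K * ∫⁻ x, W x ^ 2 ∂muOmega := by
  have hW1 : AEMeasurable (fun p : E3 × E2 => W (p.1 + hz p.2)) (muOmega.prod κ) :=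
    (hW.comp_fst (ν := κ)).comp_quasiMeasurePreserving
      (measurePreserving_skew κ).quasiMeasurePreserving
  rw [eLpNorm_two_sq, ← lintegral_lintegral_add_hz κ (hW.pow_const 2),
    ← lintegral_const_mul'' _ (hW1.pow_const 2).lintegral_prod_right']
  refine lintegral_mono_ae ?_
  filter_upwards [hK, ae_ae_add_hz κ hg, (aestronglyMeasurable_add_hz (κ := κ) hu).prodMk_left,
    hW1.aestronglyMeasurable.prodMk_left] with x h1 h2 h3 h4
  calc ‖havg κ g x‖ₑ ^ 2 ≤ (∫⁻ y, ‖g (x + hz y)‖ₑ ∂κ) ^ 2 := by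
        gcongr; exact enorm_integral_le_lintegral_enorm _
    _ ≤ (∫⁻ y, ‖u (x + hz y)‖ₑ * W (x + hz y) ∂κ) ^ 2 := by
        gcongr ?_ ^ 2; exact lintegral_mono_ae h2
    _ ≤ (∫⁻ y, ‖u (x + hz y)‖ₑ ^ 2 ∂κ) * ∫⁻ y, W (x + hz y) ^ 2 ∂κ :=
        sq_lintegral_mul_le h3.enorm h4.aemeasurable
    _ ≤ C * K * ∫⁻ y, W (x + hz y) ^ 2 ∂κ := by
        gcongr
        calc ∫⁻ y, ‖u (x + hz y)‖ₑ ^ 2 ∂κ ≤ ∫⁻ y, ‖u (x + hz y)‖ₑ ^ 2 ∂(C • volume) :=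
              lintegral_mono' hκ le_rfl
          _ ≤ C * K := by
              rw [lintegral_smul_measure, smul_eq_mul]
              gcongr

end Average

/-- Averaging against a symmetric weight is a symmetric operation. -/
lemma integral_inner_havg_comm {κ : Measure E2} [IsProbabilityMeasure κ]
    (hneg : MeasurePreserving (fun y : E2 => -y) κ κ) {g w : E3 → E3}
    (hg : ∀ᵐ x ∂muOmega, Integrable (fun y => g (x + hz y)) κ)
    (hw : ∀ᵐ x ∂muOmega, Integrable (fun y => w (x + hz y)) κ)
    (hint : Integrable (fun p : E3 × E2 => ⟪g p.1, w (p.1 + hz p.2)⟫) (muOmega.prod κ)) :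
    ∫ x, ⟪g x, havg κ w x⟫ ∂muOmega = ∫ x, ⟪havg κ g x, w x⟫ ∂muOmega := by
  have hmp : MeasurePreserving (fun p : E3 × E2 => (p.1 + hz p.2, -p.2)) (muOmega.prod κ)
      (muOmega.prod κ) :=
    ((MeasurePreserving.id muOmega).prod hneg).comp (measurePreserving_skew κ)
  have hint2 : Integrable (fun p : E3 × E2 => ⟪g (p.1 + hz p.2), w p.1⟫) (muOmega.prod κ) := by
    refine (hmp.integrable_comp_of_integrable hint).congr (Eventually.of_forall fun p => ?_)
    simp
  have e1 : ∫ x, ⟪g x, havg κ w x⟫ ∂muOmega =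
      ∫ p, ⟪g p.1, w (p.1 + hz p.2)⟫ ∂(muOmega.prod κ) := by
    rw [integral_prod _ hint]
    refine integral_congr_ae ?_
    filter_upwards [hw] with x hx
    exact (integral_inner hx _).symm
  have e2 : ∫ x, ⟪havg κ g x, w x⟫ ∂muOmega =
      ∫ p, ⟪g (p.1 + hz p.2), w p.1⟫ ∂(muOmega.prod κ) := by
    rw [integral_prod _ hint2]
    refine integral_congr_ae ?_
    filter_upwards [hg] with x hx
    simp_rw [real_inner_comm (w x)]
    exact (integral_inner hx _).symm
  rw [e1, e2]
  have h := integral_map (μ := muOmega.prod κ) (φ := fun p : E3 × E2 => (p.1 + hz p.2, -p.2))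
    (f := fun p : E3 × E2 => ⟪g p.1, w (p.1 + hz p.2)⟫) hmp.measurable.aemeasurable
    (by rw [hmp.map_eq]; exact hint.1)
  rw [hmp.map_eq] at h
  rw [h]
  simp

/-! ### The convective term -/

/-- The convective term `∑ⱼ uⱼ Dⱼ`; for `D = ∇u` it is `(u · ∇) u`. -/
def convect (u : E3 → E3) (D : Fin 3 → E3 → E3) (x : E3) : E3 := ∑ j, u x j • D j x

lemma enorm_convect_le (u : E3 → E3) (D : Fin 3 → E3 → E3) (x : E3) :
    ‖convect u D x‖ₑ ≤ ‖u x‖ₑ * ∑ j, ‖D j x‖ₑ := by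
  rw [Finset.mul_sum]
  refine (enorm_sum_le _ _).trans (Finset.sum_le_sum fun j _ => ?_)
  rw [enorm_smul]
  gcongr
  exact enorm_le_iff_norm_le.mpr (PiLp.norm_apply_le (u x) j)

lemma lintegral_mul_mul_le {α F G H : Type*} [MeasurableSpace α] {μ : Measure α}
    [NormedAddCommGroup F] [NormedAddCommGroup G] [NormedAddCommGroup H] {p q : ℝ≥0∞}
    [ENNReal.HolderTriple p q 2] {a : α → F} {b : α → G} {c : α → H}
    (ha : AEStronglyMeasurable a μ) (hb : AEStronglyMeasurable b μ)
    (hc : AEStronglyMeasurable c μ) :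
    ∫⁻ x, ‖a x‖ₑ * ‖b x‖ₑ * ‖c x‖ₑ ∂μ ≤ eLpNorm a p μ * eLpNorm b 2 μ * eLpNorm c q μ := by
  have h1 : eLpNorm (fun x => ‖a x‖ * ‖c x‖) 2 μ ≤ eLpNorm a p μ * eLpNorm c q μ := by
    have := eLpNorm_le_eLpNorm_mul_eLpNorm'_of_norm (p := p) (q := q) (r := 2) ha hc
      (fun x y => ‖x‖ * ‖y‖) 1 (Eventually.of_forall fun x => by simp)
    simpa using this
  have h2 : ∫⁻ x, ‖b x‖ₑ * ‖‖a x‖ * ‖c x‖‖ₑ ∂μ ≤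
      eLpNorm b 2 μ * eLpNorm (fun x => ‖a x‖ * ‖c x‖) 2 μ := by
    refine (ENNReal.pow_le_pow_left_iff (n := 2) (by norm_num)).mp ?_
    rw [mul_pow, eLpNorm_two_sq, eLpNorm_two_sq]
    exact sq_lintegral_mul_le hb.enorm (ha.norm.mul hc.norm).enorm
  calc ∫⁻ x, ‖a x‖ₑ * ‖b x‖ₑ * ‖c x‖ₑ ∂μ = ∫⁻ x, ‖b x‖ₑ * ‖‖a x‖ * ‖c x‖‖ₑ ∂μ := by
        congr with x
        rw [enorm_mul, enorm_norm, enorm_norm]; ring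
    _ ≤ eLpNorm b 2 μ * (eLpNorm a p μ * eLpNorm c q μ) := h2.trans (by gcongr)
    _ = _ := by ring

instance : ENNReal.HolderTriple 3 6 2 where
  inv_add_inv_eq_inv := by
    rw [← ENNReal.toReal_eq_toReal_iff' (by simp) (by simp), ENNReal.toReal_add (by simp) (by simp)]
    simp; norm_num

instance : ENNReal.HolderTriple 6 3 2 := ENNReal.HolderTriple.symm

lemma memLp_three_of_memLp_two_of_memLp_six {α F : Type*} [MeasurableSpace α] {μ : Measure α}
    [NormedAddCommGroup F] {u : α → F} (h2 : MemLp u 2 μ) (h6 : MemLp u 6 μ) : MemLp u 3 μ := by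
  refine ⟨h2.1, ?_⟩
  have key : ∀ {p : ℝ≥0}, p ≠ 0 →
      (eLpNorm u p μ < ⊤ ↔ ∫⁻ x, ‖u x‖ₑ ^ (p : ℝ) ∂μ < ⊤) := by
    intro p hp
    rw [← eLpNorm_nnreal_pow_eq_lintegral hp, ENNReal.rpow_lt_top_iff_of_pos (by positivity)]
  have a2 := (key (p := 2) (by norm_num)).mp h2.2
  have a6 := (key (p := 6) (by norm_num)).mp h6.2
  refine (key (p := 3) (by norm_num)).mpr ?_
  simp only [NNReal.coe_ofNat, ENNReal.rpow_ofNat] at a2 a6 ⊢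
  refine lt_of_le_of_lt (b := ∫⁻ x, ‖u x‖ₑ ^ 2 + ‖u x‖ₑ ^ 6 ∂μ) (lintegral_mono fun x => ?_) ?_
  · rcases le_total ‖u x‖ₑ 1 with h | h
    · exact (pow_le_pow_right_of_le_one' h (by norm_num)).trans le_self_add
    · exact (pow_le_pow_right₀ h (by norm_num)).trans le_add_self
  · rw [lintegral_add_left' (h2.1.enorm.pow_const 2)]
    exact ENNReal.add_lt_top.mpr ⟨a2, a6⟩

section Trilinear

variable {p q : ℝ≥0∞} [ENNReal.HolderTriple p q 2]

lemma aestronglyMeasurable_coord {u : E3 → E3} {μ : Measure E3} (h : AEStronglyMeasurable u μ)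
    (j : Fin 3) : AEStronglyMeasurable (fun x => u x j) μ :=
  (by fun_prop : Continuous fun y : E3 => y j).comp_aestronglyMeasurable h

lemma aestronglyMeasurable_convect {u : E3 → E3} {D : Fin 3 → E3 → E3} {μ : Measure E3}
    (h : AEStronglyMeasurable u μ) (hD : ∀ j, AEStronglyMeasurable (D j) μ) :
    AEStronglyMeasurable (convect u D) μ := by
  unfold convect
  exact Finset.aestronglyMeasurable_fun_sum _ fun j _ =>
    (aestronglyMeasurable_coord h j).smul (hD j)

lemma lintegral_enorm_inner_convect_le {a c : E3 → E3} {D : Fin 3 → E3 → E3}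
    (ha : AEStronglyMeasurable a muOmega) (hD : ∀ j, AEStronglyMeasurable (D j) muOmega)
    (hc : AEStronglyMeasurable c muOmega) :
    ∫⁻ x, ‖⟪convect a D x, c x⟫‖ₑ ∂muOmega ≤
      ∑ j, eLpNorm a p muOmega * eLpNorm (D j) 2 muOmega * eLpNorm c q muOmega := by
  calc ∫⁻ x, ‖⟪convect a D x, c x⟫‖ₑ ∂muOmega
      ≤ ∫⁻ x, ∑ j, ‖a x‖ₑ * ‖D j x‖ₑ * ‖c x‖ₑ ∂muOmega := by
        refine lintegral_mono fun x => ?_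
        have h1 : ‖⟪convect a D x, c x⟫‖ₑ ≤ ‖convect a D x‖ₑ * ‖c x‖ₑ := by
          rw [← enorm_norm (convect a D x), ← enorm_norm (c x), ← enorm_mul]
          refine enorm_le_iff_norm_le.mpr ?_
          rw [Real.norm_eq_abs, norm_mul, norm_norm, norm_norm]
          exact abs_real_inner_le_norm _ _
        refine h1.trans ?_
        rw [← Finset.sum_mul, ← Finset.mul_sum]
        gcongr
        exact enorm_convect_le a D x
    _ = ∑ j, ∫⁻ x, ‖a x‖ₑ * ‖D j x‖ₑ * ‖c x‖ₑ ∂muOmega :=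
        lintegral_finsetSum' _ fun j _ => (ha.enorm.mul (hD j).enorm).mul hc.enorm
    _ ≤ _ := Finset.sum_le_sum fun j _ => lintegral_mul_mul_le ha (hD j) hc

lemma integrable_inner_convect {a c : E3 → E3} {D : Fin 3 → E3 → E3}
    (ha : MemLp a p muOmega) (hD : ∀ j, MemLp (D j) 2 muOmega) (hc : MemLp c q muOmega) :
    Integrable (fun x => ⟪convect a D x, c x⟫) muOmega := by
  refine ⟨(aestronglyMeasurable_convect ha.1 fun j => (hD j).1).inner hc.1, ?_⟩
  refine (lintegral_enorm_inner_convect_le (p := p) (q := q) ha.1 (fun j => (hD j).1) hc.1).trans_lt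
    (ENNReal.sum_lt_top.mpr fun j _ => ?_)
  exact ENNReal.mul_lt_top (ENNReal.mul_lt_top ha.2 (hD j).2) hc.2

end Trilinear

lemma IsTestField.integral_inner_convect_self {φ ψ : E3 → E3} (hφ : IsTestField φ)
    (hψ : IsTestField ψ) :
    ∫ x, ⟪convect φ (fun j => pd j ψ) x, ψ x⟫ ∂muOmega = 0 := by
  have hout : ∀ x ∉ Omega, ψ x = 0 := fun x hx => by
    by_contra h
    exact hx (hψ.support_subset (subset_tsupport ψ h))
  rw [muOmega, setIntegral_eq_integral_of_forall_compl_eq_zero fun x hx => by simp [hout x hx]]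
  set Q : E3 → ℝ := fun x => ‖ψ x‖ ^ 2 with hQ
  have hQs : ContDiff ℝ ∞ Q := hψ.smooth.norm_sq ℝ
  have hQd : Differentiable ℝ Q := hQs.differentiable (by simp)
  have hQc : HasCompactSupport Q := hψ.compactSupport.comp_left (g := fun y => ‖y‖ ^ 2) (by simp)
  have hφj : ∀ j, ContDiff ℝ ∞ fun x => φ x j := fun j =>
    (contDiff_euclidean.mp hφ.smooth) j
  have hpd : ∀ j x, pd j (fun x => φ x j) x = (pd j φ x) j := by
    intro j x
    have h := (EuclideanSpace.proj j : E3 →L[ℝ] ℝ).hasFDerivAt.comp x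
      (hφ.differentiable x).hasFDerivAt
    have h2 : fderiv ℝ (fun x => φ x j) x = (EuclideanSpace.proj j : E3 →L[ℝ] ℝ).comp
      (fderiv ℝ φ x) := h.fderiv
    simp [pd, h2]
  have hpt : ∀ x, ⟪convect φ (fun j => pd j ψ) x, ψ x⟫ = ∑ j, 2⁻¹ * (φ x j * pd j Q x) := by
    intro x
    rw [convect, sum_inner]
    refine Finset.sum_congr rfl fun j _ => ?_
    have h2 : pd j Q x = 2 * ⟪ψ x, pd j ψ x⟫ := by
      have := ((hψ.differentiable x).hasFDerivAt.norm_sq).fderiv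
      simp only [pd, hQ]
      rw [this]
      simp
    rw [h2, inner_smul_left, real_inner_comm]
    simp
    ring
  have hcQ : ∀ j, Continuous (pd j Q) := fun j => (contDiff_pd j hQs).continuous
  have hcφ : ∀ j, Continuous (pd j fun x => φ x j) := fun j => (contDiff_pd j (hφj j)).continuous
  have hi1 : ∀ j, Integrable (fun x => φ x j * pd j Q x) volume := fun j =>
    ((hφj j).continuous.mul (hcQ j)).integrable_of_hasCompactSupport
      ((hasCompactSupport_pd j hQc).mul_left)
  have hi2 : ∀ j, Integrable (fun x => pd j (fun x => φ x j) x * Q x) volume := fun j =>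
    ((hcφ j).mul hQs.continuous).integrable_of_hasCompactSupport hQc.mul_left
  have hi3 : ∀ j, Integrable (fun x => φ x j * Q x) volume := fun j =>
    ((hφj j).continuous.mul hQs.continuous).integrable_of_hasCompactSupport hQc.mul_left
  have hparts : ∀ j, ∫ x, φ x j * pd j Q x = - ∫ x, pd j (fun x => φ x j) x * Q x := fun j =>
    integral_mul_fderiv_eq_neg_fderiv_mul_of_integrable (hi2 j) (hi1 j) (hi3 j)
      (fun x _ => (hφj j).differentiable (by simp) x) (fun x _ => hQd x)
  simp_rw [hpt]
  rw [integral_finsetSum _ fun j _ => (hi1 j).const_mul _]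
  simp_rw [integral_const_mul, hparts]
  rw [← Finset.mul_sum, Finset.sum_neg_distrib, ← integral_finsetSum _ fun j _ => hi2 j]
  have : ∀ x, ∑ j, pd j (fun x => φ x j) x * Q x = 0 := by
    intro x
    rw [← Finset.sum_mul]
    simp_rw [hpd]
    have := hφ.div_free x
    rw [divergence] at this
    rw [this, zero_mul]
  simp [this]

lemma MemV.integral_inner_convect_testField {u φ : E3 → E3} {Du : Fin 3 → E3 → E3}
    (hV : MemV u Du) (hφ : IsTestField φ) : ∫ x, ⟪convect φ Du x, u x⟫ ∂muOmega = 0 := by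
  obtain ⟨ψ, hψ, h6, h2⟩ := hV.approx
  have hφ3 := hφ.memLp 3
  have hi : ∀ n, Integrable (fun x => ⟪convect φ (fun j => pd j (ψ n)) x, ψ n x⟫) muOmega :=
    fun n =>
    integrable_inner_convect hφ3 (fun j => (hψ n).memLp_pd j 2) ((hψ n).memLp 6)
  have hlim := tendsto_integral_of_L1 (μ := muOmega) (fun x => ⟪convect φ Du x, u x⟫)
    (integrable_inner_convect hφ3 hV.grad_memLp hV.memLp).1
    (F := fun n x => ⟪convect φ (fun j => pd j (ψ n)) x, ψ n x⟫) (l := atTop)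
    (Eventually.of_forall hi) ?_
  · simp_rw [hφ.integral_inner_convect_self (hψ _)] at hlim
    exact (tendsto_nhds_unique tendsto_const_nhds hlim).symm
  have hb : ∀ n,
      ∫⁻ x, ‖⟪convect φ (fun j => pd j (ψ n)) x, ψ n x⟫ - ⟪convect φ Du x, u x⟫‖ₑ ∂muOmega
      ≤ ∑ j, eLpNorm φ 3 muOmega * eLpNorm (Du j - pd j (ψ n)) 2 muOmega *
          (eLpNorm u 6 muOmega + eLpNorm (u - ψ n) 6 muOmega)
        + ∑ j, eLpNorm φ 3 muOmega * eLpNorm (Du j) 2 muOmega * eLpNorm (u - ψ n) 6 muOmega := by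
    intro n
    have hD : ∀ j, MemLp (Du j - pd j (ψ n)) 2 muOmega := fun j =>
      (hV.grad_memLp j).sub ((hψ n).memLp_pd j 2)
    have hun : MemLp (u - ψ n) 6 muOmega := hV.memLp.sub ((hψ n).memLp 6)
    have b1 := lintegral_enorm_inner_convect_le (p := 3) (q := 6) hφ3.1 (fun j => (hD j).1)
      ((hψ n).memLp 6).1
    have b2 := lintegral_enorm_inner_convect_le (p := 3) (q := 6) hφ3.1
      (fun j => (hV.grad_memLp j).1) hun.1
    have b3 : eLpNorm (ψ n) 6 muOmega ≤ eLpNorm u 6 muOmega + eLpNorm (u - ψ n) 6 muOmega := by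
      have := eLpNorm_sub_le hV.memLp.1 hun.1 (p := 6) (by norm_num)
      rwa [sub_sub_cancel] at this
    have hm := (aestronglyMeasurable_convect hφ3.1 fun j => (hD j).1).inner ((hψ n).memLp 6).1
      (𝕜 := ℝ)
    refine le_trans ?_ (add_le_add (b1.trans ?_) b2)
    · rw [← lintegral_add_left' hm.enorm]
      refine lintegral_mono fun x => ?_
      have e : ⟪convect φ (fun j => pd j (ψ n)) x, ψ n x⟫ - ⟪convect φ Du x, u x⟫ =
          -(⟪convect φ (fun j => Du j - pd j (ψ n)) x, ψ n x⟫ + ⟪convect φ Du x, (u - ψ n) x⟫) := by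
        simp only [convect, Pi.sub_apply, smul_sub, Finset.sum_sub_distrib, inner_sub_left,
          inner_sub_right]
        ring
      rw [e, enorm_neg]
      exact enorm_add_le _ _
    · gcongr
  have h0 : Tendsto (fun n => ∑ j, eLpNorm φ 3 muOmega * eLpNorm (Du j - pd j (ψ n)) 2 muOmega *
          (eLpNorm u 6 muOmega + eLpNorm (u - ψ n) 6 muOmega)
        + ∑ j, eLpNorm φ 3 muOmega * eLpNorm (Du j) 2 muOmega * eLpNorm (u - ψ n) 6 muOmega) atTop
      (𝓝 (∑ j : Fin 3, eLpNorm φ 3 muOmega * 0 * (eLpNorm u 6 muOmega + 0)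
        + ∑ j : Fin 3, eLpNorm φ 3 muOmega * eLpNorm (Du j) 2 muOmega * 0)) := by
    refine (tendsto_finsetSum _ fun j _ => ?_).add (tendsto_finsetSum _ fun j _ => ?_)
    · refine ENNReal.Tendsto.mul (ENNReal.Tendsto.const_mul (h2 j) (Or.inr hφ3.2.ne)) ?_
        (tendsto_const_nhds.add h6) ?_
      · right; simpa using hV.memLp.2.ne
      · right; simp
    · exact ENNReal.Tendsto.const_mul h6
        (Or.inr (ENNReal.mul_ne_top hφ3.2.ne (hV.grad_memLp j).2.ne))
  simp only [mul_zero, zero_mul, Finset.sum_const_zero, add_zero] at h0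
  exact tendsto_of_tendsto_of_tendsto_of_le_of_le tendsto_const_nhds h0 (fun _ => zero_le) hb

/-- The convective term is orthogonal to the field: `((u · ∇) u, u) = 0` for `u ∈ L² ∩ V`. -/
theorem MemV.integral_inner_convect_self {u : E3 → E3} {Du : Fin 3 → E3 → E3}
    (hu : MemLp u 2 muOmega) (hV : MemV u Du) :
    Integrable (fun x => ⟪convect u Du x, u x⟫) muOmega ∧
      ∫ x, ⟪convect u Du x, u x⟫ ∂muOmega = 0 := by
  have hu3 := memLp_three_of_memLp_two_of_memLp_six hu hV.memLp
  have hI := integrable_inner_convect hV.memLp hV.grad_memLp hu3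
  refine ⟨hI, ?_⟩
  obtain ⟨ψ, hψ, h6, -⟩ := hV.approx
  have hlim := tendsto_integral_of_L1 (μ := muOmega) (fun x => ⟪convect u Du x, u x⟫) hI.1
    (F := fun n x => ⟪convect (ψ n) Du x, u x⟫) (l := atTop)
    (Eventually.of_forall fun n => integrable_inner_convect ((hψ n).memLp 6) hV.grad_memLp hu3) ?_
  · simp_rw [hV.integral_inner_convect_testField (hψ _)] at hlim
    exact (tendsto_nhds_unique tendsto_const_nhds hlim).symm
  have hb : ∀ n, ∫⁻ x, ‖⟪convect (ψ n) Du x, u x⟫ - ⟪convect u Du x, u x⟫‖ₑ ∂muOmega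
      ≤ ∑ j, eLpNorm (u - ψ n) 6 muOmega * eLpNorm (Du j) 2 muOmega * eLpNorm u 3 muOmega := by
    intro n
    refine le_trans (lintegral_mono fun x => ?_) (lintegral_enorm_inner_convect_le (p := 6) (q := 3)
      (hV.memLp.sub ((hψ n).memLp 6)).1 (fun j => (hV.grad_memLp j).1) hu3.1)
    have e : ⟪convect (ψ n) Du x, u x⟫ - ⟪convect u Du x, u x⟫ =
        -⟪convect (u - ψ n) Du x, u x⟫ := by
      simp only [convect, Pi.sub_apply, PiLp.sub_apply, sub_smul, Finset.sum_sub_distrib,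
        inner_sub_left]
      ring
    rw [e, enorm_neg]
  have h0 : Tendsto (fun n => ∑ j, eLpNorm (u - ψ n) 6 muOmega * eLpNorm (Du j) 2 muOmega *
      eLpNorm u 3 muOmega) atTop
      (𝓝 (∑ j : Fin 3, 0 * eLpNorm (Du j) 2 muOmega * eLpNorm u 3 muOmega)) :=
    tendsto_finsetSum _ fun j _ => ENNReal.Tendsto.mul_const
      (ENNReal.Tendsto.mul_const h6 (Or.inr (hV.grad_memLp j).2.ne)) (Or.inr hu3.2.ne)
  simp only [zero_mul, Finset.sum_const_zero] at h0
  exact tendsto_of_tendsto_of_tendsto_of_le_of_le tendsto_const_nhds h0 (fun _ => zero_le) hb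

/-! ### Evaluation of the weak formulation at a given time -/

lemma intervalIntegral_eq_Ioo {t : ℝ} (ht : 0 ≤ t) (f : ℝ → ℝ) :
    ∫ τ in (0 : ℝ)..t, f τ = ∫ τ in Ioo 0 t, f τ := by
  rw [intervalIntegral.integral_of_le ht, integral_Ioc_eq_integral_Ioo]

/-- A function `g` with `g' = -G` in the sense of distributions on `[0, T)`, including the initial
value `c`, is given by integrating `-G`. -/
lemma eq_sub_integral_of_weak_deriv {T : ℝ} (hT : 0 < T) {g G : ℝ → ℝ} {c : ℝ}
    (hg : ContinuousOn g (Icc 0 T)) (hG : IntervalIntegrable G volume 0 T)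
    (h : ∀ θ : ℝ → ℝ, ContDiff ℝ ∞ θ → HasCompactSupport θ → tsupport θ ⊆ Iio T →
      ∫ t in (0 : ℝ)..T, (deriv θ t * g t - θ t * G t) = - (θ 0 * c)) :
    ∀ t ∈ Icc 0 T, g t = c - ∫ τ in (0 : ℝ)..t, G τ := by
  set Γ : ℝ → ℝ := fun t => ∫ τ in (0 : ℝ)..t, G τ with hΓ
  have hΓac : AbsolutelyContinuousOnInterval Γ 0 T :=
    hG.absolutelyContinuousOnInterval_intervalIntegral left_mem_uIcc
  have hΓc : ContinuousOn Γ (Icc 0 T) := by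
    have := hΓac.continuousOn
    rwa [uIcc_of_le hT.le] at this
  have hKc : ContinuousOn (fun t => g t + Γ t - c) (Icc 0 T) :=
    (hg.add hΓc).sub continuousOn_const
  have hweak : ∀ η : ℝ → ℝ, ContDiff ℝ ∞ η → HasCompactSupport η → tsupport η ⊆ Ioo 0 T →
      ∫ t, η t • (g t + Γ t - c) = 0 := by
    intro η hη hηc hηs
    obtain ⟨b, hbT, hb⟩ : ∃ b < T, ∀ t, b < t → η t = 0 := by
      rcases (tsupport η).eq_empty_or_nonempty with he | hne
      · refine ⟨T - 1, by linarith, fun t _ => image_eq_zero_of_notMem_tsupport (by simp [he])⟩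
      · obtain ⟨b, hb, hbmax⟩ := hηc.isCompact.exists_isGreatest hne
        refine ⟨b, (hηs hb).2, fun t ht => image_eq_zero_of_notMem_tsupport fun hmem => ?_⟩
        exact absurd (hbmax hmem) (not_le.mpr ht)
    -- the primitive of `η` that vanishes near `T`, cut off at negative times
    set Θ : ℝ → ℝ := fun t => ∫ τ in T..t, η τ with hΘ
    have hΘd : ∀ t, HasDerivAt Θ (η t) t := fun t =>
      intervalIntegral.integral_hasDerivAt_right (hη.continuous.intervalIntegrable _ _)
        hη.continuous.stronglyMeasurable.stronglyMeasurableAtFilter hη.continuous.continuousAt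
    have hΘs : ContDiff ℝ ∞ Θ := by
      rw [contDiff_infty_iff_deriv]
      refine ⟨fun t => (hΘd t).differentiableAt, ?_⟩
      have : deriv Θ = η := funext fun t => (hΘd t).deriv
      rwa [this]
    have hΘ0 : ∀ t, b < t → Θ t = 0 := by
      intro t ht
      refine intervalIntegral.integral_zero_ae (Eventually.of_forall fun s hs => hb s ?_)
      have := hs.1
      exact lt_of_lt_of_le (by simp [hbT, ht]) this.le
    set χ : ℝ → ℝ := fun t => Real.smoothTransition (t + 2) with hχ
    have hχs : ContDiff ℝ ∞ χ :=
      Real.smoothTransition.contDiff.comp (contDiff_id.add contDiff_const)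
    set θ : ℝ → ℝ := fun t => χ t * Θ t with hθ
    have hθsupp : Function.support θ ⊆ Icc (-2) b := by
      intro t ht
      rw [Function.mem_support] at ht
      constructor
      · by_contra hlt
        apply ht
        have : χ t = 0 := Real.smoothTransition.zero_of_nonpos (by linarith)
        simp [hθ, this]
      · by_contra hlt
        apply ht
        simp [hθ, hΘ0 t (not_le.mp hlt)]
    have hθts : tsupport θ ⊆ Icc (-2) b := closure_minimal hθsupp isClosed_Icc
    have hθeq : ∀ t, -1 < t → θ =ᶠ[𝓝 t] Θ := by
      intro t ht
      filter_upwards [lt_mem_nhds ht] with s hs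
      have : χ s = 1 := Real.smoothTransition.one_of_one_le (by linarith)
      simp [hθ, this]
    have hθd : ∀ t, -1 < t → deriv θ t = η t := fun t ht =>
      (hθeq t ht).deriv_eq.trans (hΘd t).deriv
    have hθs : ContDiff ℝ ∞ θ := hχs.mul hΘs
    have h1 := h θ hθs (HasCompactSupport.of_support_subset_isCompact isCompact_Icc hθsupp)
      (hθts.trans fun t ht => lt_of_le_of_lt ht.2 hbT)
    have hθac : AbsolutelyContinuousOnInterval θ 0 T :=
      ((hθs.of_le (by simp)).contDiffOn).absolutelyContinuousOnInterval
    have hparts := hθac.integral_mul_deriv_eq_deriv_mul hΓac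
    have hθT : θ T = 0 := by simp [hθ, hΘ0 T hbT]
    have hΓ0 : Γ 0 = 0 := by simp [hΓ]
    have hderivΓ : ∫ t in (0 : ℝ)..T, θ t * deriv Γ t = ∫ t in (0 : ℝ)..T, θ t * G t := by
      refine intervalIntegral.integral_congr_ae ?_
      filter_upwards [hG.ae_hasDerivAt_integral] with t ht hmem
      rw [(ht (uIoc_subset_uIcc hmem) 0 left_mem_uIcc).deriv]
    have hηd : ∀ F : ℝ → ℝ, ∫ t in (0 : ℝ)..T, deriv θ t * F t = ∫ t in (0 : ℝ)..T, η t * F t := by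
      intro F
      refine intervalIntegral.integral_congr fun t ht => ?_
      rw [uIcc_of_le hT.le] at ht
      simp only [hθd t (by linarith [ht.1])]
    rw [hderivΓ, hθT, hΓ0, hηd] at hparts
    have hi1 : IntervalIntegrable (fun t => η t * g t) volume 0 T :=
      (hη.continuous.continuousOn.mul (by rwa [uIcc_of_le hT.le])).intervalIntegrable
    have hi2 : IntervalIntegrable (fun t => η t * Γ t) volume 0 T :=
      (hη.continuous.continuousOn.mul (by rwa [uIcc_of_le hT.le])).intervalIntegrable
    have hi3 : IntervalIntegrable (fun t => η t * c) volume 0 T :=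
      (hη.continuous.mul continuous_const).intervalIntegrable _ _
    have hi1' : IntervalIntegrable (fun t => deriv θ t * g t) volume 0 T := by
      refine hi1.congr fun t ht => ?_
      have ht' := (uIoc_of_le hT.le ▸ ht).1
      simp only [hθd t (by linarith)]
    rw [intervalIntegral.integral_sub hi1' (hG.continuousOn_mul hθs.continuous.continuousOn),
      hηd g] at h1
    have hθ0 : θ 0 = - ∫ t in (0 : ℝ)..T, η t := by
      rw [(hθeq 0 (by norm_num)).eq_of_nhds, hΘ, ← intervalIntegral.integral_symm]
    have hfin : ∫ t in (0 : ℝ)..T, η t * (g t + Γ t - c) = 0 := by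
      have e : ∀ t, η t * (g t + Γ t - c) = η t * g t + η t * Γ t - η t * c := fun t => by ring
      simp_rw [e]
      rw [intervalIntegral.integral_sub (hi1.add hi2) hi3, intervalIntegral.integral_add hi1 hi2,
        intervalIntegral.integral_mul_const]
      rw [hθ0] at h1
      linarith
    rw [intervalIntegral_eq_Ioo hT.le, setIntegral_eq_integral_of_forall_compl_eq_zero] at hfin
    · exact hfin
    · intro t ht
      rw [image_eq_zero_of_notMem_tsupport fun hm => ht (hηs hm), zero_mul]
  have hae := isOpen_Ioo.ae_eq_zero_of_integral_contDiff_smul_eq_zero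
    ((hKc.mono Ioo_subset_Icc_self).locallyIntegrableOn measurableSet_Ioo) hweak
  have hae2 : (fun t => g t + Γ t - c) =ᵐ[volume.restrict (Icc 0 T)] fun _ => 0 := by
    rw [restrict_Ioo_eq_restrict_Icc.symm, Filter.EventuallyEq, ae_restrict_iff' measurableSet_Ioo]
    exact hae
  have := Measure.eqOn_Icc_of_ae_eq volume hT.ne hae2 hKc continuousOn_const
  intro t ht
  have := this ht
  simp only at this
  change g t = c - Γ t
  linarith

/-! ### Measurability and integrability on space-time -/

section SpaceTime

variable {κ : Measure E2} [IsProbabilityMeasure κ] {ρ : Measure ℝ} [SFinite ρ]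
  {F : Type*} [NormedAddCommGroup F]

lemma measurePreserving_skew_time (ρ : Measure ℝ) [SFinite ρ] (κ : Measure E2) [SFinite κ] :
    MeasurePreserving (fun p : (ℝ × E3) × E2 => ((p.1.1, p.1.2 + hz p.2), p.2))
      ((ρ.prod muOmega).prod κ) ((ρ.prod muOmega).prod κ) := by
  have h1 : MeasurePreserving (fun p : ℝ × (E3 × E2) => (p.1, (p.2.1 + hz p.2.2, p.2.2)))
      (ρ.prod (muOmega.prod κ)) (ρ.prod (muOmega.prod κ)) :=
    (MeasurePreserving.id ρ).prod (measurePreserving_skew κ)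
  have h2 := measurePreserving_prodAssoc ρ muOmega κ
  exact (h2.symm.comp h1).comp h2

lemma aestronglyMeasurable_add_hz_time {A : ℝ × E3 → F}
    (hA : AEStronglyMeasurable A (ρ.prod muOmega)) :
    AEStronglyMeasurable (fun p : (ℝ × E3) × E2 => A (p.1.1, p.1.2 + hz p.2))
      ((ρ.prod muOmega).prod κ) :=
  (hA.comp_fst (ν := κ)).comp_quasiMeasurePreserving
    (measurePreserving_skew_time ρ κ).quasiMeasurePreserving

lemma aestronglyMeasurable_havg_time [NormedSpace ℝ F] {A : ℝ → E3 → F}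
    (hA : AEStronglyMeasurable (fun p : ℝ × E3 => A p.1 p.2) (ρ.prod muOmega)) :
    AEStronglyMeasurable (fun p : ℝ × E3 => havg κ (A p.1) p.2) (ρ.prod muOmega) :=
  (aestronglyMeasurable_add_hz_time (κ := κ) hA).integral_prod_right'

/-- Averaging the test function commutes with the integration over space-time. -/
lemma integral_integral_inner_translate {A : ℝ → E3 → E3} {w : E3 → E3}
    (hw : ∀ᵐ x ∂muOmega, Integrable (fun y => w (x + hz y)) κ)
    (hint : Integrable (fun p : (ℝ × E3) × E2 => ⟪A p.1.1 p.1.2, w (p.1.2 + hz p.2)⟫)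
      ((ρ.prod muOmega).prod κ)) :
    Integrable (fun y => ∫ τ, ∫ x, ⟪A τ x, w (x + hz y)⟫ ∂muOmega ∂ρ) κ ∧
    ∫ y, ∫ τ, ∫ x, ⟪A τ x, w (x + hz y)⟫ ∂muOmega ∂ρ ∂κ =
      ∫ τ, ∫ x, ⟪A τ x, havg κ w x⟫ ∂muOmega ∂ρ ∧
    Integrable (fun τ => ∫ x, ⟪A τ x, havg κ w x⟫ ∂muOmega) ρ := by
  have e1 : (fun y => ∫ q : ℝ × E3, ⟪A q.1 q.2, w (q.2 + hz y)⟫ ∂(ρ.prod muOmega)) =ᵐ[κ]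
      fun y => ∫ τ, ∫ x, ⟪A τ x, w (x + hz y)⟫ ∂muOmega ∂ρ := by
    filter_upwards [hint.prod_left_ae] with y hy
    exact integral_prod _ hy
  have e2 : (fun q : ℝ × E3 => ∫ y, ⟪A q.1 q.2, w (q.2 + hz y)⟫ ∂κ) =ᵐ[ρ.prod muOmega]
      fun q => ⟪A q.1 q.2, havg κ w q.2⟫ := by
    filter_upwards [Measure.quasiMeasurePreserving_snd.ae hw] with q hq
    exact integral_inner hq _
  have i2 : Integrable (fun q : ℝ × E3 => ⟪A q.1 q.2, havg κ w q.2⟫) (ρ.prod muOmega) :=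
    hint.integral_prod_left.congr e2
  refine ⟨hint.integral_prod_right.congr e1, ?_, i2.integral_prod_left⟩
  rw [← integral_congr_ae e1, ← integral_prod_symm _ hint, integral_prod _ hint,
    integral_congr_ae e2, integral_prod _ i2]

lemma integrable_inner_translate_of_memLp [IsFiniteMeasure ρ] {A : ℝ → E3 → E3} {w : E3 → E3}
    (hA : MemLp (fun p : ℝ × E3 => A p.1 p.2) 2 (ρ.prod muOmega)) (hw : MemLp w 2 muOmega) :
    Integrable (fun p : (ℝ × E3) × E2 => ⟪A p.1.1 p.1.2, w (p.1.2 + hz p.2)⟫)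
      ((ρ.prod muOmega).prod κ) :=
  integrable_inner_of_memLp (hA.comp_fst κ)
    (((hw.comp_snd ρ).comp_fst κ).comp_measurePreserving (measurePreserving_skew_time ρ κ))

omit [SFinite ρ] in
lemma integrable_inner_translate_of_bounded {A : ℝ → E3 → E3} {w : E3 → E3}
    (hA : Integrable (fun p : ℝ × E3 => A p.1 p.2) (ρ.prod muOmega)) (hw : Continuous w) {C : ℝ}
    (hC : ∀ x, ‖w x‖ ≤ C) :
    Integrable (fun p : (ℝ × E3) × E2 => ⟪A p.1.1 p.1.2, w (p.1.2 + hz p.2)⟫)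
      ((ρ.prod muOmega).prod κ) := by
  have hA2 := hA.comp_fst κ
  have hwc : Continuous fun p : (ℝ × E3) × E2 => w (p.1.2 + hz p.2) := hw.comp (by fun_prop)
  refine Integrable.mono' (hA2.norm.mul_const C)
    (hA2.1.inner hwc.aestronglyMeasurable) (Eventually.of_forall fun p => ?_)
  refine (norm_inner_le_norm _ _).trans ?_
  gcongr
  exact hC _

lemma integrable_inner_translate_of_memLp_slice {u w : E3 → E3} (hu : MemLp u 2 muOmega)
    (hw : MemLp w 2 muOmega) :
    Integrable (fun p : E3 × E2 => ⟪u p.1, w (p.1 + hz p.2)⟫) (muOmega.prod κ) :=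
  integrable_inner_of_memLp (hu.comp_fst κ)
    ((hw.comp_fst κ).comp_measurePreserving (measurePreserving_skew κ))

lemma integral_inner_havg_comm_of_memLp (hneg : MeasurePreserving (fun y : E2 => -y) κ κ)
    {a b : E3 → E3} (ha : MemLp a 2 muOmega) (hb : MemLp b 2 muOmega) :
    ∫ x, ⟪a x, havg κ b x⟫ ∂muOmega = ∫ x, ⟪havg κ a x, b x⟫ ∂muOmega :=
  integral_inner_havg_comm hneg (ae_integrable_add_hz_of_memLp_two ha)
    (ae_integrable_add_hz_of_memLp_two hb) (integrable_inner_translate_of_memLp_slice ha hb)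

lemma integral_inner_havg_eq {g w : E3 → E3}
    (hw : ∀ᵐ x ∂muOmega, Integrable (fun y => w (x + hz y)) κ)
    (hint : Integrable (fun p : E3 × E2 => ⟪g p.1, w (p.1 + hz p.2)⟫) (muOmega.prod κ)) :
    ∫ y, ∫ x, ⟪g x, w (x + hz y)⟫ ∂muOmega ∂κ = ∫ x, ⟪g x, havg κ w x⟫ ∂muOmega := by
  rw [← integral_prod_symm _ hint, integral_prod _ hint]
  refine integral_congr_ae ?_
  filter_upwards [hw] with x hx
  exact integral_inner hx _

end SpaceTime

/-! ### Leray–Hopf solutions: integrability and the averaged equation -/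

section LerayHopf

variable {ν T : ℝ} {v₀ : E3 → E3} {v : ℝ → E3 → E3} {Dv : Fin 3 → ℝ → E3 → E3}

lemma spaceTime_mono {t T : ℝ} (h : t ≤ T) : spaceTime t ≤ spaceTime T :=
  Measure.prod_mono (Measure.restrict_mono (Ioo_subset_Ioo_right h) le_rfl) le_rfl

/-- The convective term `(v · ∇) v` at time `t`. -/
def convTerm (v : ℝ → E3 → E3) (Dv : Fin 3 → ℝ → E3 → E3) (t : ℝ) : E3 → E3 :=
  convect (v t) fun j => Dv j t

namespace IsLerayHopf

lemma memLp_slice (hv : IsLerayHopf ν T v₀ v Dv) {t : ℝ} (ht : t ∈ Icc 0 T) :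
    MemLp (v t) 2 muOmega := (hv.memH t ht).1

lemma memLp_spaceTime (hv : IsLerayHopf ν T v₀ v Dv) :
    MemLp (fun p : ℝ × E3 => v p.1 p.2) 2 (spaceTime T) := by
  refine ⟨hv.measurable, ?_⟩
  obtain ⟨C, hC⟩ := hv.bounded
  have h : eLpNorm (fun p : ℝ × E3 => v p.1 p.2) 2 (spaceTime T) ^ 2 < ⊤ := by
    rw [eLpNorm_two_sq, spaceTime, lintegral_prod _ (hv.measurable.enorm.pow_const 2)]
    calc ∫⁻ t in Ioo 0 T, ∫⁻ x, ‖v t x‖ₑ ^ 2 ∂muOmega ≤ ∫⁻ _ in Ioo 0 T, (C : ℝ≥0∞) ^ 2 := by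
          refine lintegral_mono_ae ?_
          filter_upwards [hC] with t ht
          rw [← eLpNorm_two_sq]
          gcongr
      _ < ⊤ := by
          rw [setLIntegral_const, Real.volume_Ioo]
          exact ENNReal.mul_lt_top (by simp) ENNReal.ofReal_lt_top
  contrapose! h
  rw [top_le_iff.mp h]
  simp

lemma integrable_convTerm (hv : IsLerayHopf ν T v₀ v Dv) :
    Integrable (fun p : ℝ × E3 => convTerm v Dv p.1 p.2) (spaceTime T) := by
  unfold convTerm convect
  refine integrable_finsetSum _ fun j _ => ?_
  have h1 : MemLp (fun p : ℝ × E3 => v p.1 p.2 j) 2 (spaceTime T) :=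
    hv.memLp_spaceTime.of_le
      ((by fun_prop : Continuous fun y : E3 => y j).comp_aestronglyMeasurable hv.measurable)
      (Eventually.of_forall fun p => PiLp.norm_apply_le _ _)
  exact memLp_one_iff_integrable.mp ((hv.grad_memLp j).smul h1 (r := 1))

lemma lpNorm_le (hν : 0 < ν) (hv : IsLerayHopf ν T v₀ v Dv) {t : ℝ} (ht : t ∈ Icc 0 T) :
    lpNorm (v t) 2 muOmega ≤ lpNorm v₀ 2 muOmega := by
  have h := hv.energy_inequality t ht
  have hd : 0 ≤ dissipation Dv t :=
    intervalIntegral.integral_nonneg ht.1 fun τ _ => Finset.sum_nonneg fun j _ =>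
      integral_nonneg fun x => by positivity
  rw [normSq, normSq, integral_norm_sq_eq_lpNorm_sq (hv.memLp_slice ht).1,
    integral_norm_sq_eq_lpNorm_sq hv.initial_memH.1.1] at h
  have h2 := mul_nonneg hν.le hd
  exact (sq_le_sq₀ lpNorm_nonneg lpNorm_nonneg).mp (by linarith)

lemma weak_identity (hT : 0 < T) (hv : IsLerayHopf ν T v₀ v Dv) {ψ : E3 → E3}
    (hψ : IsTestField ψ) {t : ℝ} (ht : t ∈ Icc 0 T) :
    ∫ x, ⟪v t x, ψ x⟫ ∂muOmega = ∫ x, ⟪v₀ x, ψ x⟫ ∂muOmega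
      - ((ν * ∑ j, ∫ τ in Ioo 0 t, ∫ x, ⟪Dv j τ x, pd j ψ x⟫ ∂muOmega)
        + ∫ τ in Ioo 0 t, ∫ x, ⟪convTerm v Dv τ x, ψ x⟫ ∂muOmega) := by
  have hψ2 := hψ.memLp 2
  obtain ⟨C, hC⟩ := hψ.compactSupport.exists_bound_of_continuous hψ.smooth.continuous
  have i1 : ∀ j, Integrable (fun p : ℝ × E3 => ⟪Dv j p.1 p.2, pd j ψ p.2⟫) (spaceTime T) := fun j =>
    integrable_inner_of_memLp (hv.grad_memLp j) ((hψ.memLp_pd j 2).comp_snd _)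
  have i2 : Integrable (fun p : ℝ × E3 => ⟪convTerm v Dv p.1 p.2, ψ p.2⟫) (spaceTime T) := by
    refine Integrable.mono' (hv.integrable_convTerm.norm.mul_const C)
      (hv.integrable_convTerm.1.inner
        ((hψ.smooth.continuous.comp continuous_snd).aestronglyMeasurable))
      (Eventually.of_forall fun p => ?_)
    refine (norm_inner_le_norm _ _).trans ?_
    gcongr
    exact hC _
  have j1 : ∀ j, Integrable (fun τ => ∫ x, ⟪Dv j τ x, pd j ψ x⟫ ∂muOmega)
      (volume.restrict (Ioo 0 T)) := fun j => (i1 j).integral_prod_left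
  have j2 : Integrable (fun τ => ∫ x, ⟪convTerm v Dv τ x, ψ x⟫ ∂muOmega)
      (volume.restrict (Ioo 0 T)) := i2.integral_prod_left
  set G : ℝ → ℝ := fun τ => ν * (∑ j, ∫ x, ⟪Dv j τ x, pd j ψ x⟫ ∂muOmega)
    + ∫ x, ⟪convTerm v Dv τ x, ψ x⟫ ∂muOmega with hG
  have hGi : Integrable G (volume.restrict (Ioo 0 T)) :=
    ((integrable_finsetSum _ fun j _ => j1 j).const_mul ν).add j2
  have hsum : ∀ᵐ τ ∂(volume.restrict (Ioo 0 T)), ∫ x, ∑ j, ⟪Dv j τ x, pd j ψ x⟫ ∂muOmega =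
      ∑ j, ∫ x, ⟪Dv j τ x, pd j ψ x⟫ ∂muOmega := by
    have := fun j => (i1 j).prod_right_ae
    filter_upwards [eventually_countable_forall.mpr this] with τ hτ
    exact integral_finsetSum _ fun j _ => hτ j
  have key := eq_sub_integral_of_weak_deriv hT (hv.weakly_continuous ψ hψ2)
    ((intervalIntegrable_iff_integrableOn_Ioo_of_le hT.le).mpr hGi)
    (c := ∫ x, ⟪v₀ x, ψ x⟫ ∂muOmega) (fun θ hθ hθc hθs => ?_) t ht
  · rw [key, intervalIntegral_eq_Ioo ht.1, hG]
    have hsub : Ioo 0 t ⊆ Ioo 0 T := Ioo_subset_Ioo_right ht.2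
    rw [integral_add, integral_const_mul, integral_finsetSum]
    · exact fun j _ => (j1 j).mono_measure (Measure.restrict_mono hsub le_rfl)
    · exact ((integrable_finsetSum _ fun j _ => j1 j).const_mul ν).mono_measure
        (Measure.restrict_mono hsub le_rfl)
    · exact j2.mono_measure (Measure.restrict_mono hsub le_rfl)
  have htest : IsSpaceTimeTest T fun s x => θ s • ψ x := by
    have hsm : ContDiff ℝ ∞ fun p : ℝ × E3 => θ p.1 • ψ p.2 :=
      (hθ.comp contDiff_fst).smul (hψ.smooth.comp contDiff_snd)
    have hsub : tsupport (fun p : ℝ × E3 => θ p.1 • ψ p.2) ⊆ tsupport θ ×ˢ tsupport ψ := by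
      refine closure_minimal (fun p hp => ?_) ((isClosed_tsupport _).prod (isClosed_tsupport _))
      rw [Function.mem_support] at hp
      exact ⟨subset_tsupport _ fun h0 => hp (by simp [h0]),
        subset_tsupport _ fun h0 => hp (by simp [h0])⟩
    refine ⟨hsm, ?_, hsub.trans (prod_mono hθs hψ.support_subset), fun s _ x => ?_⟩
    · exact HasCompactSupport.of_support_subset_isCompact (hθc.isCompact.prod hψ.compactSupport)
        ((subset_tsupport _).trans hsub)
    · have := (hψ.smul (θ s)).div_free x
      exact this
  have hw := hv.weak_form _ htest
  have hpd : ∀ (s : ℝ) (j : Fin 3) (x : E3), pd j (fun x => θ s • ψ x) x = θ s • pd j ψ x := by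
    intro s j x
    have := congrFun (hψ.pd_smul (θ s) j) x
    exact this
  have hderiv : ∀ (s : ℝ) (x : E3), deriv (fun s => θ s • ψ x) s = deriv θ s • ψ x := fun s x =>
    deriv_smul_const (hθ.differentiable (by simp) s) (ψ x)
  simp_rw [hpd, hderiv, inner_smul_right, integral_const_mul, ← Finset.mul_sum,
    integral_const_mul] at hw
  rw [← hw]
  refine intervalIntegral.integral_congr_ae ?_
  rw [ae_restrict_iff' measurableSet_Ioo] at hsum
  have hne : ∀ᵐ s : ℝ, s ≠ T := by simp [ae_iff]
  filter_upwards [hsum, hne] with s hs hsT hmem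
  rw [uIoc_of_le hT.le] at hmem
  rw [hs ⟨hmem.1, lt_of_le_of_ne hmem.2 hsT⟩]
  simp only [hG, convTerm, convect]
  ring

end IsLerayHopf

end LerayHopf

section Pairing

variable {ρ : Measure ℝ} [SFinite ρ]

omit [SFinite ρ] in
lemma aestronglyMeasurable_integral_inner {Q : ℝ → E3 → E3} {φ : E3 → E3}
    (hQ : AEStronglyMeasurable (fun p : ℝ × E3 => Q p.1 p.2) (ρ.prod muOmega))
    (hφ : AEStronglyMeasurable φ muOmega) :
    AEStronglyMeasurable (fun τ => ∫ x, ⟪Q τ x, φ x⟫ ∂muOmega) ρ :=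
  AEStronglyMeasurable.integral_prod_right' (f := fun p : ℝ × E3 => ⟪Q p.1 p.2, φ p.2⟫)
    (hQ.inner (hφ.comp_snd (μ := ρ)))

omit [SFinite ρ] in
lemma tendsto_integral_integral_inner {Q : ℝ → E3 → E3} {b : ℝ → ℝ}
    (hQm : AEStronglyMeasurable (fun p : ℝ × E3 => Q p.1 p.2) (ρ.prod muOmega))
    (hQ : ∀ᵐ τ ∂ρ, MemLp (Q τ) 2 muOmega ∧ lpNorm (Q τ) 2 muOmega ≤ b τ) (hb : Integrable b ρ)
    {χ : E3 → E3} (hχ : MemLp χ 2 muOmega) {φ : ℕ → E3 → E3} (hφ : ∀ n, MemLp (φ n) 2 muOmega)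
    (h : Tendsto (fun n => eLpNorm (χ - φ n) 2 muOmega) atTop (𝓝 0)) :
    Tendsto (fun n => ∫ τ, ∫ x, ⟪Q τ x, φ n x⟫ ∂muOmega ∂ρ) atTop
      (𝓝 (∫ τ, ∫ x, ⟪Q τ x, χ x⟫ ∂muOmega ∂ρ)) := by
  have hev : ∀ᶠ n in atTop, lpNorm (φ n) 2 muOmega ≤ lpNorm χ 2 muOmega + 1 := by
    filter_upwards [h.eventually (gt_mem_nhds one_pos)] with n hn
    have h1 := lpNorm_sub_le hχ (g := χ - φ n) (p := 2) (by norm_num)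
    rw [sub_sub_cancel] at h1
    have h2 : lpNorm (χ - φ n) 2 muOmega ≤ 1 := by
      rw [lpNorm_eq_toReal (hχ.sub (hφ n)).1]
      exact ENNReal.toReal_le_of_le_ofReal zero_le_one (by simpa using hn.le)
    linarith
  refine tendsto_integral_filter_of_dominated_convergence
    (fun τ => b τ * (lpNorm χ 2 muOmega + 1))
    (Eventually.of_forall fun n => aestronglyMeasurable_integral_inner hQm (hφ n).1) ?_
    (hb.mul_const _) ?_
  · filter_upwards [hev] with n hn
    filter_upwards [hQ] with τ hτ
    refine (abs_integral_inner_le hτ.1 (hφ n)).trans ?_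
    exact mul_le_mul hτ.2 hn lpNorm_nonneg (lpNorm_nonneg.trans hτ.2)
  · filter_upwards [hQ] with τ hτ
    exact tendsto_integral_inner hτ.1 hχ hφ h

lemma memLp_havg_time {κ : Measure E2} [IsProbabilityMeasure κ] {A : ℝ → E3 → E3}
    (hA : MemLp (fun p : ℝ × E3 => A p.1 p.2) 2 (ρ.prod muOmega)) :
    MemLp (fun p : ℝ × E3 => havg κ (A p.1) p.2) 2 (ρ.prod muOmega) := by
  have hm := aestronglyMeasurable_havg_time (κ := κ) hA.1
  refine ⟨hm, lt_of_le_of_lt ?_ hA.2⟩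
  refine (ENNReal.pow_le_pow_left_iff (n := 2) (by norm_num)).mp ?_
  rw [eLpNorm_two_sq, eLpNorm_two_sq, lintegral_prod _ (hm.enorm.pow_const 2),
    lintegral_prod _ (hA.1.enorm.pow_const 2)]
  refine lintegral_mono_ae ?_
  filter_upwards [hA.1.prodMk_left] with τ hτ
  rw [← eLpNorm_two_sq, ← eLpNorm_two_sq muOmega (A τ)]
  gcongr
  exact eLpNorm_havg_le hτ

end Pairing

section LerayHopfAverage

variable {ν T : ℝ} {v₀ : E3 → E3} {v : ℝ → E3 → E3} {Dv : Fin 3 → ℝ → E3 → E3}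
  {κ : Measure E2} [IsProbabilityMeasure κ]

/-- The squared `L²` norm of the gradient at time `τ`. -/
def gradSq (Dv : Fin 3 → ℝ → E3 → E3) (τ : ℝ) : ℝ := ∑ j, normSq (Dv j τ)

lemma normSq_nonneg (u : E3 → E3) : 0 ≤ normSq u := integral_nonneg fun x => by positivity

lemma gradSq_nonneg (τ : ℝ) : 0 ≤ gradSq Dv τ := Finset.sum_nonneg fun _ _ => normSq_nonneg _

lemma normSq_eq_lpNorm_sq {u : E3 → E3} (hu : AEStronglyMeasurable u muOmega) :
    normSq u = lpNorm u 2 muOmega ^ 2 := integral_norm_sq_eq_lpNorm_sq hu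

lemma lpNorm_sq_le_gradSq {τ : ℝ} (h : ∀ j, MemLp (Dv j τ) 2 muOmega) (j : Fin 3) :
    lpNorm (Dv j τ) 2 muOmega ^ 2 ≤ gradSq Dv τ := by
  rw [← normSq_eq_lpNorm_sq (h j).1]
  exact Finset.single_le_sum (f := fun j => normSq (Dv j τ)) (fun _ _ => normSq_nonneg _)
    (Finset.mem_univ j)

lemma lpNorm_le_one_add_gradSq {τ : ℝ} (h : ∀ j, MemLp (Dv j τ) 2 muOmega) (j : Fin 3) :
    lpNorm (Dv j τ) 2 muOmega ≤ 1 + gradSq Dv τ := by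
  nlinarith [lpNorm_sq_le_gradSq h j, sq_nonneg (lpNorm (Dv j τ) 2 muOmega - 1)]

lemma lpNorm_havg_le {u : E3 → E3} (hu : MemLp u 2 muOmega) :
    lpNorm (havg κ u) 2 muOmega ≤ lpNorm u 2 muOmega := by
  rw [lpNorm_eq_toReal (memLp_havg hu).1, lpNorm_eq_toReal hu.1]
  exact ENNReal.toReal_mono hu.2.ne (eLpNorm_havg_le hu.1)

namespace IsLerayHopf

lemma ae_mem (T : ℝ) : ∀ᵐ τ ∂(volume.restrict (Ioo 0 T)), τ ∈ Icc 0 T := by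
  filter_upwards [ae_restrict_mem measurableSet_Ioo] with τ hτ
  exact Ioo_subset_Icc_self hτ

lemma integrable_gradSq (hv : IsLerayHopf ν T v₀ v Dv) :
    Integrable (gradSq Dv) (volume.restrict (Ioo 0 T)) := by
  refine integrable_finsetSum _ fun j _ => ?_
  exact ((hv.grad_memLp j).integrable_norm_pow (by norm_num)).integral_prod_left

/-- The horizontal average of the convective term is in `L²` for almost every time, with a norm that
is integrable in time. -/
lemma exists_bound_havg_convTerm (hν : 0 < ν) (hv : IsLerayHopf ν T v₀ v Dv) {C : ℝ≥0}
    (hκ : κ ≤ (C : ℝ≥0∞) • volume) : ∃ B : ℝ, 1 ≤ B ∧ ∀ᵐ τ ∂(volume.restrict (Ioo 0 T)),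
      MemLp (havg κ (convTerm v Dv τ)) 2 muOmega ∧
      lpNorm (havg κ (convTerm v Dv τ)) 2 muOmega ≤ B * (1 + gradSq Dv τ) := by
  set M := lpNorm v₀ 2 muOmega
  have hM : 0 ≤ M := lpNorm_nonneg
  refine ⟨1 + 6 * C * M, le_add_of_nonneg_right (by positivity), ?_⟩
  filter_upwards [hv.memV, ae_mem T] with τ hV hτ
  have hu := hv.memLp_slice hτ
  have hD := hV.grad_memLp
  have hconv : AEStronglyMeasurable (convTerm v Dv τ) muOmega :=
    aestronglyMeasurable_convect hu.1 fun j => (hD j).1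
  have hWm : AEMeasurable (fun x => ∑ j, ‖Dv j τ x‖ₑ) muOmega :=
    Finset.aemeasurable_fun_sum _ fun j _ => (hD j).1.enorm
  have hb := eLpNorm_havg_sq_le hκ hu.1 hWm (Eventually.of_forall (enorm_convect_le (v τ) _))
    (hV.lintegral_plane_le hu)
  have hn1 : 0 ≤ lpNorm (v τ) 2 muOmega := lpNorm_nonneg
  have hn2 : 0 ≤ lpNorm (Dv 2 τ) 2 muOmega := lpNorm_nonneg
  have hW2 : ∫⁻ x, (∑ j, ‖Dv j τ x‖ₑ) ^ 2 ∂muOmega ≤ ENNReal.ofReal (3 * gradSq Dv τ) := by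
    calc ∫⁻ x, (∑ j, ‖Dv j τ x‖ₑ) ^ 2 ∂muOmega
        ≤ ∫⁻ x, 3 * ∑ j, ‖Dv j τ x‖ₑ ^ 2 ∂muOmega := by
          refine lintegral_mono fun x => ?_
          have := sq_lintegral_le (μ := (Measure.count : Measure (Fin 3)))
            (f := fun j => ‖Dv j τ x‖ₑ) (measurable_of_finite _).aemeasurable
          simpa [lintegral_count, tsum_fintype] using this
      _ = 3 * ∑ j, ∫⁻ x, ‖Dv j τ x‖ₑ ^ 2 ∂muOmega := by
          rw [lintegral_const_mul'' _ (Finset.aemeasurable_fun_sum _ fun j _ =>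
            (hD j).1.enorm.pow_const 2), lintegral_finsetSum' _ fun j _ =>
            (hD j).1.enorm.pow_const 2]
      _ = ENNReal.ofReal (3 * gradSq Dv τ) := by
          rw [ENNReal.ofReal_mul (by norm_num), gradSq,
            ENNReal.ofReal_sum_of_nonneg fun _ _ => normSq_nonneg _]
          congr 1
          · simp
          · refine Finset.sum_congr rfl fun j _ => ?_
            rw [normSq_eq_lpNorm_sq (hD j).1, ← eLpNorm_two_sq, ENNReal.ofReal_pow lpNorm_nonneg,
              ofReal_lpNorm (hD j)]
  have hb2 : eLpNorm (havg κ (convTerm v Dv τ)) 2 muOmega ^ 2 ≤ ENNReal.ofReal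
      (C * (2 * (lpNorm (v τ) 2 muOmega * lpNorm (Dv 2 τ) 2 muOmega)) * (3 * gradSq Dv τ)) := by
    refine (hb.trans (mul_le_mul_right hW2 _)).trans_eq ?_
    have hg := gradSq_nonneg (Dv := Dv) τ
    rw [ENNReal.ofReal_mul (q := 3 * gradSq Dv τ) (by positivity),
      ENNReal.ofReal_mul (p := C) (by positivity),
      ENNReal.ofReal_mul (p := 2) (by positivity), ENNReal.ofReal_mul hn1, ofReal_lpNorm hu,
      ofReal_lpNorm (hD 2)]
    simp
  have hmem : MemLp (havg κ (convTerm v Dv τ)) 2 muOmega := by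
    refine ⟨aestronglyMeasurable_havg hconv, ?_⟩
    by_contra hcon
    rw [not_lt, top_le_iff] at hcon
    rw [hcon] at hb2
    simp at hb2
  refine ⟨hmem, ?_⟩
  have hg := gradSq_nonneg (Dv := Dv) τ
  have h1 : lpNorm (havg κ (convTerm v Dv τ)) 2 muOmega ^ 2 ≤
      C * (2 * (lpNorm (v τ) 2 muOmega * lpNorm (Dv 2 τ) 2 muOmega)) * (3 * gradSq Dv τ) := by
    rw [← ofReal_lpNorm hmem, ← ENNReal.ofReal_pow lpNorm_nonneg] at hb2
    exact (ENNReal.ofReal_le_ofReal_iff (by positivity)).mp hb2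
  have h2 : lpNorm (v τ) 2 muOmega * lpNorm (Dv 2 τ) 2 muOmega ≤ M * (1 + gradSq Dv τ) :=
    mul_le_mul (hv.lpNorm_le hν hτ) (lpNorm_le_one_add_gradSq hD 2) lpNorm_nonneg hM
  have h3 : C * (2 * (lpNorm (v τ) 2 muOmega * lpNorm (Dv 2 τ) 2 muOmega)) * (3 * gradSq Dv τ) ≤
      C * (2 * (M * (1 + gradSq Dv τ))) * (3 * (1 + gradSq Dv τ)) := by
    gcongr
    linarith
  refine (sq_le_sq₀ lpNorm_nonneg (by positivity)).mp (h1.trans (h3.trans ?_))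
  have h4 : 6 * C * M ≤ (1 + 6 * C * M) ^ 2 := by
    have : 0 ≤ 6 * C * M := by positivity
    nlinarith
  calc C * (2 * (M * (1 + gradSq Dv τ))) * (3 * (1 + gradSq Dv τ))
      = 6 * C * M * (1 + gradSq Dv τ) ^ 2 := by ring
    _ ≤ (1 + 6 * C * M) ^ 2 * (1 + gradSq Dv τ) ^ 2 := by gcongr
    _ = _ := by ring

/-- The equation, averaged horizontally and tested with an arbitrary field of `L² ∩ V`. -/
lemma averaged_identity (hν : 0 < ν) (hT : 0 < T) (hv : IsLerayHopf ν T v₀ v Dv) {C : ℝ≥0}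
    (hκ : κ ≤ (C : ℝ≥0∞) • volume) (hneg : MeasurePreserving (fun y : E2 => -y) κ κ)
    {χ : E3 → E3} {Dχ : Fin 3 → E3 → E3} (hχ : MemLp χ 2 muOmega) (hV : MemV χ Dχ)
    {t : ℝ} (ht : t ∈ Icc 0 T) :
    ∫ x, ⟪v t x, havg κ χ x⟫ ∂muOmega = ∫ x, ⟪v₀ x, havg κ χ x⟫ ∂muOmega
      - ((ν * ∑ j, ∫ τ in Ioo 0 t, ∫ x, ⟪havg κ (Dv j τ) x, Dχ j x⟫ ∂muOmega)
        + ∫ τ in Ioo 0 t, ∫ x, ⟪havg κ (convTerm v Dv τ) x, χ x⟫ ∂muOmega) := by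
  set ρ : Measure ℝ := volume.restrict (Ioo 0 t) with hρ
  have hle : ρ ≤ volume.restrict (Ioo 0 T) :=
    Measure.restrict_mono (Ioo_subset_Ioo_right ht.2) le_rfl
  have hles : ρ.prod muOmega ≤ spaceTime T := spaceTime_mono ht.2
  have hvt := hv.memLp_slice ht
  have hv0 := hv.initial_memH.1
  have hDv : ∀ j, MemLp (fun p : ℝ × E3 => Dv j p.1 p.2) 2 (ρ.prod muOmega) := fun j =>
    (hv.grad_memLp j).mono_measure hles
  have hcv : Integrable (fun p : ℝ × E3 => convTerm v Dv p.1 p.2) (ρ.prod muOmega) :=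
    hv.integrable_convTerm.mono_measure hles
  -- the identity for test fields
  have htest : ∀ {φ : E3 → E3}, IsTestField φ →
      ∫ x, ⟪havg κ (v t) x, φ x⟫ ∂muOmega = ∫ x, ⟪havg κ v₀ x, φ x⟫ ∂muOmega
      - ((ν * ∑ j, ∫ τ, ∫ x, ⟪havg κ (Dv j τ) x, pd j φ x⟫ ∂muOmega ∂ρ)
        + ∫ τ, ∫ x, ⟪havg κ (convTerm v Dv τ) x, φ x⟫ ∂muOmega ∂ρ) := by
    intro φ hφ
    have hφ2 := hφ.memLp 2
    have hφa : ∀ᵐ x ∂muOmega, Integrable (fun y => φ (x + hz y)) κ :=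
      ae_integrable_add_hz_of_memLp_two hφ2
    have hpa : ∀ j, ∀ᵐ x ∂muOmega, Integrable (fun y => pd j φ (x + hz y)) κ := fun j =>
      ae_integrable_add_hz_of_memLp_two (hφ.memLp_pd j 2)
    obtain ⟨K, hK⟩ := hφ.compactSupport.exists_bound_of_continuous hφ.smooth.continuous
    have hy := fun y => hv.weak_identity hT (hφ.translate y) ht
    simp_rw [pd_add_hz, ← hρ] at hy
    obtain ⟨i1, e1, -⟩ := integral_integral_inner_translate hφa
      (integrable_inner_translate_of_bounded (κ := κ) hcv hφ.smooth.continuous hK)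
    have h2 := fun j => integral_integral_inner_translate (hpa j)
      (integrable_inner_translate_of_memLp (κ := κ) (hDv j) (hφ.memLp_pd j 2))
    have it := integrable_inner_translate_of_memLp_slice (κ := κ) hvt hφ2
    have i0 := integrable_inner_translate_of_memLp_slice (κ := κ) hv0 hφ2
    have hint := integral_congr_ae (μ := κ) (Eventually.of_forall hy)
    rw [integral_inner_havg_eq hφa it, integral_sub, integral_inner_havg_eq hφa i0, integral_add,
      integral_const_mul, integral_finsetSum, e1] at hint
    · simp_rw [fun j => (h2 j).2.1] at hint
      rw [integral_inner_havg_comm_of_memLp hneg hvt hφ2,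
          integral_inner_havg_comm_of_memLp hneg hv0 hφ2] at hint
      rw [hint]
      congr 2
      · congr 1
        refine Finset.sum_congr rfl fun j _ => integral_congr_ae ?_
        filter_upwards [ae_mono hle hv.memV] with τ hτ
        exact integral_inner_havg_comm_of_memLp hneg (hτ.grad_memLp j) (hφ.memLp_pd j 2)
      · refine integral_congr_ae ?_
        filter_upwards [hcv.prod_right_ae] with τ hτ
        refine integral_inner_havg_comm hneg (ae_integrable_add_hz_of_integrable hτ) hφa ?_
        refine Integrable.mono' ((hτ.comp_fst κ).norm.mul_const K)
          ((hτ.comp_fst κ).1.inner (hφ.smooth.continuous.comp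
            (by fun_prop : Continuous fun p : E3 × E2 => p.1 + hz p.2)).aestronglyMeasurable)
          (Eventually.of_forall fun p => ?_)
        refine (norm_inner_le_norm _ _).trans ?_
        gcongr
        exact hK _
    · exact fun j _ => (h2 j).1
    · exact (integrable_finsetSum _ fun j _ => (h2 j).1).const_mul ν
    · exact i1
    · exact i0.integral_prod_right
    · exact ((integrable_finsetSum _ fun j _ => (h2 j).1).const_mul ν).add i1
  -- passage to the limit along jointly approximating test fields
  obtain ⟨φ, hφ, h0, h1⟩ := hV.exists_seq_testField hχ
  obtain ⟨B, hB1, hB⟩ := hv.exists_bound_havg_convTerm hν hκ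
  have hbint : Integrable (fun τ => B * (1 + gradSq Dv τ)) ρ :=
    (((integrable_const 1).add (hv.integrable_gradSq)).const_mul B).mono_measure hle
  have l1 := tendsto_integral_inner (memLp_havg (κ := κ) hvt) hχ (fun n => (hφ n).memLp 2) h0
  have l2 := tendsto_integral_inner (memLp_havg (κ := κ) hv0) hχ (fun n => (hφ n).memLp 2) h0
  have l3 := fun j => tendsto_integral_integral_inner (ρ := ρ)
    (aestronglyMeasurable_havg_time (κ := κ) (hDv j).1) (b := fun τ => B * (1 + gradSq Dv τ))
    (by
      filter_upwards [ae_mono hle hv.memV] with τ hτ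
      refine ⟨memLp_havg (κ := κ) (hτ.grad_memLp j),
        (lpNorm_havg_le (κ := κ) (hτ.grad_memLp j)).trans ?_⟩
      have := lpNorm_le_one_add_gradSq hτ.grad_memLp j
      have := gradSq_nonneg (Dv := Dv) τ
      nlinarith) hbint (hV.grad_memLp j) (fun n => (hφ n).memLp_pd j 2) (h1 j)
  have l4 := tendsto_integral_integral_inner (ρ := ρ)
    (aestronglyMeasurable_havg_time (κ := κ) hcv.1) (ae_mono hle hB) hbint hχ
    (fun n => (hφ n).memLp 2) h0
  have lR := l2.sub (((tendsto_finsetSum Finset.univ fun j _ => l3 j).const_mul ν).add l4)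
  rw [integral_inner_havg_comm_of_memLp hneg hvt hχ, integral_inner_havg_comm_of_memLp hneg hv0 hχ]
  exact tendsto_nhds_unique l1 (lR.congr fun n => (htest (hφ n)).symm)

end IsLerayHopf

end LerayHopfAverage

/-! ### Restriction of a symmetric kernel to the diagonal -/

/-- Averages over `(-h, h)` tend to twice the value at a point of continuity. -/
lemma tendsto_integral_Ioc_div {Ψ : ℝ → ℝ} (hΨ : ContinuousAt Ψ 0)
    (hint : Integrable Ψ volume) {h : ℕ → ℝ} (hpos : ∀ n, 0 < h n)
    (hlim : Tendsto h atTop (𝓝 0)) :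
    Tendsto (fun n => (h n)⁻¹ * ∫ σ in (-h n)..(h n), Ψ σ) atTop (𝓝 (2 * Ψ 0)) := by
  have hd : HasDerivAt (fun u => ∫ σ in (0 : ℝ)..u, Ψ σ) (Ψ 0) 0 :=
    intervalIntegral.integral_hasDerivAt_right (by simp)
      ⟨univ, univ_mem, by simpa using hint.1⟩ hΨ
  have hs := hasDerivAt_iff_tendsto_slope.mp hd
  have h1 : Tendsto h atTop (𝓝[≠] 0) :=
    tendsto_nhdsWithin_iff.mpr ⟨hlim, Eventually.of_forall fun n => (hpos n).ne'⟩
  have h2 : Tendsto (fun n => -h n) atTop (𝓝[≠] 0) :=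
    tendsto_nhdsWithin_iff.mpr ⟨by simpa using hlim.neg,
      Eventually.of_forall fun n => (neg_lt_zero.mpr (hpos n)).ne⟩
  have h3 := (hs.comp h1).add (hs.comp h2)
  rw [← two_mul] at h3
  refine h3.congr fun n => ?_
  have e := intervalIntegral.integral_add_adjacent_intervals (μ := volume) (f := Ψ)
    (hint.intervalIntegrable (a := -h n) (b := 0)) (hint.intervalIntegrable (a := 0) (b := h n))
  rw [← e, intervalIntegral.integral_symm 0 (-h n)]
  simp only [Function.comp_apply, slope_def_field, intervalIntegral.integral_same, sub_zero]
  have := (hpos n).ne'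
  field_simp
  ring

lemma tendsto_integral_right_div {f : ℝ → ℝ} {b : ℝ} (hb : 0 < b) (hf : ContinuousOn f (Icc 0 b))
    {h : ℕ → ℝ} (hpos : ∀ n, 0 < h n) (hlim : Tendsto h atTop (𝓝 0)) :
    Tendsto (fun n => (h n)⁻¹ * ∫ s in (0 : ℝ)..(h n), f s) atTop (𝓝 (f 0)) := by
  have hd : HasDerivWithinAt (fun u => ∫ s in (0 : ℝ)..u, f s) (f 0) (Ici 0) 0 := by
    refine intervalIntegral.integral_hasDerivWithinAt_right (t := Ioi 0) (by simp) ?_ ?_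
    · refine ⟨Icc 0 b, ?_, hf.aestronglyMeasurable measurableSet_Icc⟩
      exact mem_of_superset (Ioo_mem_nhdsGT hb) Ioo_subset_Icc_self
    · exact (hf.continuousWithinAt (left_mem_Icc.mpr hb.le)).mono_of_mem_nhdsWithin
        (mem_of_superset (Ioo_mem_nhdsGT hb) Ioo_subset_Icc_self)
  have hs := hasDerivWithinAt_iff_tendsto_slope.mp hd
  have h1 : Tendsto h atTop (𝓝[Ici 0 \ {0}] 0) :=
    tendsto_nhdsWithin_iff.mpr ⟨hlim, Eventually.of_forall fun n => ⟨(hpos n).le, (hpos n).ne'⟩⟩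
  refine (hs.comp h1).congr fun n => ?_
  simp [slope_def_field, div_eq_inv_mul]

lemma tendsto_integral_left_div {f : ℝ → ℝ} {b : ℝ} (hb : 0 < b) (hf : ContinuousOn f (Icc 0 b))
    {h : ℕ → ℝ} (hpos : ∀ n, 0 < h n) (hlim : Tendsto h atTop (𝓝 0)) :
    Tendsto (fun n => (h n)⁻¹ * ∫ s in (b - h n)..b, f s) atTop (𝓝 (f b)) := by
  have hf2 : ContinuousOn (fun s => f (b - s)) (Icc 0 b) :=
    hf.comp (by fun_prop) fun s hs => ⟨by linarith [hs.2], by linarith [hs.1]⟩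
  have := tendsto_integral_right_div hb hf2 hpos hlim
  simp only [sub_zero] at this
  refine this.congr fun n => ?_
  rw [intervalIntegral.integral_comp_sub_left (fun s => f s) b]
  simp

section Diagonal

variable {a G : ℝ → ℝ → ℝ} {t₀ : ℝ}

lemma integrable_integral_lt (hG : Integrable (fun p : ℝ × ℝ => G p.1 p.2) (volume.prod volume))
    {α : ℝ → ℝ} (hα : Measurable α) :
    Integrable (fun s => ∫ τ, {τ | τ < α s}.indicator (fun τ => G τ s) τ) := by
  have hm : MeasurableSet {p : ℝ × ℝ | p.1 < α p.2} :=
    measurableSet_lt measurable_fst (hα.comp measurable_snd)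
  exact (hG.indicator hm).integral_prod_right

/-- The values of a symmetric kernel `a` with `∂ₜ a(t, s) = -G(t, s)` at the ends of the interval
are compared by integrating `G` over the strip `|t - s| < h`; the contributions of the two
boundary curves `t = s ± h` of the strip cancel by symmetry. -/
lemma strip_identity (hsymm : ∀ t ∈ Icc 0 t₀, ∀ s ∈ Icc 0 t₀, a t s = a s t)
    (hcont : ∀ s ∈ Icc 0 t₀, ContinuousOn (fun t => a t s) (Icc 0 t₀))
    (hsupp : ∀ τ s, τ ∉ Ioo 0 t₀ → G τ s = 0) (hsupp2 : ∀ τ s, s ∉ Ioo 0 t₀ → G τ s = 0)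
    (hG : Integrable (fun p : ℝ × ℝ => G p.1 p.2) (volume.prod volume))
    (hid : ∀ᵐ s, s ∈ Ioo 0 t₀ → ∀ t ∈ Icc 0 t₀, a t s = a 0 s - ∫ τ in Ioo 0 t, G τ s)
    {h : ℝ} (hpos : 0 < h) (hlt : h < t₀) :
    (∫ s in (0 : ℝ)..h, a 0 s) - (∫ s in (t₀ - h)..t₀, a t₀ s) =
      ∫ s, ∫ τ, {τ | s - τ ∈ Ioc (-h) h}.indicator (fun τ => G τ s) τ := by
  have ht₀ : 0 < t₀ := hpos.trans hlt
  have h0mem : (0 : ℝ) ∈ Icc 0 t₀ := left_mem_Icc.mpr ht₀.le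
  have h1mem : t₀ ∈ Icc 0 t₀ := right_mem_Icc.mpr ht₀.le
  set α : ℝ → ℝ := fun s => max 0 (s - h) with hα
  set β : ℝ → ℝ := fun s => min t₀ (s + h) with hβ
  have hαm : Measurable α := by fun_prop
  have hβm : Measurable β := by fun_prop
  have hαI : ∀ s ∈ Ioo 0 t₀, α s ∈ Icc 0 t₀ := fun s hs =>
    ⟨le_max_left _ _, max_le ht₀.le (by linarith [hs.2])⟩
  have hβI : ∀ s ∈ Ioo 0 t₀, β s ∈ Icc 0 t₀ := fun s hs =>
    ⟨le_min ht₀.le (by linarith [hs.1]), min_le_left _ _⟩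
  -- the equation, with the integral extended to the whole line
  have hid2 : ∀ᵐ s, s ∈ Ioo 0 t₀ → ∀ t ∈ Icc 0 t₀,
      a t s = a 0 s - ∫ τ, {τ | τ < t}.indicator (fun τ => G τ s) τ := by
    filter_upwards [hid] with s hs hsI t ht
    rw [hs hsI t ht, ← integral_indicator measurableSet_Ioo]
    congr 2
    funext τ
    by_cases h1 : 0 < τ
    · simp [Set.indicator, h1]
    · have : G τ s = 0 := hsupp τ s fun hm => h1 hm.1
      simp [Set.indicator, this]
  have hc0 : ContinuousOn (fun s => a 0 s) (Icc 0 t₀) :=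
    (hcont 0 h0mem).congr fun s hs => hsymm 0 h0mem s hs
  have hc1 : ContinuousOn (fun s => a t₀ s) (Icc 0 t₀) :=
    (hcont t₀ h1mem).congr fun s hs => hsymm t₀ h1mem s hs
  have hi0 : IntegrableOn (fun s => a 0 s) (Ioo 0 t₀) :=
    (hc0.integrableOn_compact isCompact_Icc).mono_set Ioo_subset_Icc_self
  have hint : ∀ {γ : ℝ → ℝ}, Measurable γ → (∀ s ∈ Ioo 0 t₀, γ s ∈ Icc 0 t₀) →
      IntegrableOn (fun s => a (γ s) s) (Ioo 0 t₀) := by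
    intro γ hγ hγI
    refine (hi0.sub (integrable_integral_lt hG hγ).integrableOn).congr ?_
    rw [Filter.EventuallyEq, ae_restrict_iff' measurableSet_Ioo]
    filter_upwards [hid2] with s hs hsI
    exact (hs hsI _ (hγI s hsI)).symm
  have hiα := hint hαm hαI
  have hiβ := hint hβm hβI
  -- up to end points, the section of the strip at `s` is the interval from `α s` to `β s`
  have hpt : ∀ᵐ s, s ∈ Ioo 0 t₀ → a (α s) s - a (β s) s =
      ∫ τ, {τ | s - τ ∈ Ioc (-h) h}.indicator (fun τ => G τ s) τ := by
    filter_upwards [hid2, hG.prod_left_ae] with s hs hGs hsI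
    have hi : ∀ t, Integrable ({τ | τ < t}.indicator fun τ => G τ s) := fun t =>
      hGs.indicator measurableSet_Iio
    rw [hs hsI _ (hαI s hsI), hs hsI _ (hβI s hsI), sub_sub_sub_cancel_left,
      ← integral_sub (hi _) (hi _)]
    congr 1
    funext τ
    by_cases hτ : τ ∈ Ioo 0 t₀
    · have e1 : τ < β s ↔ τ < s + h := by simp [hβ, hτ.2]
      have e2 : τ < α s ↔ τ < s - h := by simp [hα, not_lt.mpr hτ.1.le]
      simp only [Set.indicator, mem_ofPred_eq, e1, e2, mem_Ioc]
      by_cases c1 : τ < s + h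
      · by_cases c2 : τ < s - h
        · have : ¬ (s - τ ≤ h) := by linarith
          simp [c1, c2, this]
        · have h1 : s - τ ≤ h := by linarith
          have h2 : -h < s - τ := by linarith
          simp [c1, c2, h1, h2]
      · have c2 : ¬ τ < s - h := by linarith
        have h2 : ¬ (-h < s - τ) := by linarith
        simp [c1, c2, h2]
    · have : G τ s = 0 := hsupp τ s hτ
      simp [Set.indicator, this]
  have hRHS : ∫ s, ∫ τ, {τ | s - τ ∈ Ioc (-h) h}.indicator (fun τ => G τ s) τ =
      ∫ s in Ioo 0 t₀, (a (α s) s - a (β s) s) := by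
    rw [← integral_indicator measurableSet_Ioo]
    refine integral_congr_ae ?_
    filter_upwards [hpt] with s hs
    by_cases hsI : s ∈ Ioo 0 t₀
    · rw [indicator_of_mem hsI, hs hsI]
    · rw [indicator_of_notMem hsI]
      have : ∀ τ, {τ | s - τ ∈ Ioc (-h) h}.indicator (fun τ => G τ s) τ = 0 := fun τ => by
        simp only [Set.indicator, hsupp2 τ s hsI, ite_self]
      simp only [this, integral_zero]
  rw [hRHS, integral_sub hiα hiβ, ← intervalIntegral_eq_Ioo ht₀.le (fun s => a (α s) s),
    ← intervalIntegral_eq_Ioo ht₀.le (fun s => a (β s) s)]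
  have jα : IntervalIntegrable (fun s => a (α s) s) volume 0 t₀ :=
    (intervalIntegrable_iff_integrableOn_Ioo_of_le ht₀.le).mpr hiα
  have jβ : IntervalIntegrable (fun s => a (β s) s) volume 0 t₀ :=
    (intervalIntegrable_iff_integrableOn_Ioo_of_le ht₀.le).mpr hiβ
  have hhI : h ∈ uIcc 0 t₀ := by rw [uIcc_of_le ht₀.le]; exact ⟨hpos.le, hlt.le⟩
  have hhI2 : t₀ - h ∈ uIcc 0 t₀ := by
    rw [uIcc_of_le ht₀.le]; exact ⟨by linarith, by linarith⟩
  rw [← intervalIntegral.integral_add_adjacent_intervals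
      (jα.mono_set (uIcc_subset_uIcc left_mem_uIcc hhI))
      (jα.mono_set (uIcc_subset_uIcc hhI right_mem_uIcc)),
    ← intervalIntegral.integral_add_adjacent_intervals
      (jβ.mono_set (uIcc_subset_uIcc left_mem_uIcc hhI2))
      (jβ.mono_set (uIcc_subset_uIcc hhI2 right_mem_uIcc))]
  have e1 : ∫ s in (0 : ℝ)..h, a (α s) s = ∫ s in (0 : ℝ)..h, a 0 s := by
    refine intervalIntegral.integral_congr fun s hs => ?_
    rw [uIcc_of_le hpos.le] at hs
    have : α s = 0 := max_eq_left (by linarith [hs.2])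
    simp only [this]
  have e2 : ∫ s in (t₀ - h)..t₀, a (β s) s = ∫ s in (t₀ - h)..t₀, a t₀ s := by
    refine intervalIntegral.integral_congr fun s hs => ?_
    rw [uIcc_of_le (by linarith)] at hs
    have : β s = t₀ := min_eq_left (by linarith [hs.1])
    simp only [this]
  -- the two sides of the strip are exchanged by the symmetry of the kernel
  have e3 : ∫ s in h..t₀, a (α s) s = ∫ s in (0 : ℝ)..(t₀ - h), a (β s) s := by
    have e4 := intervalIntegral.integral_comp_add_right (a := 0) (b := t₀ - h)
      (fun s => a (α s) s) h
    rw [zero_add, sub_add_cancel] at e4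
    rw [← e4]
    refine intervalIntegral.integral_congr fun s hs => ?_
    rw [uIcc_of_le (by linarith)] at hs
    have h1 : α (s + h) = s := by simp [hα, hs.1]
    have h2 : β s = s + h := min_eq_right (by linarith [hs.2])
    simp only [h1, h2]
    exact hsymm s ⟨hs.1, by linarith [hs.2]⟩ (s + h) ⟨by linarith [hs.1], by linarith [hs.2]⟩
  rw [e1, e2, e3]
  ring

lemma integral_strip_eq (hG : Integrable (fun p : ℝ × ℝ => G p.1 p.2) (volume.prod volume))
    {h : ℝ} (hpos : 0 < h) :
    Integrable (fun σ => ∫ τ, G τ (τ + σ)) ∧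
    ∫ s, ∫ τ, {τ | s - τ ∈ Ioc (-h) h}.indicator (fun τ => G τ s) τ =
      ∫ σ in (-h)..h, ∫ τ, G τ (τ + σ) := by
  have hmp : MeasurePreserving (fun z : ℝ × ℝ => (z.1, z.1 + z.2)) (volume.prod volume)
      (volume.prod volume) := measurePreserving_prod_add volume volume
  have hG2 : Integrable (fun p : ℝ × ℝ => G p.1 (p.1 + p.2)) (volume.prod volume) :=
    hmp.integrable_comp_of_integrable hG
  have hms : MeasurableSet {p : ℝ × ℝ | p.2 - p.1 ∈ Ioc (-h) h} :=
    (measurable_snd.sub measurable_fst) measurableSet_Ioc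
  have hGi := hG.indicator hms
  have hGi2 : Integrable (fun z : ℝ × ℝ => {p : ℝ × ℝ | p.2 - p.1 ∈ Ioc (-h) h}.indicator
      (fun p => G p.1 p.2) (z.1, z.1 + z.2)) (volume.prod volume) :=
    hmp.integrable_comp_of_integrable hGi
  refine ⟨hG2.integral_prod_right, ?_⟩
  have e1 : ∫ s, ∫ τ, {τ | s - τ ∈ Ioc (-h) h}.indicator (fun τ => G τ s) τ =
      ∫ p, {p : ℝ × ℝ | p.2 - p.1 ∈ Ioc (-h) h}.indicator (fun p => G p.1 p.2) p
        ∂(volume.prod volume) := (integral_prod_symm _ hGi).symm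
  have e2 := integral_map (μ := (volume : Measure ℝ).prod (volume : Measure ℝ))
    (φ := fun z : ℝ × ℝ => (z.1, z.1 + z.2))
    (f := {p : ℝ × ℝ | p.2 - p.1 ∈ Ioc (-h) h}.indicator (fun p => G p.1 p.2))
    hmp.measurable.aemeasurable (by rw [hmp.map_eq]; exact hGi.1)
  rw [hmp.map_eq] at e2
  rw [e1, e2, integral_prod_symm _ hGi2, intervalIntegral.integral_of_le (by linarith),
    ← integral_indicator measurableSet_Ioc]
  refine integral_congr_ae (Eventually.of_forall fun σ => ?_)
  by_cases hσ : σ ∈ Ioc (-h) h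
  · simp only [Set.indicator, mem_ofPred_eq, add_sub_cancel_left, hσ, if_true]
  · simp only [Set.indicator, mem_ofPred_eq, add_sub_cancel_left, hσ, if_false, integral_zero]

/-- If a symmetric kernel satisfies `∂ₜ a(t, s) = -G(t, s)`, and the integrals of `G` over the lines
parallel to the diagonal are continuous at the diagonal, then `d/dt a(t, t) = -2 G(t, t)` in
integrated form. -/
theorem diagonal_identity (ht₀ : 0 < t₀) (hsymm : ∀ t ∈ Icc 0 t₀, ∀ s ∈ Icc 0 t₀, a t s = a s t)
    (hcont : ∀ s ∈ Icc 0 t₀, ContinuousOn (fun t => a t s) (Icc 0 t₀))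
    (hsupp : ∀ τ s, τ ∉ Ioo 0 t₀ → G τ s = 0) (hsupp2 : ∀ τ s, s ∉ Ioo 0 t₀ → G τ s = 0)
    (hG : Integrable (fun p : ℝ × ℝ => G p.1 p.2) (volume.prod volume))
    (hid : ∀ᵐ s, s ∈ Ioo 0 t₀ → ∀ t ∈ Icc 0 t₀, a t s = a 0 s - ∫ τ in Ioo 0 t, G τ s)
    (hΨ : ContinuousAt (fun σ => ∫ τ, G τ (τ + σ)) 0) :
    a 0 0 - a t₀ t₀ = 2 * ∫ τ, G τ τ := by
  set h : ℕ → ℝ := fun n => t₀ / (n + 2) with hh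
  have hpos : ∀ n, 0 < h n := fun n => by positivity
  have hlt : ∀ n, h n < t₀ := fun n => by
    have : (0 : ℝ) ≤ n := Nat.cast_nonneg n
    rw [hh, div_lt_iff₀ (by positivity)]
    nlinarith
  have hlim : Tendsto h atTop (𝓝 0) := by
    refine tendsto_const_nhds.div_atTop ?_
    exact tendsto_atTop_add_const_right _ _ tendsto_natCast_atTop_atTop
  have h0mem : (0 : ℝ) ∈ Icc 0 t₀ := left_mem_Icc.mpr ht₀.le
  have h1mem : t₀ ∈ Icc 0 t₀ := right_mem_Icc.mpr ht₀.le
  have hc0 : ContinuousOn (fun s => a 0 s) (Icc 0 t₀) :=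
    (hcont 0 h0mem).congr fun s hs => hsymm 0 h0mem s hs
  have hc1 : ContinuousOn (fun s => a t₀ s) (Icc 0 t₀) :=
    (hcont t₀ h1mem).congr fun s hs => hsymm t₀ h1mem s hs
  have l1 := (tendsto_integral_right_div ht₀ hc0 hpos hlim).sub
    (tendsto_integral_left_div ht₀ hc1 hpos hlim)
  have l2 := tendsto_integral_Ioc_div hΨ (integral_strip_eq hG (hpos 0)).1 hpos hlim
  simp only [add_zero] at l2
  refine tendsto_nhds_unique l1 (l2.congr fun n => ?_)
  rw [← (integral_strip_eq hG (hpos n)).2,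
    ← strip_identity hsymm hcont hsupp hsupp2 hG hid (hpos n) (hlt n)]
  ring

end Diagonal

/-! ### Pairings of fields at two times -/

section TwoTimes

variable {A W : ℝ → E3 → E3} {α β : ℝ → ℝ}

instance : Measure.InnerRegularCompactLTTop ((volume : Measure ℝ).prod muOmega) := by
  have h : (volume : Measure ℝ).prod muOmega = (volume : Measure (ℝ × E3)).restrict
      (univ ×ˢ Omega) := by
    rw [Measure.volume_eq_prod, ← Measure.prod_restrict, Measure.restrict_univ, muOmega]
  rw [h]
  infer_instance

lemma integrable_integral_inner_two_times
    (hAm : AEStronglyMeasurable (fun p : ℝ × E3 => A p.1 p.2) (volume.prod muOmega))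
    (hWm : AEStronglyMeasurable (fun p : ℝ × E3 => W p.1 p.2) (volume.prod muOmega))
    (hA : ∀ᵐ τ, MemLp (A τ) 2 muOmega ∧ lpNorm (A τ) 2 muOmega ≤ α τ)
    (hW : ∀ᵐ s, MemLp (W s) 2 muOmega ∧ lpNorm (W s) 2 muOmega ≤ β s)
    (hα : Integrable α) (hβ : Integrable β) :
    Integrable (fun p : ℝ × ℝ => ∫ x, ⟪A p.1 x, W p.2 x⟫ ∂muOmega) (volume.prod volume) := by
  have q2 : Measure.QuasiMeasurePreserving (fun p : (ℝ × ℝ) × E3 => (p.1.2, p.2))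
      (((volume : Measure ℝ).prod (volume : Measure ℝ)).prod muOmega) (volume.prod muOmega) :=
    Measure.quasiMeasurePreserving_snd.comp
      (measurePreserving_prodAssoc volume volume muOmega).quasiMeasurePreserving
  have q1 : Measure.QuasiMeasurePreserving (fun p : (ℝ × ℝ) × E3 => (p.1.1, p.2))
      (((volume : Measure ℝ).prod (volume : Measure ℝ)).prod muOmega) (volume.prod muOmega) :=
    q2.comp (Measure.measurePreserving_swap.prod
      (MeasurePreserving.id muOmega)).quasiMeasurePreserving
  refine Integrable.mono' (hα.mul_prod hβ) ?_ ?_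
  · exact AEStronglyMeasurable.integral_prod_right'
      (f := fun p : (ℝ × ℝ) × E3 => ⟪A p.1.1 p.2, W p.1.2 p.2⟫)
      ((hAm.comp_quasiMeasurePreserving q1).inner (hWm.comp_quasiMeasurePreserving q2))
  · filter_upwards [Measure.quasiMeasurePreserving_fst.ae hA,
      Measure.quasiMeasurePreserving_snd.ae hW] with p h1 h2
    refine (abs_integral_inner_le h1.1 h2.1).trans ?_
    exact mul_le_mul h1.2 h2.2 lpNorm_nonneg (lpNorm_nonneg.trans h1.2)

/-- Translations in time are continuous in `L²` of space-time. -/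
lemma integral_inner_time_shift
    (hA : MemLp (fun p : ℝ × E3 => A p.1 p.2) 2 (volume.prod muOmega))
    (hW : MemLp (fun p : ℝ × E3 => W p.1 p.2) 2 (volume.prod muOmega)) :
    (∀ σ : ℝ, Integrable fun τ => ∫ x, ⟪A τ x, W (τ + σ) x⟫ ∂muOmega) ∧
    Continuous fun σ : ℝ => ∫ τ, ∫ x, ⟪A τ x, W (τ + σ) x⟫ ∂muOmega := by
  let g : ℝ → C(ℝ × E3, ℝ × E3) := fun σ => ⟨fun p => (p.1 + σ, p.2), by fun_prop⟩
  have hg : Continuous g := by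
    refine ContinuousMap.continuous_of_continuous_uncurry _ ?_
    change Continuous fun q : ℝ × (ℝ × E3) => (q.2.1 + q.1, q.2.2)
    fun_prop
  have hgm : ∀ σ, MeasurePreserving (g σ) ((volume : Measure ℝ).prod muOmega)
      (volume.prod muOmega) := fun σ =>
    (measurePreserving_add_right volume σ).prod (MeasurePreserving.id muOmega)
  have hint := fun σ => integrable_inner_of_memLp hA (hW.comp_measurePreserving (hgm σ))
  exact ⟨fun σ => (hint σ).integral_prod_left,
    (continuous_integral_inner_comp hg hgm hA hW).congr fun σ => integral_prod _ (hint σ)⟩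

/-- The same for a field that is bounded and weakly continuous in time, paired with a field that is
only integrable in time. -/
lemma integral_inner_time_shift_of_weaklyContinuous {I : Set ℝ} {M : ℝ}
    (hAm : AEStronglyMeasurable (fun p : ℝ × E3 => A p.1 p.2) (volume.prod muOmega))
    (hWm : AEStronglyMeasurable (fun p : ℝ × E3 => W p.1 p.2) (volume.prod muOmega))
    (hA : ∀ᵐ τ, MemLp (A τ) 2 muOmega ∧ lpNorm (A τ) 2 muOmega ≤ α τ) (hα : Integrable α)
    (hAI : ∀ τ ∉ I, A τ = 0)
    (hW : ∀ s, MemLp (W s) 2 muOmega ∧ lpNorm (W s) 2 muOmega ≤ M)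
    (hWc : ∀ ψ, MemLp ψ 2 muOmega → ∀ τ ∈ I,
      ContinuousAt (fun s => ∫ x, ⟪W s x, ψ x⟫ ∂muOmega) τ) :
    (∀ σ : ℝ, Integrable fun τ => ∫ x, ⟪A τ x, W (τ + σ) x⟫ ∂muOmega) ∧
    ContinuousAt (fun σ : ℝ => ∫ τ, ∫ x, ⟪A τ x, W (τ + σ) x⟫ ∂muOmega) 0 := by
  have hm : ∀ σ : ℝ, AEStronglyMeasurable fun τ => ∫ x, ⟪A τ x, W (τ + σ) x⟫ ∂muOmega := by
    intro σ
    have q : Measure.QuasiMeasurePreserving (fun p : ℝ × E3 => (p.1 + σ, p.2))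
        ((volume : Measure ℝ).prod muOmega) (volume.prod muOmega) :=
      ((measurePreserving_add_right volume σ).prod
        (MeasurePreserving.id muOmega)).quasiMeasurePreserving
    exact AEStronglyMeasurable.integral_prod_right'
      (f := fun p : ℝ × E3 => ⟪A p.1 p.2, W (p.1 + σ) p.2⟫)
      (hAm.inner (hWm.comp_quasiMeasurePreserving q))
  have hb : ∀ σ : ℝ, ∀ᵐ τ, ‖∫ x, ⟪A τ x, W (τ + σ) x⟫ ∂muOmega‖ ≤ α τ * M := by
    intro σ
    filter_upwards [hA] with τ hτ
    refine (abs_integral_inner_le hτ.1 (hW _).1).trans ?_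
    exact mul_le_mul hτ.2 (hW _).2 lpNorm_nonneg (lpNorm_nonneg.trans hτ.2)
  refine ⟨fun σ => Integrable.mono' (hα.mul_const M) (hm σ) (hb σ), ?_⟩
  refine tendsto_integral_filter_of_dominated_convergence (fun τ => α τ * M)
    (Eventually.of_forall hm) (Eventually.of_forall hb) (hα.mul_const M) ?_
  filter_upwards [hA] with τ hτ
  by_cases hI : τ ∈ I
  · have h1 : ContinuousAt (fun σ : ℝ => τ + σ) 0 := by fun_prop
    have h2 : ContinuousAt (fun s => ∫ x, ⟪W s x, A τ x⟫ ∂muOmega) (τ + 0) := by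
      rw [add_zero]; exact hWc _ hτ.1 τ hI
    have h3 := ContinuousAt.comp_of_eq (f := fun σ : ℝ => τ + σ) h2 h1 rfl
    simp_rw [real_inner_comm (A τ _)] at h3
    exact h3
  · simp [hAI τ hI]

lemma indicator_prod_univ_eq (I : Set ℝ) (A : ℝ → E3 → E3) :
    (fun p : ℝ × E3 => I.indicator A p.1 p.2) =
      (I ×ˢ univ).indicator (fun p : ℝ × E3 => A p.1 p.2) := by
  funext p
  by_cases h : p.1 ∈ I <;> simp [Set.indicator, h]

lemma restrict_prod_univ (I : Set ℝ) : ((volume : Measure ℝ).prod muOmega).restrict (I ×ˢ univ) =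
    (volume.restrict I).prod muOmega := by
  rw [← Measure.prod_restrict, Measure.restrict_univ]

lemma aestronglyMeasurable_indicator_time {I : Set ℝ} (hI : MeasurableSet I)
    (hA : AEStronglyMeasurable (fun p : ℝ × E3 => A p.1 p.2) ((volume.restrict I).prod muOmega)) :
    AEStronglyMeasurable (fun p : ℝ × E3 => I.indicator A p.1 p.2) (volume.prod muOmega) := by
  rw [indicator_prod_univ_eq, aestronglyMeasurable_indicator_iff (hI.prod MeasurableSet.univ),
    restrict_prod_univ]
  exact hA

lemma memLp_indicator_time {I : Set ℝ} (hI : MeasurableSet I)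
    (hA : MemLp (fun p : ℝ × E3 => A p.1 p.2) 2 ((volume.restrict I).prod muOmega)) :
    MemLp (fun p : ℝ × E3 => I.indicator A p.1 p.2) 2 (volume.prod muOmega) := by
  rw [indicator_prod_univ_eq, memLp_indicator_iff_restrict (hI.prod MeasurableSet.univ),
    restrict_prod_univ]
  exact hA

lemma ae_bound_indicator_time {I : Set ℝ} (hI : MeasurableSet I)
    (h : ∀ᵐ τ ∂(volume.restrict I), MemLp (A τ) 2 muOmega ∧ lpNorm (A τ) 2 muOmega ≤ α τ) :
    ∀ᵐ τ, MemLp (I.indicator A τ) 2 muOmega ∧ lpNorm (I.indicator A τ) 2 muOmega ≤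
      I.indicator α τ := by
  rw [ae_restrict_iff' hI] at h
  filter_upwards [h] with τ hτ
  by_cases hm : τ ∈ I
  · simpa [hm] using hτ hm
  · simp [hm]

end TwoTimes

/-! ### The averaged energy balance -/

section Balance

variable {ν T : ℝ} {v₀ : E3 → E3} {v : ℝ → E3 → E3} {Dv : Fin 3 → ℝ → E3 → E3}
  {κ : Measure E2} [IsProbabilityMeasure κ]

/-- The balance for the quadratic form `(v, P v)`, where `P` is a horizontal average: formally the
equation is tested with `P v`. As `P v` has no time regularity, the equation at time `t` is tested
with `P v(s)` for each fixed `s`, and the two-time identity is restricted to the diagonal. -/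
theorem IsLerayHopf.averaged_energy_balance (hν : 0 < ν) (hT : 0 < T)
    (hv : IsLerayHopf ν T v₀ v Dv) {C : ℝ≥0} (hκ : κ ≤ (C : ℝ≥0∞) • volume)
    (hneg : MeasurePreserving (fun y : E2 => -y) κ κ) {t₀ : ℝ} (ht₀ : t₀ ∈ Ioc 0 T) :
    ∫ x, ⟪v 0 x, havg κ (v 0) x⟫ ∂muOmega - ∫ x, ⟪v t₀ x, havg κ (v t₀) x⟫ ∂muOmega =
      2 * ∫ τ in Ioo 0 t₀, (ν * ∑ j, ∫ x, ⟪havg κ (Dv j τ) x, Dv j τ x⟫ ∂muOmega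
        + ∫ x, ⟪havg κ (convTerm v Dv τ) x, v τ x⟫ ∂muOmega) := by
  set I : Set ℝ := Ioo 0 t₀ with hI
  have hIm : MeasurableSet I := measurableSet_Ioo
  set ρ : Measure ℝ := volume.restrict I with hρ
  have hle : ρ ≤ volume.restrict (Ioo 0 T) :=
    Measure.restrict_mono (Ioo_subset_Ioo_right ht₀.2) le_rfl
  have hles : ρ.prod muOmega ≤ spaceTime T := spaceTime_mono ht₀.2
  have hIcc : ∀ {t}, t ∈ Icc 0 t₀ → t ∈ Icc 0 T := fun ht => ⟨ht.1, ht.2.trans ht₀.2⟩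
  have hIT : ∀ {t}, t ∈ I → t ∈ Icc 0 T := fun ht => hIcc (Ioo_subset_Icc_self ht)
  have h0T : (0 : ℝ) ∈ Icc 0 T := ⟨le_rfl, hT.le⟩
  obtain ⟨B, hB1, hB⟩ := hv.exists_bound_havg_convTerm hν hκ
  set M := lpNorm v₀ 2 muOmega
  -- the fields, extended by zero outside the time interval
  set P : Fin 3 → ℝ → E3 → E3 := fun j => I.indicator fun τ => havg κ (Dv j τ) with hP
  set D : Fin 3 → ℝ → E3 → E3 := fun j => I.indicator (Dv j) with hD
  set N : ℝ → E3 → E3 := I.indicator fun τ => havg κ (convTerm v Dv τ) with hN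
  set V : ℝ → E3 → E3 := I.indicator v with hVdef
  have hDv : ∀ j, MemLp (fun p : ℝ × E3 => Dv j p.1 p.2) 2 (ρ.prod muOmega) := fun j =>
    (hv.grad_memLp j).mono_measure hles
  have hPm : ∀ j, MemLp (fun p : ℝ × E3 => P j p.1 p.2) 2 (volume.prod muOmega) := fun j =>
    memLp_indicator_time hIm (memLp_havg_time (hDv j))
  have hDm : ∀ j, MemLp (fun p : ℝ × E3 => D j p.1 p.2) 2 (volume.prod muOmega) := fun j =>
    memLp_indicator_time hIm (hDv j)
  have hNm : AEStronglyMeasurable (fun p : ℝ × E3 => N p.1 p.2) (volume.prod muOmega) :=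
    aestronglyMeasurable_indicator_time hIm
      (aestronglyMeasurable_havg_time (hv.integrable_convTerm.1.mono_measure hles))
  have hVm : AEStronglyMeasurable (fun p : ℝ × E3 => V p.1 p.2) (volume.prod muOmega) :=
    aestronglyMeasurable_indicator_time hIm (hv.measurable.mono_measure hles)
  have hgi : Integrable (fun τ => B * (1 + gradSq Dv τ)) ρ :=
    (((integrable_const 1).add hv.integrable_gradSq).const_mul B).mono_measure hle
  have hαi : Integrable (I.indicator fun τ => B * (1 + gradSq Dv τ)) :=
    (integrable_indicator_iff hIm).mpr hgi
  have hMi : Integrable (I.indicator fun _ : ℝ => M) :=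
    (integrable_indicator_iff hIm).mpr (integrable_const M)
  have hDle : ∀ j, ∀ᵐ τ ∂ρ, MemLp (Dv j τ) 2 muOmega ∧
      lpNorm (Dv j τ) 2 muOmega ≤ B * (1 + gradSq Dv τ) := fun j => by
    filter_upwards [ae_mono hle hv.memV] with τ hτ
    refine ⟨hτ.grad_memLp j, ?_⟩
    have := lpNorm_le_one_add_gradSq hτ.grad_memLp j
    have := gradSq_nonneg (Dv := Dv) τ
    nlinarith
  have hDb := fun j => ae_bound_indicator_time hIm (hDle j)
  have hPb := fun j => ae_bound_indicator_time (A := fun τ => havg κ (Dv j τ)) hIm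
    ((hDle j).mono fun τ hτ => ⟨memLp_havg hτ.1, (lpNorm_havg_le hτ.1).trans hτ.2⟩)
  have hNb := ae_bound_indicator_time (A := fun τ => havg κ (convTerm v Dv τ)) hIm (ae_mono hle hB)
  have hVb : ∀ s, MemLp (V s) 2 muOmega ∧ lpNorm (V s) 2 muOmega ≤ I.indicator (fun _ => M) s := by
    intro s
    by_cases hs : s ∈ I
    · simp only [hVdef, indicator_of_mem hs]
      exact ⟨hv.memLp_slice (hIT hs), hv.lpNorm_le hν (hIT hs)⟩
    · simp [hVdef, hs]
  have hVM : ∀ s, MemLp (V s) 2 muOmega ∧ lpNorm (V s) 2 muOmega ≤ M := fun s =>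
    ⟨(hVb s).1, (hVb s).2.trans (indicator_le_self' (fun _ _ => lpNorm_nonneg) s)⟩
  have i1 := fun j => integrable_integral_inner_two_times (hPm j).1 (hDm j).1 (hPb j)
    (hDb j) hαi hαi
  have i2 := integrable_integral_inner_two_times hNm hVm hNb (Eventually.of_forall hVb) hαi hMi
  set G : ℝ → ℝ → ℝ := fun τ s => ν * ∑ j, ∫ x, ⟪P j τ x, D j s x⟫ ∂muOmega
    + ∫ x, ⟪N τ x, V s x⟫ ∂muOmega with hG
  have key := diagonal_identity (a := fun t s => ∫ x, ⟪v t x, havg κ (v s) x⟫ ∂muOmega) (G := G)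
    ht₀.1 ?_ ?_ ?_ ?_ ?_ ?_ ?_
  · rw [key, ← integral_indicator hIm]
    congr 2
    funext τ
    by_cases hτ : τ ∈ I <;> simp [hG, hP, hD, hN, hVdef, hτ]
  · intro t ht s hs
    rw [integral_inner_havg_comm_of_memLp hneg (hv.memLp_slice (hIcc ht))
      (hv.memLp_slice (hIcc hs))]
    simp_rw [real_inner_comm]
  · intro s hs
    exact (hv.weakly_continuous _ (memLp_havg (hv.memLp_slice (hIcc hs)))).mono fun t => hIcc
  · intro τ s (hτ : τ ∉ I)
    simp [hG, hP, hN, hτ]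
  · intro τ s (hs : s ∉ I)
    simp [hG, hD, hVdef, hs]
  · exact ((integrable_finsetSum _ fun j _ => i1 j).const_mul ν).add i2
  · have hVT := hv.memV
    rw [ae_restrict_iff' measurableSet_Ioo] at hVT
    filter_upwards [hVT, eventually_countable_forall.mpr fun j => (i1 j).prod_left_ae,
      i2.prod_left_ae] with s hsV hs1 hs2 (hs : s ∈ I) t ht
    have hχ := hv.memLp_slice (hIT hs)
    have hχV := hsV ⟨hs.1, hs.2.trans_le ht₀.2⟩
    rw [hv.averaged_identity hν hT hκ hneg hχ hχV (hIcc ht),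
      hv.averaged_identity hν hT hκ hneg hχ hχV h0T]
    simp only [lt_self_iff_false, not_false_eq_true, Ioo_eq_empty, Measure.restrict_empty,
      integral_zero_measure, Finset.sum_const_zero, mul_zero, add_zero, sub_zero]
    congr 1
    rw [hG, integral_add ((integrable_finsetSum _ fun j _ => (hs1 j)).const_mul ν).restrict
      hs2.restrict, integral_const_mul, integral_finsetSum _ fun j _ => (hs1 j).restrict]
    have hmem : ∀ τ ∈ Ioo 0 t, τ ∈ I := fun τ hτ => ⟨hτ.1, hτ.2.trans_le ht.2⟩
    congr 1
    · congr 1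
      refine Finset.sum_congr rfl fun j _ => setIntegral_congr_fun measurableSet_Ioo fun τ hτ => ?_
      simp only [hP, hD, indicator_of_mem (hmem τ hτ), indicator_of_mem hs]
    · refine setIntegral_congr_fun measurableSet_Ioo fun τ hτ => ?_
      simp only [hN, hVdef, indicator_of_mem (hmem τ hτ), indicator_of_mem hs]
  · have c1 := fun j => integral_inner_time_shift (hPm j) (hDm j)
    have c2 := integral_inner_time_shift_of_weaklyContinuous (I := I) hNm hVm hNb hαi
      (fun τ hτ => by simp [hN, hτ]) hVM ?_
    · have e : ∀ σ, ∫ τ, G τ (τ + σ) = ν * ∑ j, (∫ τ, ∫ x, ⟪P j τ x, D j (τ + σ) x⟫ ∂muOmega)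
          + ∫ τ, ∫ x, ⟪N τ x, V (τ + σ) x⟫ ∂muOmega := fun σ => by
        rw [hG, integral_add ((integrable_finsetSum _ fun j _ => (c1 j).1 σ).const_mul ν) (c2.1 σ),
          integral_const_mul, integral_finsetSum _ fun j _ => (c1 j).1 σ]
      simp_rw [e]
      exact ((continuous_finsetSum _ fun j _ => (c1 j).2).const_mul ν).continuousAt.add c2.2
    · intro ψ hψ τ hτ
      have hc := (hv.weakly_continuous ψ hψ).continuousAt
        (Icc_mem_nhds hτ.1 (hτ.2.trans_le ht₀.2))
      refine hc.congr ?_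
      filter_upwards [isOpen_Ioo.mem_nhds hτ] with s hs
      simp only [hVdef, hI, indicator_of_mem hs]

end Balance

/-! ### Small disks, the commutator estimate and the energy equality -/

/-- The uniform distribution on a small disk is an admissible averaging weight. -/
lemma exists_symmetric_weight {ε : ℝ} (hε : 0 < ε) : ∃ κ : Measure E2, IsProbabilityMeasure κ ∧
    MeasurePreserving (fun y : E2 => -y) κ κ ∧ (∃ C : ℝ≥0, κ ≤ (C : ℝ≥0∞) • volume) ∧
    ∀ᵐ y ∂κ, ‖y‖ ≤ ε := by
  have h0 : volume (Metric.ball (0 : E2) ε) ≠ 0 := (Metric.measure_ball_pos volume 0 hε).ne'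
  have hm : MeasurableSet (Metric.ball (0 : E2) ε) := measurableSet_ball
  refine ⟨ProbabilityTheory.cond volume (Metric.ball 0 ε),
    ProbabilityTheory.cond_isProbabilityMeasure_of_finite h0 measure_ball_lt_top.ne, ?_, ?_, ?_⟩
  · have h := (Measure.measurePreserving_neg (volume : Measure E2)).restrict_preimage hm
    have e : (Neg.neg : E2 → E2) ⁻¹' Metric.ball 0 ε = Metric.ball 0 ε := by ext y; simp
    rw [e] at h
    exact h.smul_measure _
  · refine ⟨(volume (Metric.ball (0 : E2) ε))⁻¹.toNNReal, ?_⟩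
    rw [ENNReal.coe_toNNReal (ENNReal.inv_ne_top.mpr h0), ProbabilityTheory.cond]
    gcongr
    exact Measure.restrict_le_self
  · refine Measure.ae_smul_measure ?_ _
    filter_upwards [ae_restrict_mem hm] with y hy
    exact (mem_ball_zero_iff.mp hy).le

/-- Averages over shrinking disks converge to the identity. -/
lemma tendsto_integral_inner_havg {κ : ℕ → Measure E2} [∀ n, IsProbabilityMeasure (κ n)]
    {ε : ℕ → ℝ} (hε : Tendsto ε atTop (𝓝 0)) (hκ : ∀ n, ∀ᵐ y ∂(κ n), ‖y‖ ≤ ε n) {u : E3 → E3}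
    (hu : MemLp u 2 muOmega) :
    Tendsto (fun n => ∫ x, ⟪u x, havg (κ n) u x⟫ ∂muOmega) atTop (𝓝 (normSq u)) := by
  let g : E2 → C(E3, E3) := fun y => ⟨fun x => x + hz y, by fun_prop⟩
  have hg : Continuous g := by
    refine ContinuousMap.continuous_of_continuous_uncurry _ ?_
    change Continuous fun q : E2 × E3 => q.2 + hz q.1
    fun_prop
  have hF := continuous_integral_inner_comp hg measurePreserving_add_hz hu hu
  set F : E2 → ℝ := fun y => ∫ x, ⟪u x, u (g y x)⟫ ∂muOmega with hFdef
  have hF0 : F 0 = normSq u := by simp [hFdef, g, normSq]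
  rw [Metric.tendsto_atTop]
  intro η hη
  obtain ⟨δ, hδ, hδF⟩ := Metric.continuousAt_iff.mp hF.continuousAt (η / 2) (half_pos hη)
  obtain ⟨n₀, hn₀⟩ := (Metric.tendsto_atTop.mp hε) δ hδ
  refine ⟨n₀, fun n hn => ?_⟩
  have hi := integrable_inner_translate_of_memLp_slice (κ := κ n) hu hu
  have hFi : Integrable F (κ n) := hi.integral_prod_right
  rw [← integral_inner_havg_eq (ae_integrable_add_hz_of_memLp_two hu) hi, ← hF0]
  change dist (∫ y, F y ∂(κ n)) (F 0) < η
  have e : (∫ y, F y ∂(κ n)) - F 0 = ∫ y, (F y - F 0) ∂(κ n) := by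
    rw [integral_sub hFi (integrable_const _)]; simp
  rw [Real.dist_eq, e, ← Real.norm_eq_abs]
  refine lt_of_le_of_lt (norm_integral_le_of_norm_le_const (C := η / 2) ?_) ?_
  · filter_upwards [hκ n] with y hy
    refine (hδF (x := y) ?_).le
    have := hn₀ n hn
    rw [Real.dist_eq, sub_zero] at this
    rw [dist_zero_right]
    exact hy.trans_lt ((le_abs_self _).trans_lt this)
  · simpa using hη

lemma quasiMeasurePreserving_height :
    Measure.QuasiMeasurePreserving (fun x : E3 => x 2) muOmega (volume.restrict (Ioi (0 : ℝ))) := by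
  have hm : Measurable fun x : E3 => x 2 := by fun_prop
  refine ⟨hm, Measure.AbsolutelyContinuous.mk fun s hs h0 => ?_⟩
  rw [Measure.map_apply hm hs, ← lintegral_indicator_one (hm hs),
    lintegral_muOmega_eq (measurable_one.indicator (hm hs))]
  have e : ∀ (z : ℝ) (y : E2), ((fun x : E3 => x 2) ⁻¹' s).indicator (1 : E3 → ℝ≥0∞) (point y z) =
      s.indicator (fun _ => 1) z := fun z y => by
    by_cases hz : z ∈ s <;> simp [Set.indicator, point, hz]
  simp_rw [e]
  have h1 : ∀ᵐ z ∂(volume.restrict (Ioi (0 : ℝ))), z ∉ s := measure_eq_zero_iff_ae_notMem.mp h0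
  rw [lintegral_eq_zero_of_ae_eq_zero]
  filter_upwards [h1] with z hz
  simp [hz]

section Commutator

variable {κ : Measure E2} [IsProbabilityMeasure κ] {u : E3 → E3} {Du : Fin 3 → E3 → E3}
  {om : ℝ → ℝ} {ε : ℝ}

lemma HorModulus.ae_norm_sub_le {w : E3 → E3} (hw : HorModulus om w) (hwu : w =ᵐ[muOmega] u)
    (hnn : ∀ s, 0 < s → 0 ≤ om s) (hmono : MonotoneOn om (Ioi 0)) (hε : 0 < ε)
    (hκ : ∀ᵐ y ∂κ, ‖y‖ ≤ ε) :
    ∀ᵐ q ∂(muOmega.prod κ), ‖u (q.1 + hz q.2) - u q.1‖ ≤ om ε := by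
  have hfst : Measure.QuasiMeasurePreserving (Prod.fst : E3 × E2 → E3) (muOmega.prod κ) muOmega :=
    Measure.quasiMeasurePreserving_fst
  filter_upwards [hfst.ae hwu, (measurePreserving_skew κ).quasiMeasurePreserving.ae (hfst.ae hwu),
    hfst.ae (quasiMeasurePreserving_height.ae hw), Measure.quasiMeasurePreserving_snd.ae hκ]
    with q h1 h2 h3 h4
  rw [← h1, ← h2]
  by_cases hy : q.2 = 0
  · simpa [hy] using hnn ε hε
  · have e1 := eq_point q.1
    have h5 := h3 (!₂[q.1 0, q.1 1] + q.2) !₂[q.1 0, q.1 1] (by simpa using hy)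
    rw [← point_add_hz, ← e1, add_sub_cancel_left] at h5
    exact h5.trans (hmono (norm_pos_iff.mpr hy) hε h4)

/-- As the trilinear form vanishes on `(u, u, u)`, only the difference of `u` and its horizontal
average is paired with the convective term; it is controlled by the horizontal modulus. -/
lemma MemV.abs_integral_inner_havg_convect_le (hu : MemLp u 2 muOmega) (hV : MemV u Du)
    (hneg : MeasurePreserving (fun y : E2 => -y) κ κ) {δ : ℝ} (hδ0 : 0 ≤ δ)
    (hδ : ∀ᵐ q ∂(muOmega.prod κ), ‖u (q.1 + hz q.2) - u q.1‖ ≤ δ) :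
    |∫ x, ⟪havg κ (convect u Du) x, u x⟫ ∂muOmega| ≤
      δ * (lpNorm u 2 muOmega * ∑ j, lpNorm (Du j) 2 muOmega) := by
  obtain ⟨hi, h0⟩ := hV.integral_inner_convect_self hu
  have hD := hV.grad_memLp
  have hgm : AEStronglyMeasurable (convect u Du) muOmega :=
    aestronglyMeasurable_convect hu.1 fun j => (hD j).1
  have hum : MemLp (fun q : E3 × E2 => u (q.1 + hz q.2)) 2 (muOmega.prod κ) :=
    (hu.comp_fst κ).comp_measurePreserving (measurePreserving_skew κ)
  have hle : ∀ x, ‖convect u Du x‖ ≤ ∑ j, ‖u x‖ * ‖Du j x‖ := fun x => by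
    refine (norm_sum_le _ _).trans (Finset.sum_le_sum fun j _ => ?_)
    rw [norm_smul]
    gcongr
    exact PiLp.norm_apply_le _ _
  have hprod : ∀ j, Integrable (fun x => ‖u x‖ * ‖Du j x‖) muOmega := fun j =>
    MemLp.integrable_mul hu.norm (hD j).norm
  have hsum : Integrable (fun x => ∑ j, ‖u x‖ * ‖Du j x‖) muOmega :=
    integrable_finsetSum _ fun j _ => hprod j
  have hg : Integrable (convect u Du) muOmega :=
    Integrable.mono' hsum hgm (Eventually.of_forall hle)
  have hint : Integrable (fun q : E3 × E2 => ⟪convect u Du q.1, u (q.1 + hz q.2)⟫)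
      (muOmega.prod κ) := by
    have h1 : Integrable (fun q : E3 × E2 => ⟪convect u Du q.1, u (q.1 + hz q.2) - u q.1⟫)
        (muOmega.prod κ) := by
      refine Integrable.mono' ((hg.comp_fst κ).norm.mul_const δ)
        ((hg.comp_fst κ).1.inner (hum.1.sub (hu.comp_fst κ).1)) ?_
      filter_upwards [hδ] with q hq
      exact (norm_inner_le_norm _ _).trans (by gcongr)
    refine (h1.add (hi.comp_fst κ)).congr (Eventually.of_forall fun q => ?_)
    simp [inner_sub_right]
  have hua := ae_integrable_add_hz_of_memLp_two (κ := κ) hu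
  have hdiff : ∀ᵐ x ∂muOmega, ‖havg κ u x - u x‖ ≤ δ := by
    filter_upwards [Measure.ae_ae_of_ae_prod hδ, hua] with x hx hxi
    have e : havg κ u x - u x = ∫ y, (u (x + hz y) - u x) ∂κ := by
      rw [integral_sub hxi (integrable_const _)]; simp [havg]
    rw [e]
    simpa using norm_integral_le_of_norm_le_const hx
  have hbd : ∀ᵐ x ∂muOmega, ‖⟪convect u Du x, havg κ u x - u x⟫‖ ≤
      δ * ∑ j, ‖u x‖ * ‖Du j x‖ := by
    filter_upwards [hdiff] with x hx
    rw [mul_comm δ]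
    refine (norm_inner_le_norm _ _).trans (mul_le_mul (hle x) hx (norm_nonneg _) ?_)
    exact Finset.sum_nonneg fun j _ => by positivity
  have hdi : Integrable (fun x => ⟪convect u Du x, havg κ u x - u x⟫) muOmega :=
    Integrable.mono' (hsum.const_mul δ)
      (hgm.inner ((memLp_havg hu).1.sub hu.1)) hbd
  -- move the average to the other factor and subtract `((u · ∇) u, u) = 0`
  have e : ∫ x, ⟪havg κ (convect u Du) x, u x⟫ ∂muOmega =
      ∫ x, ⟪convect u Du x, havg κ u x - u x⟫ ∂muOmega := by
    rw [← integral_inner_havg_comm hneg (ae_integrable_add_hz_of_integrable hg) hua hint,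
      ← add_zero (∫ x, ⟪convect u Du x, havg κ u x - u x⟫ ∂muOmega), ← h0, ← integral_add hdi hi]
    simp [inner_sub_right]
  rw [e, ← Real.norm_eq_abs]
  refine (norm_integral_le_of_norm_le (hsum.const_mul δ) hbd).trans ?_
  rw [integral_const_mul, integral_finsetSum _ fun j _ => hprod j,
    Finset.mul_sum _ _ (lpNorm u 2 muOmega)]
  exact mul_le_mul_of_nonneg_left
    (Finset.sum_le_sum fun j _ => integral_norm_mul_norm_le hu (hD j)) hδ0

end Commutator

section Energy

variable {ν T : ℝ} {v₀ : E3 → E3} {v : ℝ → E3 → E3} {Dv : Fin 3 → ℝ → E3 → E3}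

/-- The weakly continuous representative starts from the initial datum. -/
lemma IsLerayHopf.normSq_zero (hT : 0 < T) (hv : IsLerayHopf ν T v₀ v Dv) :
    normSq (v 0) = normSq v₀ := by
  have h0T : (0 : ℝ) ∈ Icc 0 T := ⟨le_rfl, hT.le⟩
  have hv0 := hv.memLp_slice h0T
  have hw := hv.initial_memH.1
  -- the weak limit of `v(t)` as `t → 0` is `v(0)`, the strong limit is `v₀`
  have hpair : ∀ {ψ : E3 → E3}, MemLp ψ 2 muOmega →
      ∫ x, ⟪v 0 x, ψ x⟫ ∂muOmega = ∫ x, ⟪v₀ x, ψ x⟫ ∂muOmega := by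
    intro ψ hψ
    set t : ℕ → ℝ := fun n => T / (n + 2) with ht
    have htpos : ∀ n, 0 < t n := fun n => by positivity
    have htlt : ∀ n, t n ≤ T := fun n => by
      have : (0 : ℝ) ≤ n := Nat.cast_nonneg n
      rw [ht, div_le_iff₀ (by positivity)]
      nlinarith
    have htl : Tendsto t atTop (𝓝 0) :=
      tendsto_const_nhds.div_atTop
        (tendsto_atTop_add_const_right _ _ tendsto_natCast_atTop_atTop)
    have l1 : Tendsto (fun n => ∫ x, ⟪v (t n) x, ψ x⟫ ∂muOmega) atTop
        (𝓝 (∫ x, ⟪v 0 x, ψ x⟫ ∂muOmega)) :=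
      (hv.weakly_continuous ψ hψ 0 h0T).tendsto.comp (tendsto_nhdsWithin_iff.mpr
        ⟨htl, Eventually.of_forall fun n => ⟨(htpos n).le, htlt n⟩⟩)
    have l2 := tendsto_integral_inner hψ hw
      (φ := fun n => v (t n)) (fun n => hv.memLp_slice ⟨(htpos n).le, htlt n⟩)
      ((hv.initial_attained.comp (tendsto_nhdsWithin_iff.mpr
        ⟨htl, Eventually.of_forall htpos⟩)).congr fun n => by
          simp only [Function.comp_apply]
          rw [← eLpNorm_neg, neg_sub])
    simp_rw [real_inner_comm _ (ψ _)] at l2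
    exact tendsto_nhds_unique l1 l2
  have e1 : ∫ x, ⟪v 0 x, v₀ x⟫ ∂muOmega = ∫ x, ⟪v₀ x, v 0 x⟫ ∂muOmega := by
    simp_rw [real_inner_comm]
  have e2 := (hpair hv0).trans (e1.symm.trans (hpair hw))
  simpa only [normSq, ← real_inner_self_eq_norm_sq] using e2

/-- The transport contribution to the averaged balance is at most the modulus at the radius of the
averages times a function that is integrable in time. -/
lemma IsLerayHopf.abs_integral_inner_havg_convTerm_le (hν : 0 < ν)
    (hv : IsLerayHopf ν T v₀ v Dv) {om : ℝ → ℝ} (hom : IsModulus om) {τ : ℝ} (hτ : τ ∈ Icc 0 T)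
    (hV : MemV (v τ) fun j => Dv j τ) {c : ℝ} (hc : 0 ≤ c) {w : E3 → E3} (hwv : w =ᵐ[muOmega] v τ)
    (hw : HorModulus (fun s => c * om s) w) {κ : Measure E2} [IsProbabilityMeasure κ]
    (hneg : MeasurePreserving (fun y : E2 => -y) κ κ) {ε : ℝ} (hε : 0 < ε)
    (hκ : ∀ᵐ y ∂κ, ‖y‖ ≤ ε) :
    |∫ x, ⟪havg κ (convTerm v Dv τ) x, v τ x⟫ ∂muOmega| ≤
      om ε * (3 * lpNorm v₀ 2 muOmega * (c ^ 2 + gradSq Dv τ)) := by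
  have hu := hv.memLp_slice hτ
  have hom0 := hom.nonneg ε hε
  have hδ := hw.ae_norm_sub_le (κ := κ) hwv (fun s hs => mul_nonneg hc (hom.nonneg s hs))
    (fun a ha b hb hab => mul_le_mul_of_nonneg_left (hom.mono ha hb hab) hc) hε hκ
  refine (hV.abs_integral_inner_havg_convect_le hu hneg (mul_nonneg hc hom0) hδ).trans ?_
  have hM : 0 ≤ lpNorm v₀ 2 muOmega := lpNorm_nonneg
  have h1 : c * ∑ j, lpNorm (Dv j τ) 2 muOmega ≤ 3 * (c ^ 2 + gradSq Dv τ) := by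
    have h2 : ∀ j ∈ Finset.univ, c * lpNorm (Dv j τ) 2 muOmega ≤ c ^ 2 + gradSq Dv τ :=
      fun j _ => by
        nlinarith [lpNorm_sq_le_gradSq hV.grad_memLp j,
          sq_nonneg (c - lpNorm (Dv j τ) 2 muOmega), sq_nonneg c,
          gradSq_nonneg (Dv := Dv) τ]
    rw [Finset.mul_sum]
    exact (Finset.sum_le_sum h2).trans_eq (by simp [mul_add])
  have hs : 0 ≤ c * ∑ j, lpNorm (Dv j τ) 2 muOmega :=
    mul_nonneg hc (Finset.sum_nonneg fun j _ => lpNorm_nonneg)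
  calc c * om ε * (lpNorm (v τ) 2 muOmega * ∑ j, lpNorm (Dv j τ) 2 muOmega)
      = om ε * (lpNorm (v τ) 2 muOmega * (c * ∑ j, lpNorm (Dv j τ) 2 muOmega)) := by ring
    _ ≤ om ε * (lpNorm v₀ 2 muOmega * (3 * (c ^ 2 + gradSq Dv τ))) := by
        gcongr
        exact hv.lpNorm_le hν hτ
    _ = _ := by ring

/-- The energy equality between the times `0` and `t₀`: the averaged balance, in the limit of
averages over vanishing disks. -/
theorem IsLerayHopf.energy_eq (hν : 0 < ν) (hT : 0 < T) (hv : IsLerayHopf ν T v₀ v Dv)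
    {om : ℝ → ℝ} (hom : IsModulus om) (hreg : MemL2HorModulus T om v) {t₀ : ℝ}
    (ht₀ : t₀ ∈ Ioc 0 T) :
    normSq (v 0) - normSq (v t₀) = 2 * ∫ τ in Ioo 0 t₀, ν * gradSq Dv τ := by
  obtain ⟨f, hf0, hf2, hf⟩ := hreg
  set ε : ℕ → ℝ := fun n => 1 / ((n : ℝ) + 1) with hεdef
  have hε : ∀ n, 0 < ε n := fun n => by positivity
  have hε1 : ∀ n, ε n ≤ 1 := fun n => by
    have : (0 : ℝ) ≤ n := Nat.cast_nonneg n
    rw [hεdef, div_le_one (by positivity)]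
    linarith
  have hεl : Tendsto ε atTop (𝓝 0) := tendsto_one_div_add_atTop_nhds_zero_nat
  choose κ hprob hneg hC hsmall using fun n => exists_symmetric_weight (hε n)
  choose C hC using hC
  set ρ : Measure ℝ := volume.restrict (Ioo 0 t₀) with hρ
  have hle : ρ ≤ volume.restrict (Ioo 0 T) :=
    Measure.restrict_mono (Ioo_subset_Ioo_right ht₀.2) le_rfl
  have hles : ρ.prod muOmega ≤ spaceTime T := spaceTime_mono ht₀.2
  have h0T : (0 : ℝ) ∈ Icc 0 T := ⟨le_rfl, hT.le⟩
  have hgi : Integrable (gradSq Dv) ρ := hv.integrable_gradSq.mono_measure hle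
  have hfi : Integrable (fun τ => f τ ^ 2) ρ := hf2.integrable_sq.mono_measure hle
  set b : ℝ → ℝ := fun τ => 3 * lpNorm v₀ 2 muOmega * (f τ ^ 2 + gradSq Dv τ) with hb
  have hbi : Integrable b ρ := (hfi.add hgi).const_mul _
  have hb0 : ∀ τ, 0 ≤ b τ := fun τ =>
    mul_nonneg (mul_nonneg (by norm_num) lpNorm_nonneg)
      (add_nonneg (sq_nonneg _) (gradSq_nonneg τ))
  have homl : Tendsto (fun n => om (ε n)) atTop (𝓝 0) :=
    hom.tendsto_zero.comp (tendsto_nhdsWithin_iff.mpr ⟨hεl, Eventually.of_forall hε⟩)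
  have hR : ∀ᵐ τ ∂ρ, ∀ n, |∫ x, ⟪havg (κ n) (convTerm v Dv τ) x, v τ x⟫ ∂muOmega| ≤
      om (ε n) * b τ := by
    filter_upwards [ae_mono hle hv.memV, ae_mono hle (IsLerayHopf.ae_mem T), ae_mono hle hf]
      with τ hV hτ hw n
    obtain ⟨w, hwv, hw⟩ := hw
    exact hv.abs_integral_inner_havg_convTerm_le hν hom hτ hV (hf0 τ) hwv hw (hneg n) (hε n)
      (hsmall n)
  have hDv : ∀ j, MemLp (fun p : ℝ × E3 => Dv j p.1 p.2) 2 (ρ.prod muOmega) := fun j =>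
    (hv.grad_memLp j).mono_measure hles
  have hcv : Integrable (fun p : ℝ × E3 => convTerm v Dv p.1 p.2) (ρ.prod muOmega) :=
    hv.integrable_convTerm.mono_measure hles
  have hlim : Tendsto (fun n => ∫ τ,
      (ν * ∑ j, ∫ x, ⟪havg (κ n) (Dv j τ) x, Dv j τ x⟫ ∂muOmega
        + ∫ x, ⟪havg (κ n) (convTerm v Dv τ) x, v τ x⟫ ∂muOmega) ∂ρ) atTop
      (𝓝 (∫ τ, ν * gradSq Dv τ ∂ρ)) := by
    refine tendsto_integral_of_dominated_convergence
      (fun τ => ν * gradSq Dv τ + om 1 * b τ) (fun n => ?_)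
      ((hgi.const_mul ν).add (hbi.const_mul (om 1))) (fun n => ?_) ?_
    · refine AEStronglyMeasurable.add (AEStronglyMeasurable.const_mul
        (Finset.aestronglyMeasurable_fun_sum _ fun j _ => ?_) ν) ?_
      · exact AEStronglyMeasurable.integral_prod_right'
          (f := fun p : ℝ × E3 => ⟪havg (κ n) (Dv j p.1) p.2, Dv j p.1 p.2⟫)
          ((aestronglyMeasurable_havg_time (hDv j).1).inner (hDv j).1)
      · exact AEStronglyMeasurable.integral_prod_right'
          (f := fun p : ℝ × E3 => ⟪havg (κ n) (convTerm v Dv p.1) p.2, v p.1 p.2⟫)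
          ((aestronglyMeasurable_havg_time hcv.1).inner (hv.measurable.mono_measure hles))
    · filter_upwards [hR, ae_mono hle hv.memV] with τ hRτ hV
      have h1 : |∑ j, ∫ x, ⟪havg (κ n) (Dv j τ) x, Dv j τ x⟫ ∂muOmega| ≤ gradSq Dv τ := by
        refine (Finset.abs_sum_le_sum_abs _ _).trans (Finset.sum_le_sum fun j _ => ?_)
        have hD := hV.grad_memLp j
        refine (abs_integral_inner_le (memLp_havg hD) hD).trans ?_
        rw [normSq_eq_lpNorm_sq hD.1, sq]
        exact mul_le_mul_of_nonneg_right (lpNorm_havg_le hD) lpNorm_nonneg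
      have h2 : om (ε n) * b τ ≤ om 1 * b τ :=
        mul_le_mul_of_nonneg_right (hom.mono (hε n) (mem_Ioi.mpr one_pos) (hε1 n)) (hb0 τ)
      refine (norm_add_le _ _).trans (add_le_add ?_ ((hRτ n).trans h2))
      rw [norm_mul, Real.norm_of_nonneg hν.le]
      exact mul_le_mul_of_nonneg_left h1 hν.le
    · filter_upwards [hR, ae_mono hle hv.memV] with τ hRτ hV
      have h1 : Tendsto (fun n => ∑ j, ∫ x, ⟪havg (κ n) (Dv j τ) x, Dv j τ x⟫ ∂muOmega) atTop
          (𝓝 (gradSq Dv τ)) := tendsto_finsetSum _ fun j _ => by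
        simp_rw [real_inner_comm (Dv j τ _)]
        exact tendsto_integral_inner_havg hεl hsmall (hV.grad_memLp j)
      have h2 : Tendsto (fun n => ∫ x, ⟪havg (κ n) (convTerm v Dv τ) x, v τ x⟫ ∂muOmega) atTop
          (𝓝 0) := squeeze_zero_norm hRτ (by simpa using homl.mul_const (b τ))
      simpa using (h1.const_mul ν).add h2
  have hL := (tendsto_integral_inner_havg hεl hsmall (hv.memLp_slice h0T)).sub
    (tendsto_integral_inner_havg hεl hsmall (hv.memLp_slice (Ioc_subset_Icc_self ht₀)))
  refine tendsto_nhds_unique hL ((hlim.const_mul 2).congr fun n => ?_)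
  exact (hv.averaged_energy_balance hν hT (hC n) (hneg n) ht₀).symm

end Energy
end

end HalfSpaceNS

theorem mainTheorem4 (ν T : ℝ) (hν : 0 < ν) (hT : 0 < T)
    (om : ℝ → ℝ) (hom : HalfSpaceNS.IsModulus om)
    (v₀ : HalfSpaceNS.E3 → HalfSpaceNS.E3)
    (v : ℝ → HalfSpaceNS.E3 → HalfSpaceNS.E3)
    (Dv : Fin 3 → ℝ → HalfSpaceNS.E3 → HalfSpaceNS.E3)
    (hv : HalfSpaceNS.IsLerayHopf ν T v₀ v Dv)
    (hreg : HalfSpaceNS.MemL2HorModulus T om v) :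
    HalfSpaceNS.ConservesEnergy ν T v₀ v Dv := by
  intro t ht
  rcases ht.1.eq_or_lt with rfl | h0
  · simp [HalfSpaceNS.dissipation, hv.normSq_zero hT]
  · have h := hv.energy_eq hν hT hom hreg ⟨h0, ht.2⟩
    rw [hv.normSq_zero hT, integral_const_mul, ← HalfSpaceNS.intervalIntegral_eq_Ioo ht.1] at h
    change _ + ν * ∫ τ in (0 : ℝ)..t, HalfSpaceNS.gradSq Dv τ = _
    linarith
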